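/- Let $X(0),X(1),X(2),\dots$ be a time-homogeneous Markov chain (with arbitrary initial law, on a probability space $(\Omega,\mathcal F,P)$) in a Polish (standard Borel) space $M$, with transition probability $P(x,dy)$ and $n$-step transition probabilities $P(n,x,\cdot)$. Assume the strong Doeblin condition: there are an integer $n_0>0$, a constant $C>0$ and a probability measure $\nu$ on $M$ such that $C^{-1}\nu(G)\le P(n_0,x,G)\le C\nu(G)$ for all $x\in M$ and all measurable $G\subset M$. Then the chain has a unique invariant probability measure, denoted $\mu$. Let $P_x$ and $E_x$ be the law and the expectation for the chain started at $X(0)=x$. Let $\ell\ge 1$ and let $q_1,\dots,q_\ell:(0,\infty)\to(0,\infty)$ be nondecreasing functions taking integer values at the positive integers, such that $q_1(n)=n$ for all positive integers $n$ and, for $j=2,\dots,\ell$ and every $\gamma>0$, $$\lim_{n\to\infty}\big(q_j(n)-q_j(n-1)\big)=\infty,\qquad \liminf_{n\to\infty}\big(q_j(\gamma n)-q_{j-1}(n)\big)>0$$ (limits over integers $n$). For a bounded measurable $W:M^\ell\to\mathbb R$ put $$\hat W(x)=\int\exp\big(W(x,x_2,\dots,x_\ell)\big)\,d\mu(x_2)\cdots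 d\mu(x_\ell),\qquad R(W)g(x)=\int P(x,dy)\,g(y)\,\hat W(y),$$ and let $r(W)$ be the spectral radius of the operator $R(W)$ on the Banach space of bounded measurable complex functions on $M$ with the supremum norm. (1) Let $W_\lambda$, $\lambda\in\mathbb R$, be a family of bounded measurable functions on $M^\ell$ that is differentiable in $\lambda$ at every point of $M^\ell$ and such that for every $\lambda_0$ the difference quotients $(W_\lambda-W_{\lambda_0})/(\lambda-\lambda_0)$ are bounded on $M^\ell$ uniformly over all $\lambda\ne\lambda_0$ in some neighbourhood of $\lambda_0$ (so $dW_\lambda/d\lambda$ is bounded for each $\lambda$; the condition holds whenever $dW_\lambda/d\lambda$ is bounded locally uniformly in $\lambda$). Then for every $\lambda$ and every $x\in M$ the limit $$Q(W_\lambda)=\lim_{N\to\infty}\frac1N\ln E_x\exp\Big(\sum_{n=1}^N W_\lambda\big(X(q_1(n)),\dots,X(q_\ell(n))\big)\Big)$$ exists in $\mathbb R$, does not depend on $x$, is differentiable in $\lambda$, and equals $\ln r(W_\lambda)$. (2) Let $F:M^\ell\to\mathbb R$ be bounded and measurable, $S_N=\sum_{n=1}^N F(X(q_1(n)),\dots,X(q_\ell(n)))$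 and $$J(u)=\sup_{\lambda\in\mathbb R}\big(\lambda u-\ln r(\lambda F)\big)\in(-\infty,\infty],\qquad u\in\mathbb R .$$ Then for every closed $K\subset\mathbb R$ and every open $U\subset\mathbb R$, $$\limsup_{N\to\infty}\frac1N\ln P\Big\{\frac1N S_N\in K\Big\}\le-\inf_{u\in K}J(u),\qquad \liminf_{N\to\infty}\frac1N\ln P\Big\{\frac1N S_N\in U\Big\}\ge-\inf_{u\in U}J(u),$$ with the conventions $\ln 0=-\infty$ and $\inf\emptyset=+\infty$. -/

import Mathlib

open MeasureTheory ProbabilityTheory Filter Topology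
open scoped ENNReal NNReal

namespace NonconvLD

/-- The Banach space of bounded measurable `𝕜`-valued functions on `α` with the supremum norm,
realised as the subspace of measurable elements of `ℓ^∞(α, 𝕜)`. -/
def BM (α 𝕜 : Type*) [MeasurableSpace α] [RCLike 𝕜] :
    Submodule 𝕜 (lp (fun _ : α => 𝕜) ∞) where
  carrier := {f | Measurable (f : α → 𝕜)}
  add_mem' := by
    intro f g hf hg
    simp only [Set.mem_ofPred_eq, lp.coeFn_add] at *
    exact hf.add hg
  zero_mem' := by
    simp only [Set.mem_ofPred_eq, lp.coeFn_zero]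
    exact measurable_const
  smul_mem' := by
    intro c f hf
    simp only [Set.mem_ofPred_eq, lp.coeFn_smul] at *
    exact hf.const_smul c

namespace BM

variable {α 𝕜 : Type*} [MeasurableSpace α] [RCLike 𝕜]

instance : CoeFun (BM α 𝕜) (fun _ => α → 𝕜) := ⟨fun f => ((f : lp (fun _ : α => 𝕜) ∞) : α → 𝕜)⟩

theorem measurable (f : BM α 𝕜) : Measurable (f : α → 𝕜) := f.2

theorem norm_apply_le (f : BM α 𝕜) (x : α) : ‖f x‖ ≤ ‖f‖ :=
  lp.norm_apply_le_norm ENNReal.top_ne_zero f.1 x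

/-- A measurable function that is bounded by a constant, as an element of `BM α 𝕜`. -/
def mk (f : α → 𝕜) (hf : Measurable f) (hb : ∃ C : ℝ, ∀ x, ‖f x‖ ≤ C) : BM α 𝕜 :=
  ⟨⟨f, memℓp_infty (by
    obtain ⟨C, hC⟩ := hb
    exact ⟨C, by rintro _ ⟨x, rfl⟩; exact hC x⟩)⟩, hf⟩

@[simp] theorem mk_apply (f : α → 𝕜) (hf : Measurable f) (hb : ∃ C : ℝ, ∀ x, ‖f x‖ ≤ C) (x : α) :
    mk f hf hb x = f x := rfl

@[simp] theorem add_apply (f g : BM α 𝕜) (x : α) : (f + g) x = f x + g x := rfl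

@[simp] theorem smul_apply (c : 𝕜) (f : BM α 𝕜) (x : α) : (c • f) x = c * f x := rfl

theorem ext {f g : BM α 𝕜} (h : ∀ x, f x = g x) : f = g :=
  Subtype.ext (lp.ext (funext h))

theorem norm_le {f : BM α 𝕜} {C : ℝ} (hC : 0 ≤ C) (h : ∀ x, ‖f x‖ ≤ C) : ‖f‖ ≤ C :=
  lp.norm_le_of_forall_le hC h

end BM

section Chain

variable {M : Type*} [MeasurableSpace M]

/-- The strong Doeblin condition: some power `P(n₀, x, ·)` of the transition probability satisfies
`C⁻¹ ν(G) ≤ P(n₀, x, G) ≤ C ν(G)` for all `x` and all measurable `G`, with `ν` a probability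
measure. -/
def StrongDoeblin (κ : Kernel M M) : Prop :=
  ∃ n₀ : ℕ, 0 < n₀ ∧ ∃ C : ℝ≥0, 0 < C ∧ ∃ ν : Measure M, IsProbabilityMeasure ν ∧
    ∀ (x : M) (G : Set M), MeasurableSet G →
      ((C⁻¹ : ℝ≥0) : ℝ≥0∞) * ν G ≤ (κ ^ n₀) x G ∧ (κ ^ n₀) x G ≤ (C : ℝ≥0∞) * ν G

/-- The transition probability `κ`, applied to the last point of a history
`(x₀, …, x_n)`. -/
noncomputable def stepKernel (κ : Kernel M M) (n : ℕ) : Kernel (Finset.Iic n → M) M :=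
  κ.comap (fun h => h ⟨n, Finset.mem_Iic.2 le_rfl⟩) (measurable_pi_apply _)

instance (κ : Kernel M M) [IsMarkovKernel κ] (n : ℕ) : IsMarkovKernel (stepKernel κ n) := by
  unfold stepKernel; infer_instance

/-- `X` is a (time-homogeneous) Markov chain on `(Ω, P)` with transition probability `κ` and
arbitrary initial law: the conditional law of `X (n+1)` given `X 0, …, X n` is `κ (X n)`. -/
structure IsMarkovChain {Ω : Type*} [MeasurableSpace Ω] (κ : Kernel M M) (X : ℕ → Ω → M)
    (P : Measure Ω) : Prop where
  measurable : ∀ n, Measurable (X n)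
  hasCondDistrib : ∀ n,
    HasCondDistrib (X (n + 1)) (fun ω (i : Finset.Iic n) => X i ω) (stepKernel κ n) P

/-- The law `P_x` on path space of the Markov chain with transition probability `κ` started at
`x` (Ionescu-Tulcea). -/
noncomputable def pathLaw (κ : Kernel M M) [IsMarkovKernel κ] (x : M) : Measure (ℕ → M) :=
  Kernel.trajMeasure (X := fun _ => M) (Measure.dirac x) (stepKernel κ)

/-- Sampling times `q_1, …, q_ℓ` with `ℓ = m + 1` (the index `0 : Fin (m + 1)` stands for `q_1`):
positive nondecreasing functions on `(0, ∞)`, integer valued at the positive integers, with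
`q_1(n) = n` and, for `j ≥ 2`, `q_j(n) - q_j(n-1) → ∞` and
`liminf (q_j(γ n) - q_{j-1}(n)) > 0` for each `γ > 0`. The `liminf` is taken in the extended
reals, as it may be `+∞`. -/
structure IsSamplingTimes {m : ℕ} (q : Fin (m + 1) → ℝ → ℝ) : Prop where
  pos : ∀ j t, 0 < t → 0 < q j t
  mono : ∀ j, MonotoneOn (q j) (Set.Ioi 0)
  integer : ∀ j (n : ℕ), 0 < n → ∃ k : ℕ, q j n = k
  first : ∀ n : ℕ, 0 < n → q 0 n = n
  gap : ∀ j : Fin m,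
    Tendsto (fun n : ℕ => q j.succ (n : ℝ) - q j.succ ((n : ℝ) - 1)) atTop atTop
  growth : ∀ (j : Fin m) (γ : ℝ), 0 < γ →
    0 < liminf (fun n : ℕ => ((q j.succ (γ * n) - q j.castSucc (n : ℝ) : ℝ) : EReal)) atTop

/-- The nonconventional sum `∑_{n=1}^N V(X(q_1(n)), …, X(q_ℓ(n)))` along a path. The values `q_j(n)`
are natural numbers, so the floor only changes the type. -/
noncomputable def nonconvSum {m : ℕ} (q : Fin (m + 1) → ℝ → ℝ) (V : (Fin (m + 1) → M) → ℝ)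
    (N : ℕ) (path : ℕ → M) : ℝ :=
  ∑ n ∈ Finset.Icc 1 N, V (fun j => path ⌊q j (n : ℝ)⌋₊)

/-- `Ŵ(x) = ∫ exp(W(x, x_2, …, x_ℓ)) dμ(x_2) … dμ(x_ℓ)`, with `ℓ = m + 1`. -/
noncomputable def hat (μ : Measure M) [IsProbabilityMeasure μ] {m : ℕ}
    (W : BM (Fin (m + 1) → M) ℝ) : BM M ℝ :=
  BM.mk (fun x => ∫ y : Fin m → M, Real.exp (W (Fin.cons x y)) ∂(Measure.pi fun _ => μ))
    (by
      have h : Measurable (fun p : M × (Fin m → M) =>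
          Real.exp (W (Fin.cons (α := fun _ => M) p.1 p.2))) := by
        refine Real.measurable_exp.comp ((BM.measurable W).comp ?_)
        refine measurable_pi_lambda _ fun j => ?_
        refine Fin.cases ?_ (fun i => ?_) j
        · exact measurable_fst
        · exact (measurable_pi_apply i).comp measurable_snd
      exact (h.stronglyMeasurable.integral_prod_right).measurable)
    (by
      refine ⟨Real.exp ‖W‖, fun x => ?_⟩
      have := norm_integral_le_of_norm_le_const (μ := Measure.pi fun _ : Fin m => μ)
        (f := fun y => Real.exp (W (Fin.cons x y))) (C := Real.exp ‖W‖)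
        (ae_of_all _ fun y => by
          rw [Real.norm_eq_abs, Real.abs_exp]
          exact Real.exp_le_exp.2 ((le_abs_self _).trans (BM.norm_apply_le W _)))
      simpa using this)

theorem integrable_mul (κ : Kernel M M) [IsMarkovKernel κ] (h : BM M ℝ) (g : BM M ℂ) (x : M) :
    Integrable (fun y => g y * (h y : ℂ)) (κ x) := by
  refine Integrable.of_bound (C := ‖g‖ * ‖h‖)
    ((BM.measurable g).mul (Complex.measurable_ofReal.comp (BM.measurable h))).aestronglyMeasurable
    (ae_of_all _ fun y => ?_)
  rw [norm_mul, Complex.norm_real]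
  exact mul_le_mul (BM.norm_apply_le g y) (BM.norm_apply_le h y) (norm_nonneg _) (norm_nonneg _)

theorem norm_integral_mul_le (κ : Kernel M M) [IsMarkovKernel κ] (h : BM M ℝ) (g : BM M ℂ)
    (x : M) : ‖∫ y, g y * (h y : ℂ) ∂(κ x)‖ ≤ ‖h‖ * ‖g‖ := by
  have := norm_integral_le_of_norm_le_const (μ := κ x) (f := fun y => g y * (h y : ℂ))
    (C := ‖h‖ * ‖g‖) (ae_of_all _ fun y => by
      rw [norm_mul, Complex.norm_real, mul_comm]
      exact mul_le_mul (BM.norm_apply_le h y) (BM.norm_apply_le g y) (norm_nonneg _) (norm_nonneg _))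
  simpa using this

/-- The bounded operator `g ↦ (x ↦ ∫ P(x, dy) g(y) h(y))` on the complex Banach space of bounded
measurable functions. -/
noncomputable def weightedOp (κ : Kernel M M) [IsMarkovKernel κ] (h : BM M ℝ) :
    BM M ℂ →L[ℂ] BM M ℂ :=
  LinearMap.mkContinuous
    { toFun := fun g => BM.mk (fun x => ∫ y, g y * (h y : ℂ) ∂(κ x))
        (((BM.measurable g).mul (Complex.measurable_ofReal.comp
          (BM.measurable h))).stronglyMeasurable.integral_kernel (κ := κ)).measurable
        ⟨‖h‖ * ‖g‖, norm_integral_mul_le κ h g⟩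
      map_add' := fun f g => BM.ext fun x => by
        simp only [BM.mk_apply, BM.add_apply, add_mul]
        exact integral_add (integrable_mul κ h f x) (integrable_mul κ h g x)
      map_smul' := fun c g => BM.ext fun x => by
        simp only [BM.mk_apply, BM.smul_apply, RingHom.id_apply, mul_assoc]
        exact integral_const_mul c _ }
    ‖h‖ (fun g => BM.norm_le (by positivity) (norm_integral_mul_le κ h g))

/-- `R(W) g(x) = ∫ P(x, dy) g(y) Ŵ(y)`. -/
noncomputable def R (κ : Kernel M M) [IsMarkovKernel κ] (μ : Measure M) [IsProbabilityMeasure μ]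
    {m : ℕ} (W : BM (Fin (m + 1) → M) ℝ) : BM M ℂ →L[ℂ] BM M ℂ :=
  weightedOp κ (hat μ W)

/-- The spectral radius `r(W)` of `R(W)`. -/
noncomputable def specRad (κ : Kernel M M) [IsMarkovKernel κ] (μ : Measure M)
    [IsProbabilityMeasure μ] {m : ℕ} (W : BM (Fin (m + 1) → M) ℝ) : ℝ≥0∞ :=
  spectralRadius ℂ (R κ μ W)

/-- The rate function `J(u) = sup_t (t u - ln r(t F))`, with values in the extended reals. -/
noncomputable def rate (κ : Kernel M M) [IsMarkovKernel κ] (μ : Measure M)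
    [IsProbabilityMeasure μ] {m : ℕ} (F : BM (Fin (m + 1) → M) ℝ) (u : ℝ) : EReal :=
  ⨆ t : ℝ, (((t * u : ℝ) : EReal) - ENNReal.log (specRad κ μ (t • F)))

end Chain

end NonconvLD

/-!
Write `r = r(W)` and let `L f (x) = ∫ P(x, dy) f(y) Ŵ(y)` act on real bounded measurable functions.

*The leading eigenvalue.* The Doeblin condition and the bounds on `Ŵ` squeeze `L ^ n₀ f`, for
`f ≥ 0`, between `a ∫ f dν` and `b ∫ f dν`. Applying this to `f - m u` and `m' u - f` shows that the
oscillation of `L ^ n f / L ^ n u` contracts by the factor `1 - a / b` in `n₀` steps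
(`IsDoeblinOp.contraction`). Hence `L ^ n f / L ^ n 1` converges geometrically to a positive
functional `ρ(f)`, which is a left eigenvector; its eigenvalue `r` has a positive eigenfunction, the
iterates `L ^ n 1` are comparable to `r ^ n` (`IsDoeblinOp.pow_one_bounds`), and `L - r` is bounded
below on the kernel of `ρ` (`IsDoeblinOp.exists_norm_le`). By Gelfand's formula `r` is the spectral
radius of the complex operator (`spectralRadius_weightedOp`). For `W = 0` the functional is the
integral against the invariant measure `μ`, and `P(n, x, ·)` is between `(1 - δ) μ` and `(1 + δ) μ`
for large `n` (`DoeblinBound.mixing`).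

*Differentiability.* The operators depend on the parameter differentiably only pointwise, not in
norm. If `g` is an eigenfunction of the perturbed operator, the perturbation can be written as
`L ψ`, and applying `ρ` to the eigenvalue equation gives the exact formula
`s - r = r ρ(ψ)` for the perturbed eigenvalue `s`. Since `|ρ(f)| ≤ (b / a) ∫ |f| dν`, dominated
convergence applies to the difference quotients (`DoeblinBound.differentiableAt_eigenvalue`).

*The limit.* For `n` between `ε N` and `N`, the times `q_j(n)` with `j ≥ 2` come after `N` and any
two of them are at least `k` apart once `N` is large (`IsSamplingTimes.eventually_separated`). By the
Markov property and mixing, the states at these times may be replaced by independent variables with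
law `μ`, at the cost of a factor between `(1 - δ) ^ (m N)` and `(1 + δ) ^ (m N)`
(`IsMarkovChain.lintegral_separated`). Integrating them out leaves the product of the `Ŵ(X(n))`,
whose expectation is that of `L ^ N 1 (X(0))`, hence of order `r ^ N`. The terms with `n ≤ ε N` cost
at most `exp (2 ‖W‖ (ε N + 1))` (`IsMarkovChain.compare`, `IsMarkovChain.tendsto_log_moment`).

*Large deviations.* With the limit `Λ(t) = ln r(t F)` differentiable everywhere, the bounds are those
of Gärtner and Ellis: the exponential Markov inequality and compactness above
(`HasLogMoment.limsup_le`), and, below, concentration near `Λ'(t)` under the weight `exp (t S_N)`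
(`HasLogMoment.eventually_le_prob_of_hasDerivAt`), together with the fact that a point of finite rate
is a limit of values of `Λ'` with no larger rate (`HasLogMoment.exists_exposed`).
-/

namespace NonconvLD

/-! ### Bounded measurable functions -/

namespace BM

variable {α 𝕜 : Type*} [MeasurableSpace α] [RCLike 𝕜]

/-- A shortcut for instance search, which is slow to unfold `BM`. -/
noncomputable instance : Norm (BM α 𝕜) := NormedAddCommGroup.toNorm

/-- Uniform limits of measurable functions are measurable, so `BM` is closed in `ℓ^∞`. -/
instance : CompleteSpace (BM α 𝕜) := by
  refine IsClosed.completeSpace_coe (hs := ?_)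
  refine isSeqClosed_iff_isClosed.1 fun u f hu hf => ?_
  refine measurable_of_tendsto_metrizable (f := fun n => (u n : α → 𝕜)) hu ?_
  refine tendsto_pi_nhds.2 fun x => ?_
  rw [tendsto_iff_norm_sub_tendsto_zero] at hf ⊢
  refine squeeze_zero (fun _ => norm_nonneg _) (fun n => ?_) hf
  exact lp.norm_apply_le_norm ENNReal.top_ne_zero (u n - f) x

end BM

/-- The real Banach space of bounded measurable functions. It is a type synonym of `BM α ℝ`, whose
instances are sealed to keep unification from unfolding the construction of `ℓ^∞`. -/
def RB (α : Type*) [MeasurableSpace α] : Type _ := BM α ℝ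

namespace RB

variable {α : Type*} [MeasurableSpace α]

noncomputable instance : NormedAddCommGroup (RB α) := inferInstanceAs (NormedAddCommGroup (BM α ℝ))

noncomputable instance : NormedSpace ℝ (RB α) := inferInstanceAs (NormedSpace ℝ (BM α ℝ))

instance : CompleteSpace (RB α) := inferInstanceAs (CompleteSpace (BM α ℝ))

/-- The function underlying an element of `RB α`. -/
noncomputable def toFun (f : RB α) : α → ℝ := (show BM α ℝ from f)

noncomputable instance : CoeFun (RB α) (fun _ => α → ℝ) := ⟨toFun⟩

theorem measurable (f : RB α) : Measurable (f : α → ℝ) := BM.measurable (𝕜 := ℝ) f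

theorem abs_apply_le (f : RB α) (x : α) : |f x| ≤ ‖f‖ := BM.norm_apply_le (𝕜 := ℝ) f x

/-- A bounded measurable function, as an element of `RB α`. -/
noncomputable def mk (f : α → ℝ) (hf : Measurable f) (hb : ∃ C : ℝ, ∀ x, |f x| ≤ C) : RB α :=
  BM.mk (𝕜 := ℝ) f hf hb

@[simp] theorem mk_apply (f : α → ℝ) (hf : Measurable f) (hb : ∃ C : ℝ, ∀ x, |f x| ≤ C) (x : α) :
    mk f hf hb x = f x := rfl

@[simp] theorem add_apply (f g : RB α) (x : α) : (f + g) x = f x + g x := rfl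

@[simp] theorem sub_apply (f g : RB α) (x : α) : (f - g) x = f x - g x := rfl

@[simp] theorem neg_apply (f : RB α) (x : α) : (-f) x = -f x := rfl

@[simp] theorem smul_apply (c : ℝ) (f : RB α) (x : α) : (c • f) x = c * f x := rfl

theorem ext {f g : RB α} (h : ∀ x, f x = g x) : f = g := BM.ext (𝕜 := ℝ) h

theorem norm_le {f : RB α} {C : ℝ} (hC : 0 ≤ C) (h : ∀ x, |f x| ≤ C) : ‖f‖ ≤ C :=
  BM.norm_le (𝕜 := ℝ) hC h

/-- Constant functions as elements of `RB`. -/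
noncomputable def const (α : Type*) [MeasurableSpace α] (c : ℝ) : RB α :=
  mk (fun _ => c) measurable_const ⟨|c|, fun _ => le_rfl⟩

@[simp] theorem const_apply (c : ℝ) (x : α) : const α c x = c := rfl

theorem integrable (ν : Measure α) [IsFiniteMeasure ν] (f : RB α) : Integrable (f : α → ℝ) ν :=
  Integrable.of_bound (C := ‖f‖) (measurable f).aestronglyMeasurable
    (ae_of_all _ fun x => abs_apply_le f x)

end RB

/-! ### Positive operators with a two-sided bound: leading eigenvalue and spectral gap -/

section Doeblin

variable {M : Type*} [MeasurableSpace M]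

/-- A positive operator on the real bounded measurable functions one of whose powers is squeezed
between two multiples of a fixed probability measure. -/
structure IsDoeblinOp (L : RB M →L[ℝ] RB M) (ν : Measure M) (n₀ : ℕ) (a b : ℝ) : Prop where
  prob : IsProbabilityMeasure ν
  a_pos : 0 < a
  nonneg : ∀ f : RB M, (∀ x, 0 ≤ f x) → ∀ x, 0 ≤ L f x
  one_pos : ∃ c : ℝ, 0 < c ∧ ∀ x, c ≤ L (RB.const M 1) x
  lower : ∀ f : RB M, (∀ x, 0 ≤ f x) → ∀ x, a * ∫ y, f y ∂ν ≤ (L ^ n₀) f x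
  upper : ∀ f : RB M, (∀ x, 0 ≤ f x) → ∀ x, (L ^ n₀) f x ≤ b * ∫ y, f y ∂ν

namespace IsDoeblinOp

variable {L : RB M →L[ℝ] RB M} {ν : Measure M} {n₀ : ℕ} {a b : ℝ}

theorem nonempty (hL : IsDoeblinOp L ν n₀ a b) : Nonempty M :=
  have := hL.prob
  ν.nonempty_of_neZero

theorem a_le_b (hL : IsDoeblinOp L ν n₀ a b) : a ≤ b := by
  have := hL.prob
  obtain ⟨x⟩ := hL.nonempty
  have h1 := hL.lower (RB.const M 1) (fun _ => zero_le_one' ℝ) x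
  have h2 := hL.upper (RB.const M 1) (fun _ => zero_le_one' ℝ) x
  simp only [RB.const_apply, integral_const, probReal_univ, smul_eq_mul, mul_one] at h1 h2
  exact h1.trans h2

theorem b_pos (hL : IsDoeblinOp L ν n₀ a b) : 0 < b := hL.a_pos.trans_le hL.a_le_b

theorem theta_nonneg (hL : IsDoeblinOp L ν n₀ a b) : 0 ≤ 1 - a / b := by
  have := (div_le_one hL.b_pos).2 hL.a_le_b
  linarith

theorem theta_lt_one (hL : IsDoeblinOp L ν n₀ a b) : 1 - a / b < 1 := by
  have := div_pos hL.a_pos hL.b_pos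
  linarith

theorem nonneg_pow (hL : IsDoeblinOp L ν n₀ a b) (n : ℕ) (f : RB M) (hf : ∀ x, 0 ≤ f x) :
    ∀ x, 0 ≤ (L ^ n) f x := by
  induction n with
  | zero => simpa using hf
  | succ n ih => rw [pow_succ']; exact hL.nonneg _ ih

theorem mono_pow (hL : IsDoeblinOp L ν n₀ a b) (n : ℕ) {f g : RB M} (h : ∀ x, f x ≤ g x) (x : M) :
    (L ^ n) f x ≤ (L ^ n) g x := by
  have := hL.nonneg_pow n (g - f) (fun x => by simpa using h x) x
  rw [map_sub, RB.sub_apply] at this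
  linarith

theorem pow_one_pos (hL : IsDoeblinOp L ν n₀ a b) (n : ℕ) :
    ∃ c : ℝ, 0 < c ∧ ∀ x, c ≤ (L ^ n) (RB.const M 1) x := by
  obtain ⟨c, hc, h⟩ := hL.one_pos
  refine ⟨c ^ n, by positivity, ?_⟩
  induction n with
  | zero => intro x; simp
  | succ n ih =>
    intro x
    have h1 : ∀ x, (c ^ n • RB.const M 1) x ≤ (L ^ n) (RB.const M 1) x := by
      intro x; simpa using ih x
    have h2 := hL.mono_pow 1 h1 x
    rw [pow_one, map_smul, RB.smul_apply] at h2
    rw [pow_succ' L, pow_succ]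
    refine le_trans ?_ h2
    exact mul_le_mul_of_nonneg_left (h x) (by positivity)

/-- Oscillation contraction: if `m u ≤ f ≤ m' u`, the same holds for the images under `L ^ n₀`,
with an interval shrunk by the factor `1 - a / b`. -/
theorem contraction (hL : IsDoeblinOp L ν n₀ a b) {f u : RB M} {m m' c : ℝ} (hc : 0 < c)
    (hu : ∀ x, c ≤ u x) (h : ∀ x, m * u x ≤ f x ∧ f x ≤ m' * u x) (hm : m ≤ m') :
    ∃ k k' : ℝ, k ≤ k' ∧ k' - k = (1 - a / b) * (m' - m) ∧
      ∀ x, k * (L ^ n₀) u x ≤ (L ^ n₀) f x ∧ (L ^ n₀) f x ≤ k' * (L ^ n₀) u x := by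
  have := hL.prob
  have hb := hL.b_pos
  have hνu : 0 < ∫ y, u y ∂ν := by
    refine hc.trans_le ?_
    have := integral_mono (μ := ν) (integrable_const c) (RB.integrable ν u) hu
    simpa using this
  have hu0 : ∀ x, 0 ≤ u x := fun x => hc.le.trans (hu x)
  set K := L ^ n₀ with hK
  have I1 : ∫ y, (f - m • u) y ∂ν = (∫ y, f y ∂ν) - m * ∫ y, u y ∂ν := by
    simp only [RB.sub_apply, RB.smul_apply]
    rw [integral_sub (RB.integrable ν f) ((RB.integrable ν u).const_mul m), integral_const_mul]
  have I2 : ∫ y, (m' • u - f) y ∂ν = m' * (∫ y, u y ∂ν) - ∫ y, f y ∂ν := by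
    simp only [RB.sub_apply, RB.smul_apply]
    rw [integral_sub ((RB.integrable ν u).const_mul m') (RB.integrable ν f), integral_const_mul]
  have P1 : 0 ≤ (∫ y, f y ∂ν) - m * ∫ y, u y ∂ν := by
    rw [← I1]; exact integral_nonneg fun x => by simpa using (h x).1
  have P2 : 0 ≤ m' * (∫ y, u y ∂ν) - ∫ y, f y ∂ν := by
    rw [← I2]; exact integral_nonneg fun x => by simpa using (h x).2
  set U := ∫ y, u y ∂ν
  set F := ∫ y, f y ∂ν
  refine ⟨m + a / b * ((F - m * U) / U), m' - a / b * ((m' * U - F) / U), ?_, ?_, ?_⟩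
  · have : m' - a / b * ((m' * U - F) / U) - (m + a / b * ((F - m * U) / U))
        = (1 - a / b) * (m' - m) := by field_simp; ring
    have h2 := mul_nonneg hL.theta_nonneg (sub_nonneg.2 hm)
    linarith
  · field_simp; ring
  · intro x
    have hKu : K u x ≤ b * U := hL.upper u hu0 x
    have l1 := hL.lower (f - m • u) (fun x => by simpa using (h x).1) x
    have l2 := hL.lower (m' • u - f) (fun x => by simpa using (h x).2) x
    rw [I1, map_sub, map_smul, RB.sub_apply, RB.smul_apply] at l1
    rw [I2, map_sub, map_smul, RB.sub_apply, RB.smul_apply] at l2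
    have e1 : a / b * ((F - m * U) / U) * K u x ≤ a * (F - m * U) := by
      calc a / b * ((F - m * U) / U) * K u x ≤ a / b * ((F - m * U) / U) * (b * U) := by
            refine mul_le_mul_of_nonneg_left hKu ?_
            have := hL.a_pos
            positivity
        _ = a * (F - m * U) := by field_simp
    have e2 : a / b * ((m' * U - F) / U) * K u x ≤ a * (m' * U - F) := by
      calc a / b * ((m' * U - F) / U) * K u x ≤ a / b * ((m' * U - F) / U) * (b * U) := by
            refine mul_le_mul_of_nonneg_left hKu ?_
            have := hL.a_pos
            positivity
        _ = a * (m' * U - F) := by field_simp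
    rw [← hK] at l1 l2
    constructor <;> nlinarith

/-- Iterated contraction. The interval found at time `k n₀` persists at all later times, because
`L` is positive. -/
theorem exists_interval (hL : IsDoeblinOp L ν n₀ a b) (f : RB M) (k : ℕ) :
    ∃ m m' : ℝ, m ≤ m' ∧ m' - m = (1 - a / b) ^ k * (2 * ‖f‖) ∧ ∀ n, k * n₀ ≤ n → ∀ x,
      m * (L ^ n) (RB.const M 1) x ≤ (L ^ n) f x ∧
        (L ^ n) f x ≤ m' * (L ^ n) (RB.const M 1) x := by
  suffices H : ∃ m m' : ℝ, m ≤ m' ∧ m' - m = (1 - a / b) ^ k * (2 * ‖f‖) ∧ ∀ x,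
      m * (L ^ (k * n₀)) (RB.const M 1) x ≤ (L ^ (k * n₀)) f x ∧
        (L ^ (k * n₀)) f x ≤ m' * (L ^ (k * n₀)) (RB.const M 1) x by
    obtain ⟨m, m', h1, h2, h3⟩ := H
    refine ⟨m, m', h1, h2, fun n hn x => ?_⟩
    obtain ⟨j, rfl⟩ := Nat.exists_eq_add_of_le' hn
    rw [pow_add]
    have e1 := hL.mono_pow j (f := m • (L ^ (k * n₀)) (RB.const M 1)) (fun x => (h3 x).1) x
    have e2 := hL.mono_pow j (g := m' • (L ^ (k * n₀)) (RB.const M 1)) (fun x => (h3 x).2) x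
    rw [map_smul, RB.smul_apply] at e1 e2
    exact ⟨e1, e2⟩
  induction k with
  | zero =>
    refine ⟨-‖f‖, ‖f‖, by linarith [norm_nonneg f], by ring, fun x => ?_⟩
    simpa using abs_le.1 (RB.abs_apply_le f x)
  | succ k ih =>
    obtain ⟨m, m', h1, h2, h3⟩ := ih
    obtain ⟨c, hc, hu⟩ := hL.pow_one_pos (k * n₀)
    obtain ⟨l, l', q1, q2, q3⟩ := hL.contraction hc hu h3 h1
    refine ⟨l, l', q1, by rw [q2, h2]; ring, ?_⟩
    have : (k + 1) * n₀ = n₀ + k * n₀ := by ring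
    rw [this, pow_add]
    exact q3

/-- `c` is the limit of `L ^ n f / L ^ n 1`, at the geometric rate of the oscillation
contraction. -/
def IsRatioLimit (L : RB M →L[ℝ] RB M) (n₀ : ℕ) (a b : ℝ) (f : RB M) (c A : ℝ) : Prop :=
  ∀ k n, k * n₀ ≤ n → ∀ x,
    |(L ^ n) f x - c * (L ^ n) (RB.const M 1) x| ≤
      (1 - a / b) ^ k * A * (L ^ n) (RB.const M 1) x

theorem exists_isRatioLimit (hL : IsDoeblinOp L ν n₀ a b) (f : RB M) :
    ∃ c, IsRatioLimit L n₀ a b f c (2 * ‖f‖) := by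
  choose m m' h1 h2 h3 using hL.exists_interval f
  obtain ⟨x₀⟩ := hL.nonempty
  have hmm : ∀ i j, m i ≤ m' j := by
    intro i j
    obtain ⟨c, hc, hu⟩ := hL.pow_one_pos (max (i * n₀) (j * n₀))
    have e1 := (h3 i _ (le_max_left (i * n₀) (j * n₀)) x₀).1
    have e2 := (h3 j _ (le_max_right (i * n₀) (j * n₀)) x₀).2
    exact le_of_mul_le_mul_right (e1.trans e2) (hc.trans_le (hu x₀))
  have hbdd : BddAbove (Set.range m) := ⟨m' 0, by rintro _ ⟨i, rfl⟩; exact hmm i 0⟩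
  refine ⟨⨆ i, m i, fun k n hn x => ?_⟩
  have l1 : m k ≤ ⨆ i, m i := le_ciSup hbdd k
  have l2 : ⨆ i, m i ≤ m' k := ciSup_le fun i => hmm i k
  obtain ⟨c, hc, hu⟩ := hL.pow_one_pos n
  have hu0 := hc.le.trans (hu x)
  obtain ⟨e1, e2⟩ := h3 k n hn x
  rw [← h2 k, abs_le]
  constructor <;> nlinarith

theorem IsRatioLimit.unique (hL : IsDoeblinOp L ν n₀ a b) {f : RB M} {c d A B : ℝ}
    (hc : IsRatioLimit L n₀ a b f c A) (hd : IsRatioLimit L n₀ a b f d B) : c = d := by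
  obtain ⟨x₀⟩ := hL.nonempty
  have key : ∀ k : ℕ, |c - d| ≤ (1 - a / b) ^ k * (A + B) := by
    intro k
    obtain ⟨e, he, hu⟩ := hL.pow_one_pos (k * n₀)
    have hu0 := he.trans_le (hu x₀)
    have e1 := hc k _ le_rfl x₀
    have e2 := hd k _ le_rfl x₀
    refine le_of_mul_le_mul_right ?_ hu0
    rw [← abs_of_pos hu0, ← abs_mul, abs_of_pos hu0]
    rw [abs_le] at *
    constructor <;> linarith
  have lim : Tendsto (fun k : ℕ => (1 - a / b) ^ k * (A + B)) atTop (𝓝 (0 * (A + B))) :=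
    (tendsto_pow_atTop_nhds_zero_of_lt_one hL.theta_nonneg hL.theta_lt_one).mul_const _
  rw [zero_mul] at lim
  have := ge_of_tendsto' lim key
  exact sub_eq_zero.1 (abs_eq_zero.1 (le_antisymm this (abs_nonneg _)))

theorem IsRatioLimit.add {f g : RB M} {c d A B : ℝ}
    (hc : IsRatioLimit L n₀ a b f c A) (hd : IsRatioLimit L n₀ a b g d B) :
    IsRatioLimit L n₀ a b (f + g) (c + d) (A + B) := by
  intro k n hn x
  have e1 := hc k n hn x
  have e2 := hd k n hn x
  rw [map_add, RB.add_apply]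
  rw [abs_le] at *
  constructor <;> linarith

theorem IsRatioLimit.smul {f : RB M} {c A : ℝ} (t : ℝ)
    (hc : IsRatioLimit L n₀ a b f c A) :
    IsRatioLimit L n₀ a b (t • f) (t * c) (|t| * A) := by
  intro k n hn x
  have e1 := mul_le_mul_of_nonneg_left (hc k n hn x) (abs_nonneg t)
  rw [← abs_mul] at e1
  rw [map_smul, RB.smul_apply]
  calc _ = |t * ((L ^ n) f x - c * (L ^ n) (RB.const M 1) x)| := by ring_nf
    _ ≤ _ := e1
    _ = _ := by ring

theorem IsRatioLimit.nonneg (hL : IsDoeblinOp L ν n₀ a b) {f : RB M} {c A : ℝ}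
    (hc : IsRatioLimit L n₀ a b f c A) (hf : ∀ x, 0 ≤ f x) : 0 ≤ c := by
  obtain ⟨x₀⟩ := hL.nonempty
  have key : ∀ k : ℕ, -c ≤ (1 - a / b) ^ k * A := by
    intro k
    obtain ⟨e, he, hu⟩ := hL.pow_one_pos (k * n₀)
    have hu0 := he.trans_le (hu x₀)
    have e1 := (abs_le.1 (hc k _ le_rfl x₀)).2
    have e2 := hL.nonneg_pow (k * n₀) f hf x₀
    refine le_of_mul_le_mul_right ?_ hu0
    linarith
  have lim : Tendsto (fun k : ℕ => (1 - a / b) ^ k * A) atTop (𝓝 (0 * A)) :=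
    (tendsto_pow_atTop_nhds_zero_of_lt_one hL.theta_nonneg hL.theta_lt_one).mul_const _
  rw [zero_mul] at lim
  have := ge_of_tendsto' lim key
  linarith

/-- The positive functional `ρ` with `ρ(f) = lim L ^ n f / L ^ n 1`; it is the left eigenvector of
`L` for its leading eigenvalue, normalised by `ρ(1) = 1`. -/
noncomputable def functional (hL : IsDoeblinOp L ν n₀ a b) : RB M →ₗ[ℝ] ℝ where
  toFun f := (hL.exists_isRatioLimit f).choose
  map_add' f g := IsRatioLimit.unique hL (hL.exists_isRatioLimit (f + g)).choose_spec
    ((hL.exists_isRatioLimit f).choose_spec.add (hL.exists_isRatioLimit g).choose_spec)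
  map_smul' t f := IsRatioLimit.unique hL (hL.exists_isRatioLimit (t • f)).choose_spec
    ((hL.exists_isRatioLimit f).choose_spec.smul t)

theorem isRatioLimit_functional (hL : IsDoeblinOp L ν n₀ a b) (f : RB M) :
    IsRatioLimit L n₀ a b f (hL.functional f) (2 * ‖f‖) :=
  (hL.exists_isRatioLimit f).choose_spec

theorem functional_one (hL : IsDoeblinOp L ν n₀ a b) : hL.functional (RB.const M 1) = 1 :=
  IsRatioLimit.unique hL (A := 2 * ‖RB.const M 1‖) (B := 0) (hL.isRatioLimit_functional _)
    (fun k n _ x => by simp)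

theorem functional_nonneg (hL : IsDoeblinOp L ν n₀ a b) {f : RB M} (hf : ∀ x, 0 ≤ f x) :
    0 ≤ hL.functional f :=
  (hL.isRatioLimit_functional f).nonneg hL hf

theorem functional_mono (hL : IsDoeblinOp L ν n₀ a b) {f g : RB M} (h : ∀ x, f x ≤ g x) :
    hL.functional f ≤ hL.functional g := by
  have := hL.functional_nonneg (f := g - f) (fun x => by simpa using h x)
  rw [map_sub] at this
  linarith

theorem functional_const (hL : IsDoeblinOp L ν n₀ a b) (c : ℝ) :
    hL.functional (RB.const M c) = c := by
  have : RB.const M c = c • RB.const M 1 := RB.ext fun x => by simp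
  rw [this, map_smul, functional_one, smul_eq_mul, mul_one]

theorem abs_functional_le_of_le (hL : IsDoeblinOp L ν n₀ a b) {f g : RB M}
    (h : ∀ x, |f x| ≤ g x) : |hL.functional f| ≤ hL.functional g := by
  rw [abs_le, ← map_neg]
  exact ⟨hL.functional_mono fun x => by simpa using (abs_le.1 (h x)).1,
    hL.functional_mono fun x => (abs_le.1 (h x)).2⟩

theorem abs_functional_le (hL : IsDoeblinOp L ν n₀ a b) (f : RB M) :
    |hL.functional f| ≤ ‖f‖ := by
  rw [← hL.functional_const ‖f‖]
  exact hL.abs_functional_le_of_le fun x => RB.abs_apply_le f x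

/-- The leading eigenvalue of `L`. -/
noncomputable def eigenvalue (hL : IsDoeblinOp L ν n₀ a b) : ℝ :=
  hL.functional (L (RB.const M 1))

theorem eigenvalue_pos (hL : IsDoeblinOp L ν n₀ a b) : 0 < hL.eigenvalue := by
  obtain ⟨c, hc, h⟩ := hL.one_pos
  refine hc.trans_le ?_
  rw [← hL.functional_const c]
  exact hL.functional_mono h

theorem functional_map (hL : IsDoeblinOp L ν n₀ a b) (f : RB M) :
    hL.functional (L f) = hL.eigenvalue * hL.functional f := by
  set c := hL.functional f
  set r := hL.eigenvalue
  set A := 2 * ‖f‖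
  set B := 2 * ‖L (RB.const M 1)‖
  refine IsRatioLimit.unique hL (B := A * ‖L (RB.const M 1)‖ + |c| * B)
    (hL.isRatioLimit_functional (L f)) fun k n hn x => ?_
  have hpow : ∀ g : RB M, (L ^ n) (L g) = (L ^ (n + 1)) g := fun g => by rw [pow_succ]; rfl
  have e1 := hL.isRatioLimit_functional f k (n + 1) (hn.trans n.le_succ) x
  have e2 := hL.isRatioLimit_functional (L (RB.const M 1)) k n hn x
  have hle : (L ^ (n + 1)) (RB.const M 1) x ≤ ‖L (RB.const M 1)‖ * (L ^ n) (RB.const M 1) x := by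
    rw [← hpow]
    have := hL.mono_pow n (f := L (RB.const M 1)) (g := ‖L (RB.const M 1)‖ • RB.const M 1)
      (fun x => by simpa using (le_abs_self _).trans (RB.abs_apply_le _ x)) x
    rwa [map_smul, RB.smul_apply] at this
  have hθ : 0 ≤ (1 - a / b) ^ k * A := mul_nonneg (pow_nonneg hL.theta_nonneg k) (by positivity)
  have e3 := e1.trans (mul_le_mul_of_nonneg_left hle hθ)
  have e4 := mul_le_mul_of_nonneg_left e2 (abs_nonneg c)
  rw [← abs_mul] at e4
  rw [hpow] at e4 ⊢
  calc _ = |((L ^ (n + 1)) f x - c * (L ^ (n + 1)) (RB.const M 1) x)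
        + c * ((L ^ (n + 1)) (RB.const M 1) x - r * (L ^ n) (RB.const M 1) x)| := by ring_nf
    _ ≤ _ := abs_add_le _ _
    _ ≤ _ := add_le_add e3 e4
    _ = _ := by ring

theorem functional_map_pow (hL : IsDoeblinOp L ν n₀ a b) (n : ℕ) (f : RB M) :
    hL.functional ((L ^ n) f) = hL.eigenvalue ^ n * hL.functional f := by
  induction n with
  | zero => simp
  | succ n ih => rw [pow_succ', mul_apply_eq_comp, functional_map, ih]; ring

/-- The functional `ρ` is dominated by `ν`; this replaces its countable additivity. -/
theorem abs_functional_le_integral (hL : IsDoeblinOp L ν n₀ a b) (f : RB M) :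
    |hL.functional f| ≤ b / a * ∫ y, |f y| ∂ν := by
  have := hL.prob
  have ha := hL.a_pos
  set g : RB M := RB.mk (fun x => |f x|) (RB.measurable f).abs
    ⟨‖f‖, fun x => by simpa using RB.abs_apply_le f x⟩
  have hg : ∀ x, 0 ≤ g x := fun x => abs_nonneg _
  refine (hL.abs_functional_le_of_le (g := g) fun x => le_rfl).trans ?_
  change _ ≤ b / a * ∫ y, g y ∂ν
  have e1 : hL.eigenvalue ^ n₀ * hL.functional g ≤ b * ∫ y, g y ∂ν := by
    rw [← functional_map_pow, ← hL.functional_const (b * ∫ y, g y ∂ν)]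
    exact hL.functional_mono (hL.upper g hg)
  have e2 : a ≤ hL.eigenvalue ^ n₀ := by
    have : hL.functional ((L ^ n₀) (RB.const M 1)) = hL.eigenvalue ^ n₀ := by
      rw [functional_map_pow, functional_one, mul_one]
    refine (hL.functional_const a).symm.le.trans (le_of_le_of_eq ?_ this)
    refine hL.functional_mono fun x => ?_
    simpa using hL.lower (RB.const M 1) (fun _ => zero_le_one' ℝ) x
  have e3 := mul_le_mul_of_nonneg_right e2 (hL.functional_nonneg hg)
  rw [div_mul_eq_mul_div, le_div_iff₀ ha]
  linarith

/-- The iterates `L ^ n 1` are comparable to `r ^ n`, uniformly in `x` and `n`. -/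
theorem pow_one_bounds (hL : IsDoeblinOp L ν n₀ a b) {n : ℕ} (hn : n₀ ≤ n) (x : M) :
    a / b * hL.eigenvalue ^ n ≤ (L ^ n) (RB.const M 1) x ∧
      (L ^ n) (RB.const M 1) x ≤ b / a * hL.eigenvalue ^ n := by
  have ha := hL.a_pos
  have hb := hL.b_pos
  obtain ⟨j, rfl⟩ := Nat.exists_eq_add_of_le hn
  set u := (L ^ j) (RB.const M 1) with hu
  have hu0 : ∀ x, 0 ≤ u x := hL.nonneg_pow j _ fun _ => zero_le_one' ℝ
  have hpow : (L ^ (n₀ + j)) (RB.const M 1) = (L ^ n₀) u := by rw [pow_add]; rfl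
  have hρ : hL.functional ((L ^ n₀) u) = hL.eigenvalue ^ (n₀ + j) := by
    rw [← hpow, functional_map_pow, functional_one, mul_one]
  have e1 : a * ∫ y, u y ∂ν ≤ hL.eigenvalue ^ (n₀ + j) := by
    rw [← hρ, ← hL.functional_const (a * ∫ y, u y ∂ν)]
    exact hL.functional_mono (hL.lower u hu0)
  have e2 : hL.eigenvalue ^ (n₀ + j) ≤ b * ∫ y, u y ∂ν := by
    rw [← hρ, ← hL.functional_const (b * ∫ y, u y ∂ν)]
    exact hL.functional_mono (hL.upper u hu0)
  have l1 := hL.lower u hu0 x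
  have l2 := hL.upper u hu0 x
  rw [hpow]
  constructor
  · rw [div_mul_eq_mul_div, div_le_iff₀ hb]
    nlinarith
  · rw [div_mul_eq_mul_div, le_div_iff₀ ha]
    nlinarith

theorem norm_pow_le_of_functional_eq_zero (hL : IsDoeblinOp L ν n₀ a b) {k n : ℕ} (hk : k * n₀ ≤ n)
    (hn : n₀ ≤ n) {f : RB M} (hf : hL.functional f = 0) :
    ‖(L ^ n) f‖ ≤ (1 - a / b) ^ k * (2 * ‖f‖) * (b / a * hL.eigenvalue ^ n) := by
  have ha := hL.a_pos
  have hb := hL.b_pos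
  have hr := hL.eigenvalue_pos
  have hθ := hL.theta_nonneg
  refine RB.norm_le (by positivity) fun x => ?_
  have e1 := hL.isRatioLimit_functional f k n hk x
  rw [hf, zero_mul, sub_zero] at e1
  refine e1.trans (mul_le_mul_of_nonneg_left (hL.pow_one_bounds hn x).2 (by positivity))

/-- Existence of a leading eigenfunction, bounded away from zero. -/
theorem exists_eigenfunction (hL : IsDoeblinOp L ν n₀ a b) :
    ∃ g : RB M, L g = hL.eigenvalue • g ∧ hL.functional g = 1 ∧
      ∀ x, a / b ≤ g x ∧ g x ≤ b / a := by
  have ha := hL.a_pos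
  have hb := hL.b_pos
  have hr := hL.eigenvalue_pos
  have hθ := hL.theta_nonneg
  set r := hL.eigenvalue with hrdef
  set v : ℕ → RB M := fun k => (r ^ ((k + 1) * n₀))⁻¹ • (L ^ ((k + 1) * n₀)) (RB.const M 1)
    with hv
  -- iterates of a function in the kernel of the functional decay geometrically
  have decay : ∀ f : RB M, hL.functional f = 0 → ∀ k : ℕ,
      ‖(r ^ ((k + 1) * n₀))⁻¹ • (L ^ ((k + 1) * n₀)) f‖ ≤
        2 * ‖f‖ * (b / a) * (1 - a / b) ^ k := by
    intro f hf k
    have h1 := hL.norm_pow_le_of_functional_eq_zero (k := k) (n := (k + 1) * n₀)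
      (by nlinarith) (by nlinarith) hf
    rw [norm_smul, norm_inv, Real.norm_of_nonneg (by positivity)]
    calc _ ≤ (r ^ ((k + 1) * n₀))⁻¹ * ((1 - a / b) ^ k * (2 * ‖f‖) *
          (b / a * r ^ ((k + 1) * n₀))) := by gcongr
      _ = _ := by field_simp
  have hcauchy : CauchySeq v := by
    -- the increments of `v` are normalised iterates of this function
    set f : RB M := RB.const M 1 - (r ^ n₀)⁻¹ • (L ^ n₀) (RB.const M 1) with hf
    have hρ : hL.functional f = 0 := by
      rw [hf, map_sub, map_smul, functional_map_pow, functional_one, smul_eq_mul, mul_one,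
        inv_mul_cancel₀ (by positivity), sub_self]
    refine cauchySeq_of_le_geometric (1 - a / b) (2 * ‖f‖ * (b / a)) hL.theta_lt_one fun k => ?_
    refine le_trans (le_of_eq ?_) (decay f hρ k)
    rw [dist_eq_norm]
    congr 1
    have : (k + 1 + 1) * n₀ = (k + 1) * n₀ + n₀ := by ring
    simp only [hv, hf, map_sub, map_smul, smul_sub, this, pow_add, mul_inv, mul_smul]
    rfl
  obtain ⟨g, hg⟩ := cauchySeq_tendsto_of_complete hcauchy
  have hpt : ∀ x, Tendsto (fun k => v k x) atTop (𝓝 (g x)) := by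
    intro x
    rw [tendsto_iff_norm_sub_tendsto_zero] at hg ⊢
    exact squeeze_zero (fun _ => norm_nonneg _) (fun k => RB.abs_apply_le (v k - g) x) hg
  refine ⟨g, ?_, ?_, fun x => ?_⟩
  · set f : RB M := L (RB.const M 1) - r • RB.const M 1 with hf
    have hρ : hL.functional f = 0 := by
      rw [hf, map_sub, map_smul, functional_one, smul_eq_mul, mul_one, hrdef, eigenvalue, sub_self]
    have l1 : Tendsto (fun k => L (v k) - r • v k) atTop (𝓝 (L g - r • g)) :=
      ((L.continuous.tendsto g).comp hg).sub (hg.const_smul r)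
    have l2 : Tendsto (fun k => L (v k) - r • v k) atTop (𝓝 0) := by
      refine squeeze_zero_norm (a := fun k : ℕ => 2 * ‖f‖ * (b / a) * (1 - a / b) ^ k)
        (fun k => ?_) ?_
      · refine le_trans (le_of_eq ?_) (decay f hρ k)
        congr 1
        simp only [hv, hf, map_sub, map_smul, smul_sub]
        rw [smul_comm r]
        congr 2
        change (L * L ^ ((k + 1) * n₀)) _ = (L ^ ((k + 1) * n₀) * L) _
        rw [← pow_succ, ← pow_succ']
      · have := (tendsto_pow_atTop_nhds_zero_of_lt_one hθ hL.theta_lt_one).const_mul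
          (2 * ‖f‖ * (b / a))
        simpa using this
    exact sub_eq_zero.1 (tendsto_nhds_unique l1 l2)
  · have hρv : ∀ k, hL.functional (v k) = 1 := fun k => by
      simp only [hv]
      rw [map_smul, functional_map_pow, functional_one, smul_eq_mul, mul_one,
        inv_mul_cancel₀ (by positivity)]
    have : Tendsto (fun k => hL.functional (v k)) atTop (𝓝 (hL.functional g)) := by
      rw [tendsto_iff_norm_sub_tendsto_zero] at hg ⊢
      refine squeeze_zero (fun _ => norm_nonneg _) (fun k => ?_) hg
      rw [← map_sub]
      exact hL.abs_functional_le _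
    simp only [hρv] at this
    exact tendsto_nhds_unique this tendsto_const_nhds |>.symm ▸ rfl
  · have hbd : ∀ k, a / b ≤ v k x ∧ v k x ≤ b / a := by
      intro k
      obtain ⟨l1, l2⟩ := hL.pow_one_bounds (n := (k + 1) * n₀) (by nlinarith) x
      simp only [hv, RB.smul_apply]
      have hp : 0 < r ^ ((k + 1) * n₀) := by positivity
      rw [inv_mul_eq_div]
      exact ⟨(le_div_iff₀ hp).2 l1, (div_le_iff₀ hp).2 l2⟩
    exact ⟨ge_of_tendsto' (hpt x) fun k => (hbd k).1, le_of_tendsto' (hpt x) fun k => (hbd k).2⟩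

/-- Spectral gap in the form needed for perturbation: `L - r` is bounded below on the kernel of
the functional. -/
theorem exists_norm_le (hL : IsDoeblinOp L ν n₀ a b) :
    ∃ B : ℝ, 0 < B ∧ ∀ f : RB M, hL.functional f = 0 → ‖f‖ ≤ B * ‖L f - hL.eigenvalue • f‖ := by
  have ha := hL.a_pos
  have hb := hL.b_pos
  have hr := hL.eigenvalue_pos
  have hθ := hL.theta_nonneg
  set r := hL.eigenvalue with hrdef
  obtain ⟨k, hk⟩ : ∃ k : ℕ, (1 - a / b) ^ k < 1 / (4 * (b / a)) :=
    exists_pow_lt_of_lt_one (by positivity) hL.theta_lt_one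
  set n := (k + 1) * n₀ with hn
  set T : RB M →L[ℝ] RB M := r • 1 with hT
  have hcomm : Commute L T := by
    rw [hT]; exact (Commute.one_right L).smul_right r
  -- `S (L - r) = L ^ n - r ^ n`, where `L ^ n` is negligible against `r ^ n` on the kernel
  set S := ∑ i ∈ Finset.range n, L ^ i * T ^ (n - 1 - i) with hS
  have hgeom : S * (L - T) = L ^ n - T ^ n := hcomm.geom_sum₂_mul n
  have hrn : 0 < r ^ n := by positivity
  refine ⟨2 * (r ^ n)⁻¹ * (‖S‖ + 1), by positivity, fun f hf => ?_⟩
  have h1 := hL.norm_pow_le_of_functional_eq_zero (k := k) (n := n) (by nlinarith) (by nlinarith) hf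
  have h2 : (L ^ n) f - r ^ n • f = S (L f - r • f) := by
    have := congrArg (fun A : RB M →L[ℝ] RB M => A f) hgeom
    simp only [hT, smul_pow, one_pow] at this
    exact this.symm
  have h3 : r ^ n * ‖f‖ ≤ ‖(L ^ n) f‖ + ‖S‖ * ‖L f - r • f‖ := by
    calc r ^ n * ‖f‖ = ‖r ^ n • f‖ := by rw [norm_smul, Real.norm_of_nonneg hrn.le]
      _ = ‖(L ^ n) f - S (L f - r • f)‖ := by rw [← h2, sub_sub_cancel]
      _ ≤ _ := (norm_sub_le _ _).trans (add_le_add le_rfl (S.le_opNorm _))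
  have h4 : ‖(L ^ n) f‖ ≤ r ^ n * ‖f‖ / 2 := by
    refine h1.trans ?_
    calc _ ≤ 1 / (4 * (b / a)) * (2 * ‖f‖) * (b / a * r ^ n) := by gcongr
      _ = _ := by field_simp; ring
  have h5 : r ^ n * ‖f‖ ≤ 2 * ((‖S‖ + 1) * ‖L f - r • f‖) := by
    nlinarith [norm_nonneg (L f - r • f)]
  calc ‖f‖ = (r ^ n)⁻¹ * (r ^ n * ‖f‖) := by field_simp
    _ ≤ (r ^ n)⁻¹ * (2 * ((‖S‖ + 1) * ‖L f - r • f‖)) := by gcongr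
    _ = _ := by ring

end IsDoeblinOp

end Doeblin

/-! ### Weighted transition operators -/

section RealOp

variable {M : Type*} [MeasurableSpace M]

theorem isMarkovKernel_pow (κ : Kernel M M) [IsMarkovKernel κ] (n : ℕ) :
    IsMarkovKernel (κ ^ n) := by
  induction n with
  | zero => rw [pow_zero]; exact inferInstanceAs (IsMarkovKernel Kernel.id)
  | succ n ih => rw [pow_succ']; exact Kernel.IsMarkovKernel.comp κ (κ ^ n)

theorem integrable_mul_real (κ : Kernel M M) [IsMarkovKernel κ] (h f : RB M) (x : M) :
    Integrable (fun y => f y * h y) (κ x) :=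
  Integrable.of_bound (C := ‖f‖ * ‖h‖) ((RB.measurable f).mul (RB.measurable h)).aestronglyMeasurable
    (ae_of_all _ fun y => by
      rw [norm_mul]
      exact mul_le_mul (RB.abs_apply_le f y) (RB.abs_apply_le h y) (norm_nonneg _)
        (norm_nonneg _))

/-- The operator `f ↦ (x ↦ ∫ P(x, dy) f(y) h(y))` on real bounded measurable functions. -/
noncomputable def realOp (κ : Kernel M M) [IsMarkovKernel κ] (h : RB M) : RB M →L[ℝ] RB M :=
  have hbd : ∀ (f : RB M) (x : M), |∫ y, f y * h y ∂(κ x)| ≤ ‖h‖ * ‖f‖ := fun f x => by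
    have := norm_integral_le_of_norm_le_const (μ := κ x) (f := fun y => f y * h y)
      (C := ‖h‖ * ‖f‖) (ae_of_all _ fun y => by
        rw [norm_mul, mul_comm]
        exact mul_le_mul (RB.abs_apply_le h y) (RB.abs_apply_le f y) (norm_nonneg _)
          (norm_nonneg _))
    simpa using this
  LinearMap.mkContinuous
    { toFun := fun f => RB.mk (fun x => ∫ y, f y * h y ∂(κ x))
        (((RB.measurable f).mul (RB.measurable h)).stronglyMeasurable.integral_kernel
          (κ := κ)).measurable ⟨‖h‖ * ‖f‖, hbd f⟩
      map_add' := fun f g => RB.ext fun x => by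
        simp only [RB.mk_apply, RB.add_apply, add_mul]
        exact integral_add (integrable_mul_real κ h f x) (integrable_mul_real κ h g x)
      map_smul' := fun c g => RB.ext fun x => by
        simp only [RB.mk_apply, RB.smul_apply, RingHom.id_apply, mul_assoc]
        exact integral_const_mul c _ }
    ‖h‖ (fun f => RB.norm_le (by positivity) (hbd f))

variable (κ : Kernel M M) [IsMarkovKernel κ]

theorem realOp_apply (h f : RB M) (x : M) : realOp κ h f x = ∫ y, f y * h y ∂(κ x) := rfl

theorem realOp_one_apply (f : RB M) (x : M) : realOp κ (RB.const M 1) f x = ∫ y, f y ∂(κ x) := by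
  simp [realOp_apply]

theorem realOp_one_pow_apply (n : ℕ) (f : RB M) (x : M) :
    (realOp κ (RB.const M 1) ^ n) f x = ∫ y, f y ∂((κ ^ n) x) := by
  induction n generalizing f with
  | zero =>
    have : ((κ ^ 0) x) = Measure.dirac x := by
      rw [pow_zero]; exact Kernel.id_apply x
    rw [this, integral_dirac' _ _ (RB.measurable f).stronglyMeasurable]
    simp
  | succ n ih =>
    have : (realOp κ (RB.const M 1) ^ (n + 1)) f =
        (realOp κ (RB.const M 1) ^ n) (realOp κ (RB.const M 1) f) := by rw [pow_succ]; rfl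
    rw [this, ih, pow_succ']
    change _ = ∫ y, f y ∂((κ ∘ₖ (κ ^ n)) x)
    have := isMarkovKernel_pow κ n
    rw [Kernel.integral_comp (RB.integrable _ f)]
    simp only [realOp_one_apply]

theorem realOp_nonneg {h f : RB M} (hh : ∀ x, 0 ≤ h x) (hf : ∀ x, 0 ≤ f x) (x : M) :
    0 ≤ realOp κ h f x :=
  integral_nonneg fun y => mul_nonneg (hf y) (hh y)

theorem realOp_mono {h f g : RB M} (hh : ∀ x, 0 ≤ h x) (hf : ∀ x, f x ≤ g x) (x : M) :
    realOp κ h f x ≤ realOp κ h g x :=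
  integral_mono (integrable_mul_real κ h f x) (integrable_mul_real κ h g x)
    fun y => mul_le_mul_of_nonneg_right (hf y) (hh y)

theorem realOp_le_of_le {h h' f : RB M} (hh : ∀ x, h x ≤ h' x) (hf : ∀ x, 0 ≤ f x) (x : M) :
    realOp κ h f x ≤ realOp κ h' f x :=
  integral_mono (integrable_mul_real κ h f x) (integrable_mul_real κ h' f x)
    fun y => mul_le_mul_of_nonneg_left (hh y) (hf y)

theorem realOp_const (c : ℝ) (f : RB M) :
    realOp κ (RB.const M c) f = c • realOp κ (RB.const M 1) f := RB.ext fun x => by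
  simp only [realOp_apply, RB.const_apply, RB.smul_apply, mul_one]
  rw [integral_mul_const, mul_comm]

theorem realOp_pow_nonneg {h f : RB M} (hh : ∀ x, 0 ≤ h x) (hf : ∀ x, 0 ≤ f x) (n : ℕ) (x : M) :
    0 ≤ (realOp κ h ^ n) f x := by
  induction n generalizing x with
  | zero => simpa using hf x
  | succ n ih => rw [pow_succ']; exact realOp_nonneg κ hh ih x

theorem le_realOp_pow {h f : RB M} {c : ℝ} (hc : 0 ≤ c) (hh : ∀ x, c ≤ h x) (hf : ∀ x, 0 ≤ f x)
    (n : ℕ) (x : M) :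
    c ^ n * (realOp κ (RB.const M 1) ^ n) f x ≤ (realOp κ h ^ n) f x := by
  induction n generalizing x with
  | zero => simp
  | succ n ih =>
    rw [pow_succ' (realOp κ h), pow_succ' (realOp κ (RB.const M 1))]
    have h1 := realOp_mono κ (h := h) (f := c ^ n • (realOp κ (RB.const M 1) ^ n) f)
      (fun x => hc.trans (hh x)) ih x
    have h2 := realOp_le_of_le κ (h := RB.const M c) (h' := h)
      (f := c ^ n • (realOp κ (RB.const M 1) ^ n) f) hh (fun x => mul_nonneg (pow_nonneg hc n)
        (realOp_pow_nonneg κ (h := RB.const M 1) (fun _ => zero_le_one' ℝ) hf n x)) x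
    rw [realOp_const, map_smul, RB.smul_apply, RB.smul_apply] at h2
    refine le_trans (le_of_eq ?_) (h2.trans h1)
    rw [mul_apply_eq_comp]; ring

theorem realOp_pow_le {h f : RB M} {d : ℝ} (h0 : ∀ x, 0 ≤ h x) (hh : ∀ x, h x ≤ d)
    (hf : ∀ x, 0 ≤ f x) (hd : 0 ≤ d) (n : ℕ) (x : M) :
    (realOp κ h ^ n) f x ≤ d ^ n * (realOp κ (RB.const M 1) ^ n) f x := by
  induction n generalizing x with
  | zero => simp
  | succ n ih =>
    rw [pow_succ' (realOp κ h), pow_succ' (realOp κ (RB.const M 1))]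
    have h1 := realOp_mono κ (h := h) (g := d ^ n • (realOp κ (RB.const M 1) ^ n) f)
      h0 ih x
    have h2 := realOp_le_of_le κ (h := h) (h' := RB.const M d)
      (f := d ^ n • (realOp κ (RB.const M 1) ^ n) f) hh (fun x => mul_nonneg (pow_nonneg hd n)
        (realOp_pow_nonneg κ (h := RB.const M 1) (fun _ => zero_le_one' ℝ) hf n x)) x
    rw [realOp_const, RB.smul_apply, map_smul (realOp κ (RB.const M 1)), RB.smul_apply] at h2
    refine (h1.trans h2).trans (le_of_eq ?_)
    rw [mul_apply_eq_comp]; ring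

/-- The two-sided Doeblin bound, for a given number of steps, constant and reference measure. -/
def DoeblinBound (κ : Kernel M M) (n₀ : ℕ) (C : ℝ≥0) (ν : Measure M) : Prop :=
  ∀ (x : M) (G : Set M), MeasurableSet G →
    ((C⁻¹ : ℝ≥0) : ℝ≥0∞) * ν G ≤ (κ ^ n₀) x G ∧ (κ ^ n₀) x G ≤ (C : ℝ≥0∞) * ν G

variable {κ}

theorem DoeblinBound.integral_le {n₀ : ℕ} {C : ℝ≥0} {ν : Measure M} [IsProbabilityMeasure ν]
    (hκ : DoeblinBound κ n₀ C ν) {f : RB M} (hf : ∀ x, 0 ≤ f x) (x : M) :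
    (C : ℝ)⁻¹ * ∫ y, f y ∂ν ≤ ∫ y, f y ∂((κ ^ n₀) x) ∧
      ∫ y, f y ∂((κ ^ n₀) x) ≤ C * ∫ y, f y ∂ν := by
  have := isMarkovKernel_pow κ n₀
  have h1 : C⁻¹ • ν ≤ (κ ^ n₀) x := Measure.le_iff.2 fun G hG => (hκ x G hG).1
  have h2 : (κ ^ n₀) x ≤ C • ν := Measure.le_iff.2 fun G hG => (hκ x G hG).2
  have e1 := integral_mono_measure h1 (ae_of_all _ hf) (RB.integrable _ f)
  have e2 := integral_mono_measure h2 (ae_of_all _ hf) (RB.integrable _ f)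
  rw [integral_smul_nnreal_measure] at e1 e2
  exact ⟨e1, e2⟩

theorem DoeblinBound.isDoeblinOp {n₀ : ℕ} {C : ℝ≥0} {ν : Measure M} [IsProbabilityMeasure ν]
    (hC : 0 < C) (hκ : DoeblinBound κ n₀ C ν) {h : RB M} {c d : ℝ} (hc : 0 < c)
    (hh : ∀ x, c ≤ h x ∧ h x ≤ d) :
    IsDoeblinOp (realOp κ h) ν n₀ (c ^ n₀ * (C : ℝ)⁻¹) (d ^ n₀ * C) where
  prob := inferInstance
  a_pos := by positivity
  nonneg f hf := realOp_nonneg κ (fun x => hc.le.trans (hh x).1) hf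
  one_pos := ⟨c, hc, fun x => by
    have := le_realOp_pow κ hc.le (fun x => (hh x).1) (f := RB.const M 1) (fun _ => zero_le_one' ℝ)
      1 x
    simpa [realOp_one_apply] using this⟩
  lower f hf x := by
    refine le_trans ?_ (le_realOp_pow κ hc.le (fun x => (hh x).1) hf n₀ x)
    rw [realOp_one_pow_apply, mul_assoc]
    exact mul_le_mul_of_nonneg_left (hκ.integral_le hf x).1 (by positivity)
  upper f hf x := by
    have hd : 0 ≤ d := hc.le.trans ((hh x).1.trans (hh x).2)
    refine (realOp_pow_le κ (fun x => hc.le.trans (hh x).1) (fun x => (hh x).2) hf hd n₀ x).trans ?_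
    rw [realOp_one_pow_apply, mul_assoc]
    exact mul_le_mul_of_nonneg_left (hκ.integral_le hf x).2 (by positivity)

end RealOp

/-! ### The spectral radius -/

section SpectralRadius

/-- If the powers of `T` grow like `r ^ n` up to constants, then `r` is the spectral radius. -/
theorem spectralRadius_eq_of_growth {E : Type*} [NormedAddCommGroup E] [NormedSpace ℂ E]
    [CompleteSpace E] (T : E →L[ℂ] E) {r c C : ℝ} (hr : 0 < r) (hc : 0 < c) (n₀ : ℕ)
    (hle' : ∀ n, n₀ ≤ n → ∀ f, ‖T^[n] f‖ ≤ C * r ^ n * ‖f‖)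
    {f₀ : E} (hf₀ : ‖f₀‖ ≤ 1) (hge' : ∀ n, n₀ ≤ n → c * r ^ n ≤ ‖T^[n] f₀‖) :
    spectralRadius ℂ T = ENNReal.ofReal r := by
  have hge : ∀ n, n₀ ≤ n → c * r ^ n ≤ ‖T ^ n‖ := fun n hn => by
    refine (hge' n hn).trans ?_
    rw [← FunLike.coe_pow_eq_iterate]
    exact ((T ^ n).le_opNorm _).trans (mul_le_of_le_one_right (norm_nonneg _) hf₀)
  have hC : 0 ≤ C := by
    have h1 := (hge' n₀ le_rfl).trans (hle' n₀ le_rfl f₀)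
    have h2 : 0 < C * r ^ n₀ * ‖f₀‖ := lt_of_lt_of_le (by positivity) h1
    by_contra hneg
    exact absurd h2 (not_lt.2 (mul_nonpos_of_nonpos_of_nonneg
      (mul_nonpos_of_nonpos_of_nonneg (not_le.1 hneg).le (by positivity)) (norm_nonneg _)))
  have hle : ∀ n, n₀ ≤ n → ‖T ^ n‖ ≤ C * r ^ n := fun n hn => by
    refine ContinuousLinearMap.opNorm_le_bound _ (by positivity) fun f => ?_
    rw [FunLike.coe_pow_eq_iterate]
    exact hle' n hn f
  have hCpos : 0 < C := by
    have h := (hge n₀ le_rfl).trans (hle n₀ le_rfl)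
    exact hc.trans_le (le_of_mul_le_mul_right h (by positivity))
  refine tendsto_nhds_unique (spectrum.pow_norm_pow_one_div_tendsto_nhds_spectralRadius T) ?_
  refine (ENNReal.continuous_ofReal.tendsto r).comp ?_
  have key : ∀ D : ℝ, 0 < D → Tendsto (fun n : ℕ => D ^ (1 / n : ℝ) * r) atTop (𝓝 r) := by
    intro D hD
    have h1 : Tendsto (fun n : ℕ => D ^ (1 / n : ℝ)) atTop (𝓝 (D ^ (0 : ℝ))) :=
      (Real.continuousAt_const_rpow hD.ne').tendsto.comp tendsto_one_div_atTop_nhds_zero_nat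
    simpa using h1.mul_const r
  have split : ∀ D : ℝ, 0 < D → ∀ n : ℕ, 0 < n → (D * r ^ n) ^ (1 / n : ℝ) = D ^ (1 / n : ℝ) * r := by
    intro D hD n hn
    rw [Real.mul_rpow hD.le (by positivity), one_div, Real.pow_rpow_inv_natCast hr.le hn.ne']
  refine tendsto_of_tendsto_of_tendsto_of_le_of_le' (key c hc) (key C hCpos) ?_ ?_
  · filter_upwards [eventually_ge_atTop n₀, eventually_gt_atTop 0] with n hn hn'
    rw [← split c hc n hn']
    exact Real.rpow_le_rpow (by positivity) (hge n hn) (by positivity)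
  · filter_upwards [eventually_ge_atTop n₀, eventually_gt_atTop 0] with n hn hn'
    rw [← split C hCpos n hn']
    exact Real.rpow_le_rpow (norm_nonneg _) (hle n hn) (by positivity)

variable {M : Type*} [MeasurableSpace M]

/-- The constant function `1` as a complex bounded measurable function. -/
noncomputable def BM.one (M : Type*) [MeasurableSpace M] : BM M ℂ :=
  BM.mk (fun _ => 1) measurable_const ⟨1, fun _ => by simp⟩

@[simp] theorem BM.one_apply (x : M) : BM.one M x = 1 := rfl

/-- An element of `BM M ℝ`, seen in `RB M`. -/
noncomputable def toRB (h : BM M ℝ) : RB M := h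

@[simp] theorem toRB_apply (h : BM M ℝ) (x : M) : toRB h x = h x := rfl

variable (κ : Kernel M M) [IsMarkovKernel κ]

theorem weightedOp_apply (h : BM M ℝ) (g : BM M ℂ) (x : M) :
    weightedOp κ h g x = ∫ y, g y * (h y : ℂ) ∂(κ x) := rfl

theorem norm_weightedOp_pow_apply_le (h : BM M ℝ) (h0 : ∀ x, 0 ≤ h x) (g : BM M ℂ) (n : ℕ) (x : M) :
    ‖(weightedOp κ h)^[n] g x‖ ≤ ‖g‖ * (realOp κ (toRB h) ^ n) (RB.const M 1) x := by
  induction n generalizing x with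
  | zero => simpa using BM.norm_apply_le g x
  | succ n ih =>
    have e1 : (realOp κ (toRB h) ^ (n + 1)) (RB.const M 1) x =
        ∫ y, (realOp κ (toRB h) ^ n) (RB.const M 1) y * h y ∂(κ x) := by rw [pow_succ']; rfl
    rw [Function.iterate_succ_apply', weightedOp_apply, e1, ← integral_const_mul]
    refine norm_integral_le_of_norm_le ((integrable_mul_real κ _ _ x).const_mul ‖g‖)
      (ae_of_all _ fun y => ?_)
    rw [norm_mul, Complex.norm_real, Real.norm_of_nonneg (h0 y), ← mul_assoc]
    exact mul_le_mul_of_nonneg_right (ih y) (h0 y)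

theorem weightedOp_pow_one (h : BM M ℝ) (n : ℕ) (x : M) :
    (weightedOp κ h)^[n] (BM.one M) x =
      ((realOp κ (toRB h) ^ n) (RB.const M 1) x : ℝ) := by
  induction n generalizing x with
  | zero => simp
  | succ n ih =>
    have e1 : (realOp κ (toRB h) ^ (n + 1)) (RB.const M 1) x =
        ∫ y, (realOp κ (toRB h) ^ n) (RB.const M 1) y * h y ∂(κ x) := by rw [pow_succ']; rfl
    rw [Function.iterate_succ_apply', weightedOp_apply, e1, ← integral_complex_ofReal]
    simp only [ih]
    push_cast
    rfl

/-- The spectral radius of a weighted transition operator is its leading eigenvalue. -/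
theorem spectralRadius_weightedOp (h : BM M ℝ) (h0 : ∀ x, 0 ≤ h x) {ν : Measure M} {n₀ : ℕ} {a b : ℝ}
    (hL : IsDoeblinOp (realOp κ (toRB h)) ν n₀ a b) :
    spectralRadius ℂ (weightedOp κ h) = ENNReal.ofReal hL.eigenvalue := by
  have ha := hL.a_pos
  have hb := hL.b_pos
  have hr := hL.eigenvalue_pos
  obtain ⟨x₀⟩ := hL.nonempty
  refine spectralRadius_eq_of_growth (c := a / b) (C := b / a) _ hr (by positivity) n₀
    (fun n hn g => ?_) (f₀ := BM.one M) (BM.norm_le zero_le_one fun x => ?_) (fun n hn => ?_)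
  · refine BM.norm_le (by positivity) fun x => ?_
    refine (norm_weightedOp_pow_apply_le κ h h0 g n x).trans ?_
    rw [mul_comm]
    exact mul_le_mul_of_nonneg_right (hL.pow_one_bounds hn x).2 (norm_nonneg _)
  · simp
  · refine (hL.pow_one_bounds hn x₀).1.trans ?_
    have e1 := BM.norm_apply_le ((weightedOp κ h)^[n] (BM.one M)) x₀
    rw [weightedOp_pow_one, Complex.norm_real] at e1
    exact (le_abs_self _).trans e1

end SpectralRadius

/-! ### The invariant measure -/

section Invariant

variable {M : Type*} [MeasurableSpace M]

/-- The indicator of a measurable set as a bounded measurable function. -/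
noncomputable def RB.indicator {G : Set M} (hG : MeasurableSet G) : RB M :=
  RB.mk (G.indicator fun _ => 1) (measurable_const.indicator hG) ⟨1, fun x => by
    by_cases h : x ∈ G <;> simp [h]⟩

theorem RB.integral_indicator {G : Set M} (hG : MeasurableSet G) (m : Measure M) :
    ∫ x, RB.indicator hG x ∂m = m.real G := by
  simp [RB.indicator, MeasureTheory.integral_indicator hG]

theorem RB.indicator_nonneg {G : Set M} (hG : MeasurableSet G) (x : M) :
    0 ≤ RB.indicator hG x := by
  by_cases h : x ∈ G <;> simp [RB.indicator, h]

theorem DoeblinBound.one_step {κ : Kernel M M} {n₀ : ℕ} {C : ℝ≥0} {ν : Measure M}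
    (hκ : DoeblinBound κ n₀ C ν) : DoeblinBound (κ ^ n₀) 1 C ν := by
  simpa [DoeblinBound] using hκ

variable {κ : Kernel M M} [IsMarkovKernel κ]

theorem realOp_one_pow_one (n : ℕ) (x : M) :
    (realOp κ (RB.const M 1) ^ n) (RB.const M 1) x = 1 := by
  have := isMarkovKernel_pow κ n
  rw [realOp_one_pow_apply]
  simp

theorem integral_realOp_one {μ : Measure M} [IsProbabilityMeasure μ] (hμ : κ.Invariant μ)
    (f : RB M) (n : ℕ) : ∫ x, (realOp κ (RB.const M 1) ^ n) f x ∂μ = ∫ x, f x ∂μ := by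
  induction n generalizing f with
  | zero => simp
  | succ n ih =>
    rw [pow_succ, mul_apply_eq_comp, ih]
    simp only [realOp_one_apply]
    have : IsProbabilityMeasure (μ.bind κ) := by rw [hμ.def]; infer_instance
    have h := Kernel.integral_comp (η := κ) (κ := Kernel.const Unit μ) (a := ()) (f := f) (by
      rw [← Measure.comp_eq_comp_const_apply]; exact RB.integrable (μ.bind κ) f)
    rw [← Measure.comp_eq_comp_const_apply, hμ.def] at h
    exact h.symm

namespace DoeblinBound

variable {n₀ : ℕ} {C : ℝ≥0} {ν : Measure M} [IsProbabilityMeasure ν]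

theorem isDoeblinOp_one (hC : 0 < C) (hκ : DoeblinBound κ n₀ C ν) :
    IsDoeblinOp (realOp κ (RB.const M 1)) ν n₀ (C : ℝ)⁻¹ C := by
  have := hκ.isDoeblinOp hC (h := RB.const M 1) (c := 1) (d := 1) zero_lt_one
    (fun x => ⟨le_rfl, le_rfl⟩)
  simpa only [one_pow, one_mul] using this

theorem abs_integral_pow_sub_le (hC : 0 < C) (hκ : DoeblinBound κ n₀ C ν) (f : RB M)
    {k n : ℕ} (hk : k * n₀ ≤ n) (x : M) :
    |∫ y, f y ∂((κ ^ n) x) - (hκ.isDoeblinOp_one hC).functional f| ≤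
      (1 - (C : ℝ)⁻¹ / C) ^ k * (2 * ‖f‖) := by
  have := (hκ.isDoeblinOp_one hC).isRatioLimit_functional f k n hk x
  rwa [realOp_one_pow_one, mul_one, mul_one, realOp_one_pow_apply] at this

/-- The limit functional of the transition operator itself is the integral against any invariant
law; this makes the invariant law unique. -/
theorem functional_eq_integral (hC : 0 < C) (hκ : DoeblinBound κ n₀ C ν)
    {μ : Measure M} [IsProbabilityMeasure μ] (hμ : κ.Invariant μ) (f : RB M) :
    (hκ.isDoeblinOp_one hC).functional f = ∫ x, f x ∂μ := by
  set hL := hκ.isDoeblinOp_one hC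
  have key : ∀ k : ℕ, |∫ x, f x ∂μ - hL.functional f| ≤ (1 - (C : ℝ)⁻¹ / C) ^ k * (2 * ‖f‖) := by
    intro k
    rw [← integral_realOp_one hμ f (k * n₀)]
    have h1 : ∫ x, (realOp κ (RB.const M 1) ^ (k * n₀)) f x ∂μ - hL.functional f =
        ∫ x, ((realOp κ (RB.const M 1) ^ (k * n₀)) f x - hL.functional f) ∂μ := by
      rw [integral_sub (RB.integrable μ _) (integrable_const _)]; simp
    rw [h1]
    have := norm_integral_le_of_norm_le_const (μ := μ)
      (f := fun x => (realOp κ (RB.const M 1) ^ (k * n₀)) f x - hL.functional f)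
      (C := (1 - (C : ℝ)⁻¹ / C) ^ k * (2 * ‖f‖)) (ae_of_all _ fun x => by
        have h2 := hκ.abs_integral_pow_sub_le hC f (le_refl (k * n₀)) x
        rwa [← realOp_one_pow_apply] at h2)
    simpa using this
  have lim : Tendsto (fun k : ℕ => (1 - (C : ℝ)⁻¹ / C) ^ k * (2 * ‖f‖)) atTop
      (𝓝 (0 * (2 * ‖f‖))) :=
    (tendsto_pow_atTop_nhds_zero_of_lt_one hL.theta_nonneg hL.theta_lt_one).mul_const _
  rw [zero_mul] at lim
  have := ge_of_tendsto' lim key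
  exact (sub_eq_zero.1 (abs_eq_zero.1 (le_antisymm this (abs_nonneg _)))).symm

theorem invariant_unique (hC : 0 < C) (hκ : DoeblinBound κ n₀ C ν)
    {μ μ' : Measure M} [IsProbabilityMeasure μ] [IsProbabilityMeasure μ'] (hμ : κ.Invariant μ)
    (hμ' : κ.Invariant μ') : μ = μ' := by
  refine Measure.ext fun G hG => (measureReal_eq_measureReal_iff).1 ?_
  rw [← RB.integral_indicator hG, ← RB.integral_indicator hG,
    ← hκ.functional_eq_integral hC hμ, ← hκ.functional_eq_integral hC hμ']

/-- Uniform mixing with a multiplicative error: after many steps the transition probability is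
comparable to the invariant measure with constants close to `1`. -/
theorem mixing (hC : 0 < C) (hκ : DoeblinBound κ n₀ C ν)
    {μ : Measure M} [IsProbabilityMeasure μ] (hμ : κ.Invariant μ) {δ : ℝ} (hδ : 0 < δ) :
    ∃ k : ℕ, ∀ n, k ≤ n → ∀ x, ENNReal.ofReal (1 - δ) • μ ≤ (κ ^ n) x ∧
      (κ ^ n) x ≤ ENNReal.ofReal (1 + δ) • μ := by
  set hL := hκ.isDoeblinOp_one hC
  have hC' : (0 : ℝ) < C := hC
  obtain ⟨k, hk⟩ : ∃ k : ℕ, (1 - (C : ℝ)⁻¹ / C) ^ k < δ / (2 * (C * C)) :=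
    exists_pow_lt_of_lt_one (by positivity) hL.theta_lt_one
  have key : ∀ n, k * n₀ + n₀ ≤ n → ∀ x G, MeasurableSet G →
      |((κ ^ n) x).real G - μ.real G| ≤ δ * μ.real G := by
    intro n hn x G hG
    -- uniform ergodicity is applied to `P(n₀, ·, G)`, whose supremum is at most `C² μ(G)`; this
    -- makes the error proportional to `μ(G)`
    set f := (realOp κ (RB.const M 1) ^ n₀) (RB.indicator hG) with hf
    have hμG : (C : ℝ)⁻¹ * ν.real G ≤ μ.real G := by
      rw [← RB.integral_indicator hG μ, ← integral_realOp_one hμ _ n₀, ← RB.integral_indicator hG ν]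
      have := integral_mono (μ := μ) (integrable_const ((C : ℝ)⁻¹ * ∫ y, RB.indicator hG y ∂ν))
        (RB.integrable μ f) (hL.lower _ (RB.indicator_nonneg hG))
      rwa [integral_const, probReal_univ, one_smul] at this
    have hfn : ‖f‖ ≤ C * (C * μ.real G) := by
      refine RB.norm_le (by positivity) fun x => ?_
      rw [abs_of_nonneg (hL.nonneg_pow n₀ _ (RB.indicator_nonneg hG) x)]
      refine (hL.upper _ (RB.indicator_nonneg hG) x).trans ?_
      rw [RB.integral_indicator]
      gcongr
      rwa [inv_mul_le_iff₀ hC'] at hμG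
    obtain ⟨j, rfl⟩ := Nat.exists_eq_add_of_le' (le_of_add_le_right hn)
    have hj : k * n₀ ≤ j := by omega
    have h1 := hκ.abs_integral_pow_sub_le hC f hj x
    have h2 : ∫ y, f y ∂((κ ^ j) x) = ((κ ^ (j + n₀)) x).real G := by
      rw [← RB.integral_indicator hG, ← realOp_one_pow_apply, ← realOp_one_pow_apply, pow_add]
      rfl
    have h3 : hL.functional f = μ.real G := by
      rw [hκ.functional_eq_integral hC hμ, hf, integral_realOp_one hμ, RB.integral_indicator]
    rw [h2, h3] at h1
    refine h1.trans ?_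
    calc _ ≤ δ / (2 * (C * C)) * (2 * (C * (C * μ.real G))) := by gcongr
      _ = δ * μ.real G := by field_simp
  refine ⟨k * n₀ + n₀, fun n hn x => ?_⟩
  have := isMarkovKernel_pow κ n
  constructor
  · refine Measure.le_iff.2 fun G hG => ?_
    have h1 := (abs_le.1 (key n hn x G hG)).1
    rw [Measure.smul_apply, smul_eq_mul, ← ofReal_measureReal, ← ofReal_measureReal]
    rcases le_total δ 1 with h | h
    · rw [← ENNReal.ofReal_mul (by linarith)]
      exact ENNReal.ofReal_le_ofReal (by linarith)
    · rw [ENNReal.ofReal_of_nonpos (by linarith), zero_mul]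
      exact zero_le
  · refine Measure.le_iff.2 fun G hG => ?_
    have h1 := (abs_le.1 (key n hn x G hG)).2
    rw [Measure.smul_apply, smul_eq_mul, ← ofReal_measureReal, ← ofReal_measureReal,
      ← ENNReal.ofReal_mul (by linarith)]
    exact ENNReal.ofReal_le_ofReal (by linarith)

/-- If the kernel itself satisfies the Doeblin bound, an invariant law is given by the series
`c ∑ ν D ^ k`, where `D = κ - c ν`. -/
theorem exists_invariant_of_one_step (hC : 0 < C) (hκ : DoeblinBound κ 1 C ν) :
    ∃ μ : Measure M, IsProbabilityMeasure μ ∧ κ.Invariant μ := by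
  set c : ℝ≥0∞ := ((C⁻¹ : ℝ≥0) : ℝ≥0∞) with hc
  have hc0 : c ≠ 0 := by rw [hc]; exact ENNReal.coe_ne_zero.2 (inv_pos.2 hC).ne'
  have hle : ∀ x, c • ν ≤ κ x := fun x => Measure.le_iff.2 fun G hG => by
    have := (hκ x G hG).1
    rwa [pow_one] at this
  have hc1 : c ≤ 1 := by
    have hne : Nonempty M := ν.nonempty_of_neZero
    have := hle hne.some Set.univ
    simpa using this
  have hct : c ≠ ⊤ := ENNReal.coe_ne_top
  have : IsFiniteMeasure (c • ν) := inferInstanceAs (IsFiniteMeasure ((C⁻¹ : ℝ≥0) • ν))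
  have hsub : ∀ x G, MeasurableSet G → (κ x - c • ν) G = κ x G - c * ν G := fun x G hG => by
    rw [Measure.sub_apply hG (hle x)]; rfl
  let D : Kernel M M :=
    { toFun := fun x => κ x - c • ν
      measurable' := Measure.measurable_of_measurable_coe _ fun G hG => by
        simp only [hsub _ G hG]
        exact (Kernel.measurable_coe κ hG).sub measurable_const }
  have hD : ∀ x G, MeasurableSet G → κ x G = D x G + c * ν G := fun x G hG => by
    change _ = (κ x - c • ν) G + _
    rw [hsub x G hG]
    exact (tsub_add_cancel_of_le (hle x G)).symm
  have hDuniv : ∀ x, D x Set.univ = 1 - c := fun x => by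
    change (κ x - c • ν) Set.univ = _
    rw [hsub x _ .univ]; simp
  let m : ℕ → Measure M := fun k => Nat.rec ν (fun _ m => m.bind D) k
  have hm : ∀ k G, MeasurableSet G → m (k + 1) G = ∫⁻ x, D x G ∂(m k) := fun k G hG =>
    Measure.bind_apply hG D.aemeasurable
  have hmass : ∀ k, m k Set.univ = (1 - c) ^ k := by
    intro k
    induction k with
    | zero => exact measure_univ (μ := ν) |>.trans (pow_zero _).symm
    | succ k ih => rw [hm k _ .univ, lintegral_congr hDuniv, lintegral_const, ih, pow_succ']
  have hprob : IsProbabilityMeasure (c • Measure.sum m) := ⟨by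
    rw [Measure.smul_apply, Measure.sum_apply _ .univ, smul_eq_mul]
    simp only [hmass]
    rw [ENNReal.tsum_geometric, ENNReal.sub_sub_cancel ENNReal.one_ne_top hc1,
      ENNReal.mul_inv_cancel hc0 hct]⟩
  refine ⟨c • Measure.sum m, hprob, ?_⟩
  refine Measure.ext fun G hG => ?_
  rw [Measure.bind_apply hG κ.aemeasurable, lintegral_congr fun x => hD x G hG,
    lintegral_add_right _ measurable_const, lintegral_const, measure_univ, mul_one,
    lintegral_smul_measure, lintegral_sum_measure, Measure.smul_apply, Measure.sum_apply _ hG,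
    tsum_eq_zero_add' (f := fun k => m k G) ENNReal.summable]
  simp only [← hm _ G hG, smul_eq_mul, mul_add]
  exact add_comm _ _

theorem exists_invariant (hC : 0 < C) (hκ : DoeblinBound κ n₀ C ν) :
    ∃ μ : Measure M, IsProbabilityMeasure μ ∧ κ.Invariant μ := by
  have := isMarkovKernel_pow κ n₀
  obtain ⟨μ, hμ, hinv⟩ := hκ.one_step.exists_invariant_of_one_step hC
  refine ⟨μ, hμ, ?_⟩
  -- `μ κ` is also invariant under `κ ^ n₀`
  refine hκ.one_step.invariant_unique hC (μ := μ.bind κ) (μ' := μ) ?_ hinv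
  rw [Kernel.Invariant, Measure.comp_assoc]
  have hcomm : (κ ^ n₀) ∘ₖ κ = κ ∘ₖ (κ ^ n₀) :=
    (pow_succ κ n₀).symm.trans (pow_succ' κ n₀)
  rw [hcomm, ← Measure.comp_assoc, hinv.def]

end DoeblinBound

end Invariant

/-! ### Differentiability of the leading eigenvalue -/

section Perturbation

variable {M : Type*} [MeasurableSpace M]

namespace IsDoeblinOp

variable {L : RB M →L[ℝ] RB M} {ν : Measure M} {n₀ : ℕ} {a b : ℝ}

/-- First-order perturbation: if `g` is an eigenfunction of a perturbed operator, written as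
`L g + L ψ = s g`, then `s - r = r ρ(ψ)` exactly, and `g` is close to `g₀` when `ψ` is small. -/
theorem exists_perturbation_bound (hL : IsDoeblinOp L ν n₀ a b) {g₀ : RB M}
    (hg₀ : L g₀ = hL.eigenvalue • g₀) (hρ₀ : hL.functional g₀ = 1) :
    ∃ B : ℝ, 0 < B ∧ ∀ (g ψ : RB M) (s : ℝ), L g + L ψ = s • g → hL.functional g = 1 →
      s - hL.eigenvalue = hL.eigenvalue * hL.functional ψ ∧
        ‖g - g₀‖ ≤ B * (1 + ‖g‖) * ‖ψ‖ := by
  obtain ⟨B, hB, hgap⟩ := hL.exists_norm_le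
  have hr := hL.eigenvalue_pos
  set r := hL.eigenvalue with hrdef
  refine ⟨B * (r + ‖L‖), by positivity, fun g ψ s hs hρ => ?_⟩
  have e1 : s - r = r * hL.functional ψ := by
    have := congrArg hL.functional hs
    rw [map_add, functional_map, functional_map, map_smul, hρ, smul_eq_mul, ← hrdef] at this
    linarith
  refine ⟨e1, ?_⟩
  have e2 : L (g - g₀) - r • (g - g₀) = (s - r) • g - L ψ := by
    rw [map_sub, hg₀, eq_sub_of_add_eq hs, smul_sub, sub_smul]
    abel
  have h1 := hgap (g - g₀) (by rw [map_sub, hρ, hρ₀, sub_self])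
  rw [e2] at h1
  have h2 : ‖(s - r) • g - L ψ‖ ≤ r * ‖ψ‖ * ‖g‖ + ‖L‖ * ‖ψ‖ := by
    refine (norm_sub_le _ _).trans (add_le_add ?_ (L.le_opNorm _))
    rw [norm_smul, e1, norm_mul, Real.norm_of_nonneg hr.le]
    have := hL.abs_functional_le ψ
    rw [Real.norm_eq_abs]
    gcongr
  calc ‖g - g₀‖ ≤ B * (r * ‖ψ‖ * ‖g‖ + ‖L‖ * ‖ψ‖) := h1.trans (by gcongr)
    _ ≤ B * ((r + ‖L‖) * (1 + ‖g‖) * ‖ψ‖) := by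
        refine mul_le_mul_of_nonneg_left ?_ hB.le
        have t1 : 0 ≤ r * ‖ψ‖ := by positivity
        have t2 : 0 ≤ ‖L‖ * ‖ψ‖ * ‖g‖ := by positivity
        nlinarith
    _ = _ := by ring

end IsDoeblinOp

variable {κ : Kernel M M} [IsMarkovKernel κ] {n₀ : ℕ} {C : ℝ≥0} {ν : Measure M}
  [IsProbabilityMeasure ν]

/-- The leading eigenvalue of a weighted transition operator is differentiable along a family of
weights that is differentiable only pointwise, with uniformly bounded difference quotients. The
family of operators need not be differentiable in norm: dominated convergence applies because the
left eigenvector is dominated by `ν`. -/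
theorem DoeblinBound.differentiableAt_eigenvalue (hC : 0 < C)
    (hκ : DoeblinBound κ n₀ C ν) {h : ℝ → RB M} {l₀ c d K : ℝ} (hc : 0 < c)
    (hcd : ∀ᶠ l in 𝓝 l₀, ∀ x, c ≤ h l x ∧ h l x ≤ d)
    (hLip : ∀ᶠ l in 𝓝 l₀, ∀ x, |h l x - h l₀ x| ≤ K * |l - l₀|)
    (hdiff : ∀ x, DifferentiableAt ℝ (fun l => h l x) l₀) {r : ℝ → ℝ}
    (hr : ∀ᶠ l in 𝓝 l₀, ∀ a b, ∀ hL : IsDoeblinOp (realOp κ (h l)) ν n₀ a b,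
      r l = hL.eigenvalue) :
    DifferentiableAt ℝ r l₀ := by
  have hcd₀ := hcd.self_of_nhds
  set a := c ^ n₀ * (C : ℝ)⁻¹ with ha_def
  set b := d ^ n₀ * C with hb_def
  have hLl : ∀ᶠ l in 𝓝 l₀, IsDoeblinOp (realOp κ (h l)) ν n₀ a b :=
    hcd.mono fun l hl => hκ.isDoeblinOp hC hc hl
  have hL := hLl.self_of_nhds
  have ha := hL.a_pos
  have hb := hL.b_pos
  obtain ⟨x₀⟩ := hL.nonempty
  have hKnn : ∀ᶠ l in 𝓝[≠] l₀, 0 ≤ K := by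
    filter_upwards [hLip.filter_mono nhdsWithin_le_nhds, self_mem_nhdsWithin] with l hl hne
    have h1 : 0 < |l - l₀| := abs_pos.2 (sub_ne_zero.2 hne)
    exact nonneg_of_mul_nonneg_left ((abs_nonneg _).trans (hl x₀)) h1
  have hK : 0 ≤ K := hKnn.exists.choose_spec
  obtain ⟨g₀, hg₀, hρ₀, -⟩ := hL.exists_eigenfunction
  obtain ⟨B, hB, hpert⟩ := hL.exists_perturbation_bound hg₀ hρ₀
  set G := (b / a) / (a / b) with hG
  have hGpos : 0 < G := by positivity
  -- eigenfunctions of the perturbed operators, normalised by the unperturbed functional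
  have hex : ∀ᶠ l in 𝓝 l₀, ∃ g : RB M, realOp κ (h l) g = r l • g ∧ hL.functional g = 1 ∧
      ‖g‖ ≤ G := by
    filter_upwards [hLl, hr] with l hl hrl
    obtain ⟨g, h1, -, h3⟩ := hl.exists_eigenfunction
    have h4 : a / b ≤ hL.functional g := (hL.functional_const (a / b)).symm.le.trans
      (hL.functional_mono fun x => (h3 x).1)
    have h5 : 0 < hL.functional g := lt_of_lt_of_le (by positivity) h4
    refine ⟨(hL.functional g)⁻¹ • g, ?_, ?_, ?_⟩
    · rw [map_smul, h1, hrl _ _ hl, smul_comm]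
    · rw [map_smul, smul_eq_mul, inv_mul_cancel₀ h5.ne']
    · rw [norm_smul, norm_inv, Real.norm_of_nonneg h5.le, inv_mul_eq_div, hG]
      refine div_le_div₀ (by positivity) (RB.norm_le (by positivity) fun x => ?_) (by positivity) h4
      rw [abs_of_nonneg ((by positivity : (0 : ℝ) ≤ a / b).trans (h3 x).1)]
      exact (h3 x).2
  obtain ⟨g, hg⟩ := hex.choice
  -- the relative difference quotients of the weights
  have h0pos : ∀ x, 0 < h l₀ x := fun x => hc.trans_le (hcd₀ x).1
  set q : ℝ → M → ℝ := fun l x => (h l x - h l₀ x) / (l - l₀) / h l₀ x with hq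
  have hqm : ∀ l, Measurable (q l) := fun l =>
    (((RB.measurable (h l)).sub (RB.measurable (h l₀))).div_const _).div (RB.measurable (h l₀))
  have hqb : ∀ᶠ l in 𝓝[≠] l₀, ∀ x, |q l x| ≤ K / c := by
    filter_upwards [hLip.filter_mono nhdsWithin_le_nhds, self_mem_nhdsWithin] with l hl hne x
    have h1 : 0 < |l - l₀| := abs_pos.2 (sub_ne_zero.2 hne)
    rw [hq, abs_div, abs_div, abs_of_pos (h0pos x)]
    exact div_le_div₀ hK ((div_le_iff₀ h1).2 (hl x)) hc (hcd₀ x).1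
  set e : M → ℝ := fun x => deriv (fun l => h l x) l₀ / h l₀ x with he
  have hqe : ∀ x, Tendsto (fun l => q l x) (𝓝[≠] l₀) (𝓝 (e x)) := by
    intro x
    have := (hdiff x).hasDerivAt.tendsto_slope
    refine Tendsto.div_const (this.congr fun l => ?_) _
    rw [slope_def_field]
  have hem : Measurable e := measurable_of_tendsto_metrizable' (𝓝[≠] l₀) hqm
    (tendsto_pi_nhds.2 hqe)
  have heb : ∀ x, |e x| ≤ K / c := fun x =>
    le_of_tendsto (hqe x).abs (hqb.mono fun l hl => hl x)
  -- `ψ l` is the perturbation of `g l`, and `F l` its difference quotient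
  have hFb : ∀ (f : RB M) (p : M → ℝ), (∀ x, |p x| ≤ K / c) → ∀ x, |f x * p x| ≤ ‖f‖ * (K / c) := by
    intro f p hp x
    rw [abs_mul]
    exact mul_le_mul (RB.abs_apply_le f x) (hp x) (abs_nonneg _) (norm_nonneg _)
  set E : RB M := RB.mk (fun x => g₀ x * e x) ((RB.measurable g₀).mul hem)
    ⟨_, hFb g₀ e heb⟩ with hE
  have main : ∀ᶠ l in 𝓝[≠] l₀, ∃ F : RB M, (∀ x, F x = g l x * q l x) ∧
      ‖F‖ ≤ G * (K / c) ∧ slope r l₀ l = hL.eigenvalue * hL.functional F ∧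
      ‖g l - g₀‖ ≤ B * (1 + G) * (|l - l₀| * (G * (K / c))) := by
    filter_upwards [hqb, hg.filter_mono nhdsWithin_le_nhds, self_mem_nhdsWithin]
      with l hql hgl hne
    obtain ⟨h1, h2, h3⟩ := hgl
    have hne' : l - l₀ ≠ 0 := sub_ne_zero.2 hne
    set F : RB M := RB.mk (fun x => g l x * q l x) ((RB.measurable (g l)).mul (hqm l))
      ⟨_, hFb (g l) (q l) hql⟩ with hF
    have hFn : ‖F‖ ≤ G * (K / c) := RB.norm_le (by positivity) fun x =>
      (hFb (g l) (q l) hql x).trans (by gcongr)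
    have hs : realOp κ (h l₀) (g l) + realOp κ (h l₀) ((l - l₀) • F) = r l • g l := by
      rw [← h1, ← map_add]
      refine RB.ext fun x => ?_
      rw [realOp_apply, realOp_apply]
      refine integral_congr_ae (ae_of_all _ fun y => ?_)
      simp only [RB.add_apply, RB.smul_apply, hF, RB.mk_apply, hq]
      have := (h0pos y).ne'
      field_simp
      ring
    obtain ⟨e1, e2⟩ := hpert (g l) ((l - l₀) • F) (r l) hs h2
    refine ⟨F, fun x => rfl, hFn, ?_, ?_⟩
    · rw [slope_def_field, hr.self_of_nhds _ _ hL, e1, map_smul, smul_eq_mul]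
      field_simp
    · refine e2.trans ?_
      rw [norm_smul, Real.norm_eq_abs]
      gcongr
  obtain ⟨F, hF⟩ := main.choice
  have hgconv : Tendsto g (𝓝[≠] l₀) (𝓝 g₀) := by
    rw [tendsto_iff_norm_sub_tendsto_zero]
    have lim : Tendsto (fun l => B * (1 + G) * (|l - l₀| * (G * (K / c)))) (𝓝[≠] l₀) (𝓝 0) := by
      have hcont : Continuous fun l => B * (1 + G) * (|l - l₀| * (G * (K / c))) := by fun_prop
      have := (hcont.tendsto l₀).mono_left (nhdsWithin_le_nhds (s := {l₀}ᶜ))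
      simpa using this
    exact squeeze_zero' (Eventually.of_forall fun _ => norm_nonneg _)
      (hF.mono fun l hl => hl.2.2.2) lim
  have hgpt : ∀ x, Tendsto (fun l => g l x) (𝓝[≠] l₀) (𝓝 (g₀ x)) := by
    intro x
    rw [tendsto_iff_norm_sub_tendsto_zero] at hgconv ⊢
    exact squeeze_zero (fun _ => norm_nonneg _) (fun l => RB.abs_apply_le (g l - g₀) x) hgconv
  have hint : Tendsto (fun l => ∫ x, |(F l - E) x| ∂ν) (𝓝[≠] l₀) (𝓝 (∫ _, (0 : ℝ) ∂ν)) := by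
    refine tendsto_integral_filter_of_dominated_convergence (fun _ => G * (K / c) + ‖E‖) ?_ ?_
      (integrable_const _) (ae_of_all _ fun x => ?_)
    · exact Eventually.of_forall fun l => (RB.measurable (F l - E)).abs.aestronglyMeasurable
    · filter_upwards [hF] with l hl
      refine ae_of_all _ fun x => ?_
      rw [Real.norm_eq_abs, abs_abs]
      exact (RB.abs_apply_le _ x).trans ((norm_sub_le _ _).trans (by gcongr; exact hl.2.1))
    · have h1 : Tendsto (fun l => g l x * q l x - g₀ x * e x) (𝓝[≠] l₀)
          (𝓝 (g₀ x * e x - g₀ x * e x)) := ((hgpt x).mul (hqe x)).sub_const _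
      rw [sub_self] at h1
      have h2 := h1.abs
      rw [abs_zero] at h2
      refine h2.congr' (hF.mono fun l hl => ?_)
      simp only [RB.sub_apply, hl.1 x, hE, RB.mk_apply]
  rw [integral_zero] at hint
  have hρ : Tendsto (fun l => hL.functional (F l)) (𝓝[≠] l₀) (𝓝 (hL.functional E)) := by
    rw [tendsto_iff_norm_sub_tendsto_zero]
    have lim := hint.const_mul (b / a)
    rw [mul_zero] at lim
    refine squeeze_zero (fun _ => norm_nonneg _) (fun l => ?_) lim
    rw [← map_sub]
    exact hL.abs_functional_le_integral _
  have hfinal : HasDerivAt r (hL.eigenvalue * hL.functional E) l₀ := by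
    rw [hasDerivAt_iff_tendsto_slope]
    exact (hρ.const_mul hL.eigenvalue).congr' (hF.mono fun l hl => hl.2.2.1.symm)
  exact hfinal.differentiableAt

end Perturbation

/-! ### The averaged weight `Ŵ` and its spectral radius -/

section Hat

variable {M : Type*} [MeasurableSpace M] (μ : Measure M) [IsProbabilityMeasure μ] {m : ℕ}

theorem hat_apply (W : BM (Fin (m + 1) → M) ℝ) (x : M) :
    hat μ W x = ∫ y : Fin m → M, Real.exp (W (Fin.cons x y)) ∂(Measure.pi fun _ => μ) := rfl

theorem measurable_exp_cons (W : BM (Fin (m + 1) → M) ℝ) (x : M) :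
    Measurable (fun y : Fin m → M => Real.exp (W (Fin.cons (α := fun _ => M) x y))) := by
  refine Real.measurable_exp.comp ((BM.measurable W).comp ?_)
  refine measurable_pi_lambda _ fun j => ?_
  refine Fin.cases ?_ (fun i => ?_) j
  · exact measurable_const
  · exact measurable_pi_apply i

theorem exp_apply_bounds {α : Type*} [MeasurableSpace α] (W : BM α ℝ) (z : α) :
    Real.exp (-‖W‖) ≤ Real.exp (W z) ∧ Real.exp (W z) ≤ Real.exp ‖W‖ := by
  have := abs_le.1 (BM.norm_apply_le W z)
  exact ⟨Real.exp_le_exp.2 this.1, Real.exp_le_exp.2 this.2⟩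

theorem integrable_exp_cons (W : BM (Fin (m + 1) → M) ℝ) (x : M) :
    Integrable (fun y : Fin m → M => Real.exp (W (Fin.cons (α := fun _ => M) x y)))
      (Measure.pi fun _ => μ) :=
  Integrable.of_bound (C := Real.exp ‖W‖) (measurable_exp_cons W x).aestronglyMeasurable
    (ae_of_all _ fun y => by
      rw [Real.norm_eq_abs, Real.abs_exp]; exact (exp_apply_bounds W _).2)

theorem hat_bounds (W : BM (Fin (m + 1) → M) ℝ) (x : M) :
    Real.exp (-‖W‖) ≤ hat μ W x ∧ hat μ W x ≤ Real.exp ‖W‖ := by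
  rw [hat_apply]
  constructor
  · have := integral_mono (μ := Measure.pi fun _ : Fin m => μ)
      (integrable_const (Real.exp (-‖W‖))) (integrable_exp_cons μ W x)
      (fun y => (exp_apply_bounds W _).1)
    rwa [integral_const, probReal_univ, one_smul] at this
  · have := integral_mono (μ := Measure.pi fun _ : Fin m => μ) (integrable_exp_cons μ W x)
      (integrable_const (Real.exp ‖W‖)) (fun y => (exp_apply_bounds W _).2)
    rwa [integral_const, probReal_univ, one_smul] at this

theorem abs_exp_sub_exp_le {s t B : ℝ} (hs : s ≤ B) (ht : t ≤ B) :
    |Real.exp s - Real.exp t| ≤ Real.exp B * |s - t| := by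
  wlog hst : t ≤ s generalizing s t
  · rw [abs_sub_comm, abs_sub_comm s]
    exact this ht hs (not_le.1 hst).le
  rw [abs_of_nonneg (sub_nonneg.2 (Real.exp_le_exp.2 hst)), abs_of_nonneg (sub_nonneg.2 hst)]
  have h1 : Real.exp t = Real.exp s * Real.exp (t - s) := by rw [← Real.exp_add]; ring_nf
  have h2 := Real.add_one_le_exp (t - s)
  have h3 := Real.exp_le_exp.2 hs
  rw [h1]
  nlinarith [Real.exp_pos s]

variable {κ : Kernel M M} [IsMarkovKernel κ] {n₀ : ℕ} {C : ℝ≥0} {ν : Measure M}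

variable (κ) in
/-- The leading eigenvalue of the operator with weight `Ŵ`, defined as its spectral radius `r(W)`,
which is finite, seen as a real number. -/
noncomputable def lead (W : BM (Fin (m + 1) → M) ℝ) : ℝ := (specRad κ μ W).toReal

/-- The operator on complex functions enters only here: its spectral radius is the leading eigenvalue
of the operator with the same weight on real functions. -/
theorem specRad_eq (W : BM (Fin (m + 1) → M) ℝ) {a b : ℝ}
    (hL : IsDoeblinOp (realOp κ (toRB (hat μ W))) ν n₀ a b) :
    specRad κ μ W = ENNReal.ofReal hL.eigenvalue :=
  spectralRadius_weightedOp κ (hat μ W) (fun x => (Real.exp_pos _).le.trans (hat_bounds μ W x).1) hL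

theorem lead_eq (W : BM (Fin (m + 1) → M) ℝ) {a b : ℝ}
    (hL : IsDoeblinOp (realOp κ (toRB (hat μ W))) ν n₀ a b) :
    lead μ κ W = hL.eigenvalue := by
  rw [lead, specRad_eq μ W hL, ENNReal.toReal_ofReal hL.eigenvalue_pos.le]

variable [IsProbabilityMeasure ν]

theorem DoeblinBound.isDoeblinOp_hat (hC : 0 < C) (hκ : DoeblinBound κ n₀ C ν)
    (W : BM (Fin (m + 1) → M) ℝ) :
    ∃ a b, IsDoeblinOp (realOp κ (toRB (hat μ W))) ν n₀ a b :=
  ⟨_, _, hκ.isDoeblinOp hC (Real.exp_pos (-‖W‖)) (hat_bounds μ W)⟩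

theorem DoeblinBound.lead_pos (hC : 0 < C) (hκ : DoeblinBound κ n₀ C ν)
    (W : BM (Fin (m + 1) → M) ℝ) : 0 < lead μ κ W := by
  obtain ⟨a, b, hL⟩ := hκ.isDoeblinOp_hat μ hC W
  rw [lead_eq μ W hL]
  exact hL.eigenvalue_pos

theorem DoeblinBound.log_specRad (hC : 0 < C) (hκ : DoeblinBound κ n₀ C ν)
    (W : BM (Fin (m + 1) → M) ℝ) :
    ENNReal.log (specRad κ μ W) = ((Real.log (lead μ κ W) : ℝ) : EReal) := by
  obtain ⟨a, b, hL⟩ := hκ.isDoeblinOp_hat μ hC W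
  rw [specRad_eq μ W hL, lead_eq μ W hL, ENNReal.log_ofReal_of_pos hL.eigenvalue_pos]

theorem DoeblinBound.differentiableAt_log_lead (hC : 0 < C)
    (hκ : DoeblinBound κ n₀ C ν) {W : ℝ → BM (Fin (m + 1) → M) ℝ} {l₀ : ℝ}
    (hdiff : ∀ z, DifferentiableAt ℝ (fun l => W l z) l₀)
    (hLip : ∃ K : ℝ, ∀ᶠ l in 𝓝 l₀, ∀ z, |W l z - W l₀ z| ≤ K * |l - l₀|) :
    DifferentiableAt ℝ (fun l => Real.log (lead μ κ (W l))) l₀ := by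
  obtain ⟨K', hK'⟩ := hLip
  set K := max K' 0 with hKdef
  have hK0 : 0 ≤ K := le_max_right _ _
  have hK : ∀ᶠ l in 𝓝 l₀, ∀ z, |W l z - W l₀ z| ≤ K * |l - l₀| := hK'.mono fun l hl z =>
    (hl z).trans (mul_le_mul_of_nonneg_right (le_max_left _ _) (abs_nonneg _))
  set B := ‖W l₀‖ + K with hB
  have hball : ∀ᶠ l in 𝓝 l₀, |l - l₀| ≤ 1 := by
    filter_upwards [Metric.closedBall_mem_nhds l₀ one_pos] with l hl
    rwa [Metric.mem_closedBall, Real.dist_eq] at hl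
  have hnorm : ∀ᶠ l in 𝓝 l₀, ‖W l‖ ≤ B := by
    filter_upwards [hK, hball] with l hl hb
    refine BM.norm_le (by positivity) fun z => ?_
    have h1 : K * |l - l₀| ≤ K := mul_le_of_le_one_right hK0 hb
    have h2 := BM.norm_apply_le (W l₀) z
    have h3 := hl z
    rw [Real.norm_eq_abs] at h2 ⊢
    rw [abs_le] at *
    constructor <;> linarith
  have hexp : ∀ᶠ l in 𝓝 l₀, ∀ z, |Real.exp (W l z) - Real.exp (W l₀ z)| ≤
      Real.exp B * K * |l - l₀| := by
    filter_upwards [hK, hnorm] with l hl hn z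
    have h1 := abs_le.1 (BM.norm_apply_le (W l) z)
    have h2 := abs_le.1 (BM.norm_apply_le (W l₀) z)
    have h3 := abs_exp_sub_exp_le (s := W l z) (t := W l₀ z) (B := B) (h1.2.trans hn)
      (h2.2.trans (by linarith))
    refine h3.trans ?_
    rw [mul_assoc]
    exact mul_le_mul_of_nonneg_left (hl z) (Real.exp_pos _).le
  have hd : DifferentiableAt ℝ (fun l => lead μ κ (W l)) l₀ := by
    refine hκ.differentiableAt_eigenvalue hC (h := fun l => toRB (hat μ (W l)))
      (c := Real.exp (-B)) (d := Real.exp B) (K := Real.exp B * K) (Real.exp_pos _) ?_ ?_ ?_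
      (Eventually.of_forall fun l a b hL => lead_eq μ (W l) hL)
    · filter_upwards [hnorm] with l hl x
      have := hat_bounds μ (W l) x
      exact ⟨(Real.exp_le_exp.2 (neg_le_neg hl)).trans this.1,
        this.2.trans (Real.exp_le_exp.2 hl)⟩
    · filter_upwards [hexp] with l hl x
      rw [toRB_apply, toRB_apply, hat_apply, hat_apply,
        ← integral_sub (integrable_exp_cons μ _ x) (integrable_exp_cons μ _ x)]
      have := norm_integral_le_of_norm_le_const (μ := Measure.pi fun _ : Fin m => μ)
        (f := fun y => Real.exp (W l (Fin.cons x y)) - Real.exp (W l₀ (Fin.cons x y)))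
        (ae_of_all _ fun y => hl (Fin.cons x y))
      rwa [probReal_univ, mul_one] at this
    · intro x
      have hslope : Tendsto (slope (fun l => hat μ (W l) x) l₀) (𝓝[≠] l₀)
          (𝓝 (∫ y : Fin m → M, deriv (fun l => Real.exp (W l (Fin.cons x y))) l₀
            ∂(Measure.pi fun _ => μ))) := by
        have := tendsto_integral_filter_of_dominated_convergence
          (μ := Measure.pi fun _ : Fin m => μ) (l := 𝓝[≠] l₀)
          (F := fun l y => slope (fun l => Real.exp (W l (Fin.cons x y))) l₀ l)
          (f := fun y => deriv (fun l => Real.exp (W l (Fin.cons x y))) l₀)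
          (fun _ => Real.exp B * K) ?_ ?_ (integrable_const _) (ae_of_all _ fun y => ?_)
        · refine this.congr fun l => ?_
          simp only [slope_def_field, hat_apply]
          rw [integral_div, integral_sub (integrable_exp_cons μ _ x) (integrable_exp_cons μ _ x)]
        · refine Eventually.of_forall fun l => ?_
          simp only [slope_def_field]
          exact (((measurable_exp_cons (W l) x).sub
            (measurable_exp_cons (W l₀) x)).div_const _).aestronglyMeasurable
        · filter_upwards [hexp.filter_mono nhdsWithin_le_nhds, self_mem_nhdsWithin] with l hl hne
          refine ae_of_all _ fun y => ?_
          have h1 : 0 < |l - l₀| := abs_pos.2 (sub_ne_zero.2 hne)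
          rw [slope_def_field, norm_div, Real.norm_eq_abs, Real.norm_eq_abs, div_le_iff₀ h1]
          exact hl _
        · exact (hdiff _).exp.hasDerivAt.tendsto_slope
      exact (hasDerivAt_iff_tendsto_slope.2 hslope).differentiableAt
  exact hd.log (hκ.lead_pos μ hC (W l₀)).ne'

end Hat

/-! ### Markov property and asymptotic independence at separated times -/

section MarkovChain

theorem IsMarkovChain.measurable_path {M : Type*} [MeasurableSpace M] {Ω : Type*} [MeasurableSpace Ω]
    {P : Measure Ω} {κ : Kernel M M} {X : ℕ → Ω → M} (hX : IsMarkovChain κ X P) :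
    Measurable fun ω n => X n ω :=
  measurable_pi_lambda _ hX.measurable

variable {M : Type*} [MeasurableSpace M] {κ : Kernel M M} [IsMarkovKernel κ]
  {Ω : Type*} [MeasurableSpace Ω] {P : Measure Ω} {X : ℕ → Ω → M}

/-- Under `pathLaw κ x` the coordinate process is a Markov chain. -/
theorem isMarkovChain_pathLaw (x : M) :
    IsMarkovChain κ (fun n (path : ℕ → M) => path n) (pathLaw κ x) where
  measurable n := measurable_pi_apply n
  hasCondDistrib n := by
    refine ⟨?_, ?_⟩
    · refine Measurable.aemeasurable ?_
      exact (measurable_pi_lambda _ fun i => measurable_pi_apply _).prodMk (measurable_pi_apply _)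
    · exact (Kernel.map_frestrictLe_trajMeasure_compProd_eq_map_trajMeasure
        (X := fun _ => M) (μ₀ := Measure.dirac x) (κ := stepKernel κ) (a := n)).symm

instance (x : M) : IsProbabilityMeasure (pathLaw κ x) := by
  unfold pathLaw; infer_instance

/-- Extension of a history up to time `u` to a whole path, constant after time `u`. -/
def extendHistory (u : ℕ) (h : Finset.Iic u → M) (n : ℕ) : M :=
  h ⟨min n u, Finset.mem_Iic.2 (min_le_right n u)⟩

theorem measurable_extendHistory (u : ℕ) : Measurable (extendHistory (M := M) u) :=
  measurable_pi_lambda _ fun _ => measurable_pi_apply _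

theorem measurable_lintegral_update {f : (ℕ → M) → ℝ≥0∞} (hf : Measurable f) (u t : ℕ)
    (η : Kernel M M) [IsSFiniteKernel η] :
    Measurable fun x : ℕ → M => ∫⁻ y, f (Function.update x t y) ∂(η (x u)) := by
  have h1 : Measurable fun p : (ℕ → M) × M => f (Function.update p.1 t p.2) := by
    refine hf.comp (measurable_pi_lambda _ fun i => ?_)
    by_cases hi : i = t
    · subst hi; simpa using measurable_snd
    · simp only [Function.update_of_ne hi]
      exact (measurable_pi_apply i).comp measurable_fst
  exact h1.lintegral_kernel_prod_right' (κ := η.comap (fun x : ℕ → M => x u) (measurable_pi_apply u))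

/-- The Markov property over one step: the state at time `u + 1` is integrated out. -/
theorem IsMarkovChain.lintegral_succ [SFinite P] (hX : IsMarkovChain κ X P) {f : (ℕ → M) → ℝ≥0∞}
    (hf : Measurable f) (u : ℕ) (hdep : DependsOn f (Set.Iic (u + 1))) :
    ∫⁻ ω, f (fun n => X n ω) ∂P =
      ∫⁻ ω, ∫⁻ y, f (Function.update (fun n => X n ω) (u + 1) y) ∂(κ (X u ω)) ∂P := by
  set Φ : (Finset.Iic u → M) × M → ℝ≥0∞ :=
    fun p => f (Function.update (extendHistory u p.1) (u + 1) p.2) with hΦ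
  have hΦm : Measurable Φ := by
    refine hf.comp (measurable_pi_lambda _ fun i => ?_)
    by_cases hi : i = u + 1
    · subst hi; simpa using measurable_snd
    · simp only [Function.update_of_ne hi]
      exact ((measurable_pi_apply i).comp (measurable_extendHistory u)).comp measurable_fst
  have hval : ∀ (x : ℕ → M) (y : M), f (Function.update x (u + 1) y) =
      Φ (fun i => x i, y) := by
    intro x y
    refine hdep fun i hi => ?_
    by_cases h : i = u + 1
    · subst h; simp
    · have : i ≤ u := by simp only [Set.mem_Iic] at hi; omega
      simp [Function.update_of_ne h, extendHistory, this]
  have hhist : Measurable fun ω => fun i : Finset.Iic u => X i ω :=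
    measurable_pi_lambda _ fun i => hX.measurable _
  have hlaw := (hX.hasCondDistrib u).map_eq
  calc ∫⁻ ω, f (fun n => X n ω) ∂P = ∫⁻ ω, Φ (fun i => X i ω, X (u + 1) ω) ∂P := by
        refine lintegral_congr fun ω => ?_
        rw [← hval (fun n => X n ω), Function.update_eq_self]
    _ = ∫⁻ p, Φ p ∂(P.map fun ω => (fun i : Finset.Iic u => X i ω, X (u + 1) ω)) :=
        (lintegral_map hΦm (hhist.prodMk (hX.measurable _))).symm
    _ = ∫⁻ h, ∫⁻ y, Φ (h, y) ∂(stepKernel κ u h) ∂(P.map fun ω => fun i : Finset.Iic u => X i ω) := by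
        rw [hlaw, Measure.lintegral_compProd hΦm]
    _ = ∫⁻ ω, ∫⁻ y, Φ (fun i => X i ω, y) ∂(κ (X u ω)) ∂P := by
        rw [lintegral_map hΦm.lintegral_kernel_prod_right' hhist]
        rfl
    _ = _ := by simp only [hval]

/-- The Markov property over several steps, for functions of the past of time `u` and of the state
at the later time `u + j + 1`. -/
theorem IsMarkovChain.lintegral_add [SFinite P] (hX : IsMarkovChain κ X P) (u j : ℕ)
    {f : (ℕ → M) → ℝ≥0∞} (hf : Measurable f)
    (hdep : DependsOn f (Set.Iic u ∪ {u + (j + 1)})) :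
    ∫⁻ ω, f (fun n => X n ω) ∂P =
      ∫⁻ ω, ∫⁻ y, f (Function.update (fun n => X n ω) (u + (j + 1)) y)
        ∂((κ ^ (j + 1)) (X u ω)) ∂P := by
  induction j generalizing f with
  | zero =>
    rw [zero_add, pow_one]
    refine hX.lintegral_succ hf u fun x y hxy => hdep fun i hi => hxy i ?_
    rcases hi with hi | hi <;> simp only [Set.mem_Iic, Set.mem_singleton_iff] at * <;> omega
  | succ j ih =>
    set t := u + (j + 1) with ht
    have ht1 : u + (j + 1 + 1) = t + 1 := by omega
    rw [ht1] at hdep ⊢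
    have hpow := isMarkovKernel_pow κ (j + 1)
    have hmeas := measurable_lintegral_update hf t (t + 1) κ
    rw [hX.lintegral_succ hf t fun x y hxy => hdep fun i hi => hxy i (by
      rcases hi with hi | hi <;> simp only [Set.mem_Iic, Set.mem_singleton_iff] at * <;> omega)]
    rw [ih (f := fun x => ∫⁻ y, f (Function.update x (t + 1) y) ∂(κ (x t))) hmeas]
    · refine lintegral_congr fun ω => ?_
      rw [pow_succ' κ (j + 1)]
      change _ = ∫⁻ y, _ ∂((κ ∘ₖ (κ ^ (j + 1))) (X u ω))
      rw [Kernel.lintegral_comp _ _ _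
        (show Measurable fun y => f (Function.update (fun n => X n ω) (t + 1) y) from
          hf.comp (measurable_update _))]
      refine lintegral_congr fun z => ?_
      rw [Function.update_self]
      refine lintegral_congr fun y => hdep fun i hi => ?_
      by_cases h : i = t + 1
      · subst h; simp
      · have : i ≠ t := by
          rcases hi with hi | hi <;> simp only [Set.mem_Iic, Set.mem_singleton_iff] at hi <;> omega
        simp [Function.update_of_ne h, Function.update_of_ne this]
    · intro x y hxy
      have h1 : x t = y t := hxy t (Or.inr rfl)
      simp only [h1]
      refine lintegral_congr fun z => hdep fun i hi => ?_
      by_cases h : i = t + 1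
      · subst h; simp
      · rw [Function.update_of_ne h, Function.update_of_ne h]
        refine hxy i (Or.inl ?_)
        rcases hi with hi | hi
        · exact hi
        · exact absurd hi h

theorem dependsOn_lintegral_update {f : (ℕ → M) → ℝ≥0∞} {A : Set ℕ} {t : ℕ} (μ : Measure M)
    (hdep : DependsOn f (insert t A)) :
    DependsOn (fun x => ∫⁻ y, f (Function.update x t y) ∂μ) A := by
  intro x y hxy
  refine lintegral_congr fun z => hdep fun i hi => ?_
  by_cases h : i = t
  · subst h; simp
  · rw [Function.update_of_ne h, Function.update_of_ne h]
    exact hxy i (hi.resolve_left h)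

theorem measurable_lintegral_update_const {f : (ℕ → M) → ℝ≥0∞} (hf : Measurable f) (t : ℕ)
    (μ : Measure M) [SFinite μ] :
    Measurable fun x : ℕ → M => ∫⁻ y, f (Function.update x t y) ∂μ := by
  simpa using measurable_lintegral_update hf 0 t (Kernel.const M μ)

/-- A set of times, all later than `N`, in which consecutive times (and `N`) are separated by at
least `k`. -/
structure IsSeparated (k N : ℕ) (s : Finset ℕ) : Prop where
  after : ∀ t ∈ s, N + k ≤ t
  gap : ∀ t ∈ s, ∀ t' ∈ s, t < t' → t + k ≤ t'

/-- If `κ ^ k` is comparable to `μ`, the states at separated times after `N` may be replaced by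
independent variables with law `μ`, at the cost of one constant per time. -/
theorem IsMarkovChain.lintegral_separated [SFinite P] (hX : IsMarkovChain κ X P) {μ : Measure M}
    [IsProbabilityMeasure μ] {k : ℕ} (hk : 0 < k) {c c' : ℝ≥0∞}
    (hc : ∀ x, c • μ ≤ (κ ^ k) x) (hc' : ∀ x, (κ ^ k) x ≤ c' • μ) {N : ℕ} (s : Finset ℕ)
    (hs : IsSeparated k N s) {f : (ℕ → M) → ℝ≥0∞} (hf : Measurable f)
    (hdep : DependsOn f (Set.Iic N ∪ s)) :
    c ^ s.card * ∫⁻ ω, (∫⋯∫⁻_s, f ∂fun _ => μ) (fun n => X n ω) ∂P ≤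
        ∫⁻ ω, f (fun n => X n ω) ∂P ∧
      ∫⁻ ω, f (fun n => X n ω) ∂P ≤
        c' ^ s.card * ∫⁻ ω, (∫⋯∫⁻_s, f ∂fun _ => μ) (fun n => X n ω) ∂P := by
  -- the latest time is replaced first
  induction s using Finset.induction_on_max generalizing f with
  | empty => simp
  | insert t s hlt ih =>
    have hts : t ∉ s := fun h => lt_irrefl _ (hlt t h)
    obtain ⟨j, rfl⟩ := Nat.exists_eq_succ_of_ne_zero hk.ne'
    obtain ⟨u, hu⟩ := Nat.exists_eq_add_of_le'
      ((Nat.le_add_left (j.succ) N).trans (hs.after t (Finset.mem_insert_self t s)))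
    have hNu : N ≤ u := by have := hs.after t (Finset.mem_insert_self t s); omega
    have hsu : ∀ t' ∈ s, t' ≤ u := fun t' ht' => by
      have := hs.gap t' (Finset.mem_insert_of_mem ht') t (Finset.mem_insert_self t s) (hlt t' ht')
      omega
    have hdep' : DependsOn f (insert t (Set.Iic N ∪ (s : Set ℕ))) := fun x y hxy =>
      hdep fun i hi => hxy i (by
        rw [Finset.coe_insert] at hi
        rcases hi with hi | hi | hi
        · exact Or.inr (Or.inl hi)
        · exact Or.inl hi
        · exact Or.inr (Or.inr hi))
    have hs' : IsSeparated (j.succ) N s :=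
      ⟨fun t' ht' => hs.after t' (Finset.mem_insert_of_mem ht'), fun t' ht' t'' ht'' =>
        hs.gap t' (Finset.mem_insert_of_mem ht') t'' (Finset.mem_insert_of_mem ht'')⟩
    set g : (ℕ → M) → ℝ≥0∞ := fun x => ∫⁻ y, f (Function.update x t y) ∂μ with hg
    have hgm : Measurable g := measurable_lintegral_update_const hf t μ
    obtain ⟨ih1, ih2⟩ := ih hs' hgm (dependsOn_lintegral_update μ hdep')
    have hmark := hX.lintegral_add u j hf (fun x y hxy => hdep' fun i hi => hxy i (by
      rcases hi with hi | hi | hi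
      · exact Or.inr (by rw [Set.mem_singleton_iff, hi, hu])
      · exact Or.inl (le_trans hi hNu)
      · exact Or.inl (hsu i hi)))
    have hut : u + (j + 1) = t := hu.symm
    rw [hut] at hmark
    have hgX : Measurable fun ω => g (fun n => X n ω) := hgm.comp hX.measurable_path
    have hlow : c * ∫⁻ ω, g (fun n => X n ω) ∂P ≤ ∫⁻ ω, f (fun n => X n ω) ∂P := by
      rw [hmark, ← lintegral_const_mul _ hgX]
      refine lintegral_mono fun ω => ?_
      rw [hg, ← smul_eq_mul, ← lintegral_smul_measure]
      exact lintegral_mono' (hc _) le_rfl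
    have hupp : ∫⁻ ω, f (fun n => X n ω) ∂P ≤ c' * ∫⁻ ω, g (fun n => X n ω) ∂P := by
      rw [hmark, ← lintegral_const_mul _ hgX]
      refine lintegral_mono fun ω => ?_
      rw [hg, ← smul_eq_mul, ← lintegral_smul_measure]
      exact lintegral_mono' (hc' _) le_rfl
    rw [lmarginal_insert' f hf hts, Finset.card_insert_of_notMem hts, pow_succ', pow_succ', mul_assoc,
      mul_assoc]
    exact ⟨(mul_le_mul_right ih1 _).trans hlow, hupp.trans (mul_le_mul_right ih2 _)⟩

/-- The expectation of a product of weights along the chain is given by the powers of the weighted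
transition operator. -/
theorem IsMarkovChain.lintegral_prod [SFinite P] (hX : IsMarkovChain κ X P) {h : RB M}
    (h0 : ∀ x, 0 ≤ h x) (N : ℕ) {g : RB M} (hg : ∀ x, 0 ≤ g x) :
    ∫⁻ ω, (∏ n ∈ Finset.Icc 1 N, ENNReal.ofReal (h (X n ω))) * ENNReal.ofReal (g (X N ω)) ∂P =
      ∫⁻ ω, ENNReal.ofReal ((realOp κ h ^ N) g (X 0 ω)) ∂P := by
  induction N generalizing g with
  | zero => simp
  | succ N ih =>
    have hmg : Measurable g := RB.measurable g
    have hmh : Measurable h := RB.measurable h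
    set f : (ℕ → M) → ℝ≥0∞ := fun x => (∏ n ∈ Finset.Icc 1 (N + 1), ENNReal.ofReal (h (x n))) *
      ENNReal.ofReal (g (x (N + 1))) with hf
    have hfm : Measurable f := by
      refine Measurable.mul (Finset.measurable_fun_prod _ fun n _ => ?_) ?_
      · exact (hmh.comp (measurable_pi_apply n)).ennreal_ofReal
      · exact (hmg.comp (measurable_pi_apply _)).ennreal_ofReal
    have hdep : DependsOn f (Set.Iic (N + 1)) := by
      intro x y hxy
      simp only [hf]
      rw [hxy (N + 1) (Set.mem_Iic.2 le_rfl)]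
      congr 1
      refine Finset.prod_congr rfl fun n hn => ?_
      rw [hxy n (Finset.mem_Icc.1 hn).2]
    have hstep := hX.lintegral_succ hfm N hdep
    have hL : (realOp κ h ^ (N + 1)) g = (realOp κ h ^ N) (realOp κ h g) := by rw [pow_succ]; rfl
    rw [hL, ← ih (realOp_nonneg κ h0 hg)]
    refine hstep.trans (lintegral_congr fun ω => ?_)
    rw [realOp_apply, ofReal_integral_eq_lintegral_ofReal (integrable_mul_real κ h g _)
      (ae_of_all _ fun y => mul_nonneg (hg y) (h0 y)), ← lintegral_const_mul _
      (show Measurable fun y => ENNReal.ofReal (g y * h y) from (hmg.mul hmh).ennreal_ofReal)]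
    refine lintegral_congr fun y => ?_
    simp only [hf, Function.update_self]
    rw [Finset.prod_Icc_succ_top (by omega), Function.update_self, mul_assoc, mul_comm (g y),
      ENNReal.ofReal_mul (h0 y)]
    congr 1
    refine Finset.prod_congr rfl fun n hn => ?_
    have : n ≠ N + 1 := by have := (Finset.mem_Icc.1 hn).2; omega
    rw [Function.update_of_ne this]

end MarkovChain

/-! ### Marginals of products over disjoint blocks -/

section Marginal

variable {M : Type*} [MeasurableSpace M] {μ : Measure M}

/-- A factor that does not depend on the integrated variables can be taken out. -/
theorem lmarginal_mul_left {s : Finset ℕ} {f g : (ℕ → M) → ℝ≥0∞} (hf : Measurable f)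
    (hg : DependsOn g (s : Set ℕ)ᶜ) (x : ℕ → M) :
    (∫⋯∫⁻_s, (fun x => g x * f x) ∂fun _ => μ) x = g x * (∫⋯∫⁻_s, f ∂fun _ => μ) x := by
  simp only [lmarginal]
  rw [← lintegral_const_mul _
    (show Measurable fun y => f (Function.updateFinset x s y) from hf.comp measurable_updateFinset)]
  refine lintegral_congr fun y => ?_
  congr 1
  refine hg fun i hi => ?_
  simp only [Set.mem_compl_iff, Finset.mem_coe] at hi
  simp [Function.updateFinset, hi]

variable [IsProbabilityMeasure μ]

/-- Integrating out the variables at the times `t j n`, `n ∈ A`, from a product over `n` factorises,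
provided these times are distinct and different from the `n ∈ A`. -/
theorem lmarginal_prod_blocks {m : ℕ} {w : (Fin (m + 1) → M) → ℝ≥0∞} (hw : Measurable w)
    (t : Fin m → ℕ → ℕ) (A : Finset ℕ)
    (hinj : ∀ j, ∀ n ∈ A, ∀ j', ∀ n' ∈ A, t j n = t j' n' → j = j' ∧ n = n')
    (hne : ∀ j, ∀ n ∈ A, t j n ∉ A) (x : ℕ → M) :
    (∫⋯∫⁻_(A.biUnion fun n => Finset.univ.image fun j => t j n),
        (fun x => ∏ n ∈ A, w (Fin.cons (x n) fun j => x (t j n))) ∂fun _ => μ) x =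
      ∏ n ∈ A, ∫⁻ y, w (Fin.cons (x n) y) ∂(Measure.pi fun _ : Fin m => μ) := by
  have hcons : ∀ n, Measurable fun x : ℕ → M =>
      w (Fin.cons (α := fun _ => M) (x n) fun j => x (t j n)) := by
    intro n
    refine hw.comp (measurable_pi_lambda _ fun j => ?_)
    refine Fin.cases ?_ (fun i => ?_) j
    · exact measurable_pi_apply n
    · exact measurable_pi_apply (t i n)
  induction A using Finset.induction_on generalizing x with
  | empty => simp
  | insert n A hn ih =>
    set sn := Finset.univ.image fun j => t j n with hsn
    set s := A.biUnion fun n => Finset.univ.image fun j => t j n with hs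
    have hmem : ∀ i, i ∈ s ↔ ∃ n' ∈ A, ∃ j, t j n' = i := fun i => by simp [hs]
    have hmemn : ∀ i, i ∈ sn ↔ ∃ j, t j n = i := fun i => by simp [hsn]
    have hI : n ∈ insert n A := Finset.mem_insert_self n A
    have hdisj : Disjoint sn s := by
      rw [Finset.disjoint_left]
      intro i hi hi'
      obtain ⟨j, rfl⟩ := (hmemn i).1 hi
      obtain ⟨n', hn', j', hj'⟩ := (hmem _).1 hi'
      have := (hinj j' n' (Finset.mem_insert_of_mem hn') j n hI hj').2
      exact hn (this ▸ hn')
    have hf' : Measurable fun x : ℕ → M =>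
        ∏ n ∈ A, w (Fin.cons (α := fun _ => M) (x n) fun j => x (t j n)) :=
      Finset.measurable_fun_prod _ fun n _ => hcons n
    rw [Finset.biUnion_insert]
    simp only [Finset.prod_insert hn]
    rw [lmarginal_union _ _ (show Measurable fun x : ℕ → M =>
      w (Fin.cons (α := fun _ => M) (x n) fun j => x (t j n)) *
        ∏ n ∈ A, w (Fin.cons (x n) fun j => x (t j n)) from (hcons n).mul hf') hdisj]
    have hinner : (∫⋯∫⁻_s, (fun x => w (Fin.cons (α := fun _ => M) (x n) fun j => x (t j n)) *
        ∏ n ∈ A, w (Fin.cons (x n) fun j => x (t j n))) ∂fun _ => μ) =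
        fun x => (∏ n ∈ A, ∫⁻ y, w (Fin.cons (x n) y) ∂(Measure.pi fun _ : Fin m => μ)) *
          w (Fin.cons (x n) fun j => x (t j n)) := by
      funext x
      rw [lmarginal_mul_left hf', ih (fun j n hn j' n' hn' => hinj j n (Finset.mem_insert_of_mem hn)
        j' n' (Finset.mem_insert_of_mem hn')) (fun j n hn h => hne j n (Finset.mem_insert_of_mem hn)
          (Finset.mem_insert_of_mem h)), mul_comm]
      intro x y hxy
      have h1 : x n = y n := hxy n fun h => by
        obtain ⟨n', hn', j, hj⟩ := (hmem _).1 h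
        exact hne j n' (Finset.mem_insert_of_mem hn') (hj.symm ▸ hI)
      have h2 : (fun j => x (t j n)) = fun j => y (t j n) := funext fun j => hxy _ fun h =>
        Finset.disjoint_left.1 hdisj ((hmemn _).2 ⟨j, rfl⟩) h
      simp only [h1, h2]
    rw [hinner, lmarginal_mul_left (hcons n), mul_comm]
    · congr 1
      have hni : n ∉ sn := fun h => by
        obtain ⟨j, hj⟩ := (hmemn _).1 h
        exact hne j n hI (hj.symm ▸ hI)
      have he : Function.Injective fun j => t j n := fun j j' h => (hinj j n hI j' n hI h).1
      have hF : Measurable fun y : Fin m → M => w (Fin.cons (α := fun _ => M) (x n) y) := by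
        refine hw.comp (measurable_pi_lambda _ fun j => ?_)
        refine Fin.cases ?_ (fun i => ?_) j
        · exact measurable_const
        · exact measurable_pi_apply i
      have h1 := lmarginal_image (μ := fun _ : ℕ => μ) (X := fun _ => M) he Finset.univ hF x
      rw [lmarginal_univ] at h1
      refine Eq.trans ?_ h1
      simp only [lmarginal]
      refine lintegral_congr fun y => ?_
      congr 2
      simp [Function.updateFinset, hni]
    · intro x y hxy
      refine Finset.prod_congr rfl fun n' hn' => ?_
      rw [hxy n' fun h => ?_]
      obtain ⟨j, hj⟩ := (hmemn _).1 h
      exact hne j n hI (hj.symm ▸ Finset.mem_insert_of_mem hn')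

end Marginal

/-! ### Separation of the sampling times -/

section Sampling

variable {m : ℕ} {q : Fin (m + 1) → ℝ → ℝ}

/-- The sampling times as natural numbers; at positive integers the floor changes nothing. -/
noncomputable def natTime (q : Fin (m + 1) → ℝ → ℝ) (j : Fin (m + 1)) (n : ℕ) : ℕ := ⌊q j (n : ℝ)⌋₊

namespace IsSamplingTimes

theorem natTime_cast (hq : IsSamplingTimes q) (j : Fin (m + 1)) {n : ℕ} (hn : 0 < n) :
    (natTime q j n : ℝ) = q j n := by
  obtain ⟨k, hk⟩ := hq.integer j n hn
  rw [natTime, hk, Nat.floor_natCast]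

theorem natTime_zero (hq : IsSamplingTimes q) {n : ℕ} (hn : 0 < n) : natTime q 0 n = n := by
  have := hq.natTime_cast 0 hn
  rw [hq.first n hn] at this
  exact_mod_cast this

theorem natTime_mono (hq : IsSamplingTimes q) (j : Fin (m + 1)) {n n' : ℕ} (hn : 0 < n)
    (h : n ≤ n') : natTime q j n ≤ natTime q j n' := by
  have h1 : q j n ≤ q j n' := hq.mono j (by simpa using hn)
    (by simpa using hn.trans_le h) (by exact_mod_cast h)
  rw [← hq.natTime_cast j hn, ← hq.natTime_cast j (hn.trans_le h)] at h1
  exact_mod_cast h1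

theorem eventually_gap (hq : IsSamplingTimes q) (k : ℕ) :
    ∀ᶠ n in atTop, ∀ j : Fin m, natTime q j.succ (n - 1) + k ≤ natTime q j.succ n := by
  rw [eventually_all]
  intro j
  filter_upwards [(hq.gap j).eventually_ge_atTop (k : ℝ), eventually_ge_atTop 2] with n hn h2
  have e : (n : ℝ) - 1 = ((n - 1 : ℕ) : ℝ) := by rw [Nat.cast_sub (by omega)]; simp
  rw [e, ← hq.natTime_cast _ (by omega), ← hq.natTime_cast _ (by omega)] at hn
  have h3 : (natTime q j.succ (n - 1) : ℝ) + k ≤ natTime q j.succ n := by linarith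
  exact_mod_cast h3

theorem eventually_growth (hq : IsSamplingTimes q) {ε : ℝ} (hε : 0 < ε) :
    ∀ᶠ N : ℕ in atTop, ∀ j : Fin m, natTime q j.castSucc N < natTime q j.succ ⌈ε * N⌉₊ := by
  rw [eventually_all]
  intro j
  filter_upwards [eventually_lt_of_lt_liminf (hq.growth j ε hε), eventually_gt_atTop 0] with N hN h0
  have hN' : 0 < q j.succ (ε * N) - q j.castSucc N := by exact_mod_cast hN
  have hpos : 0 < ε * N := by positivity
  have hceil : 0 < ⌈ε * N⌉₊ := Nat.ceil_pos.2 hpos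
  have h1 : q j.succ (ε * N) ≤ q j.succ (⌈ε * N⌉₊ : ℝ) :=
    hq.mono _ hpos (by simpa using hceil) (Nat.le_ceil _)
  have h2 : (natTime q j.castSucc N : ℝ) < natTime q j.succ ⌈ε * N⌉₊ := by
    rw [hq.natTime_cast _ h0, hq.natTime_cast _ hceil]
    linarith
  exact_mod_cast h2

/-- For large `N`, the times `q_j(n)` with `j ≥ 2` and `ε N < n ≤ N` are all later than `N`, and
they are separated by at least `k`, in the lexicographic order of the pairs `(j, n)`. -/
theorem eventually_separated (hq : IsSamplingTimes q) {k : ℕ} {ε : ℝ} (hε : 0 < ε)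
    (hε1 : ε ≤ 1) : ∀ᶠ N : ℕ in atTop,
      (∀ j : Fin m, ∀ n ∈ Finset.Ioc ⌈ε * N⌉₊ N, N + k < natTime q j.succ n) ∧
      (∀ j j' : Fin m, ∀ n ∈ Finset.Ioc ⌈ε * N⌉₊ N, ∀ n' ∈ Finset.Ioc ⌈ε * N⌉₊ N,
        (j < j' ∨ j = j' ∧ n < n') → natTime q j.succ n + k ≤ natTime q j'.succ n') := by
  obtain ⟨n₂, hn₂⟩ := eventually_atTop.1 (hq.eventually_gap k)
  have hlarge : Tendsto (fun N : ℕ => ⌈ε * N⌉₊) atTop atTop :=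
    tendsto_nat_ceil_atTop.comp (tendsto_natCast_atTop_atTop.const_mul_atTop hε)
  filter_upwards [hq.eventually_growth hε, hlarge.eventually_ge_atTop (n₂ + 1),
    eventually_gt_atTop 0] with N hgrow hceil hN
  set n₁ := ⌈ε * N⌉₊ with hn₁
  have hn₁N : n₁ ≤ N := Nat.ceil_le.2 (mul_le_of_le_one_left (Nat.cast_nonneg _) hε1)
  have hlev : ∀ j : Fin m, natTime q j.castSucc N < natTime q j.succ N := fun j =>
    (hgrow j).trans_le (hq.natTime_mono _ (by omega) hn₁N)
  have hmono : Monotone fun j : Fin (m + 1) => natTime q j N :=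
    Fin.monotone_iff_le_succ.2 fun j => (hlev j).le
  have hgap : ∀ j : Fin m, ∀ n n', n₁ ≤ n → n < n' →
      natTime q j.succ n + k ≤ natTime q j.succ n' := by
    intro j n n' h1 h2
    have h3 := hq.natTime_mono j.succ (n := n) (n' := n' - 1) (by omega) (by omega)
    have h4 := hn₂ n' (by omega) j
    omega
  have hfirst : ∀ j : Fin m, ∀ n ∈ Finset.Ioc n₁ N, natTime q j.castSucc N + k <
      natTime q j.succ n := by
    intro j n hn
    have h1 := hgap j n₁ n le_rfl (Finset.mem_Ioc.1 hn).1
    have h2 := hgrow j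
    omega
  refine ⟨fun j n hn => ?_, fun j j' n hn n' hn' hlt => ?_⟩
  · have h1 := hfirst j n hn
    have h2 := hmono (Fin.zero_le j.castSucc)
    simp only [hq.natTime_zero hN] at h2
    omega
  · rcases hlt with hlt | ⟨rfl, hlt⟩
    · have h1 := hfirst j' n' hn'
      have h2 : natTime q j.succ n ≤ natTime q j.succ N := hq.natTime_mono _
        (by have := (Finset.mem_Ioc.1 hn).1; omega) (Finset.mem_Ioc.1 hn).2
      have h3 : natTime q j.succ N ≤ natTime q j'.castSucc N := hmono (Fin.succ_le_castSucc_iff.2 hlt)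
      omega
    · exact hgap j n n' (Finset.mem_Ioc.1 hn).1.le hlt

end IsSamplingTimes

end Sampling

/-! ### The logarithmic moment generating function -/

section MomentGenerating

/-- Dropping the first `n₁` factors of a product changes it at most by the factor `E ^ n₁`, in both
directions. -/
theorem prod_Icc_Ioc_le {u : ℕ → ℝ≥0∞} {E : ℝ≥0∞} (h1 : ∀ n, u n ≤ E) (h2 : ∀ n, 1 ≤ E * u n)
    {n₁ N : ℕ} (h : n₁ ≤ N) :
    ∏ n ∈ Finset.Icc 1 N, u n ≤ E ^ n₁ * ∏ n ∈ Finset.Ioc n₁ N, u n ∧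
      ∏ n ∈ Finset.Ioc n₁ N, u n ≤ E ^ n₁ * ∏ n ∈ Finset.Icc 1 N, u n := by
  have hsplit : ∏ n ∈ Finset.Icc 1 N, u n =
      (∏ n ∈ Finset.Ioc 0 n₁, u n) * ∏ n ∈ Finset.Ioc n₁ N, u n := by
    rw [Finset.prod_Ioc_consecutive _ (Nat.zero_le _) h]
    rfl
  have hcard : (Finset.Ioc 0 n₁).card = n₁ := by simp
  rw [hsplit]
  constructor
  · refine mul_le_mul_left ?_ _
    calc _ ≤ ∏ n ∈ Finset.Ioc 0 n₁, E := Finset.prod_le_prod' fun n _ => h1 n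
      _ = E ^ n₁ := by rw [Finset.prod_const, hcard]
  · rw [← mul_assoc]
    refine le_mul_of_one_le_left zero_le ?_
    calc (1 : ℝ≥0∞) ≤ ∏ n ∈ Finset.Ioc 0 n₁, (E * u n) := Finset.one_le_prod' fun n _ => h2 n
      _ = _ := by rw [Finset.prod_mul_distrib, Finset.prod_const, hcard]

variable {M : Type*} [MeasurableSpace M] {m : ℕ} {q : Fin (m + 1) → ℝ → ℝ}

theorem measurable_nonconvSum (W : BM (Fin (m + 1) → M) ℝ) (N : ℕ) :
    Measurable fun path : ℕ → M => nonconvSum q W N path :=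
  Finset.measurable_fun_sum _ fun _ _ => (BM.measurable W).comp
    (measurable_pi_lambda _ fun _ => measurable_pi_apply _)

theorem abs_nonconvSum_le (W : BM (Fin (m + 1) → M) ℝ) (N : ℕ) (path : ℕ → M) :
    |nonconvSum q W N path| ≤ ‖W‖ * N := by
  refine (Finset.abs_sum_le_sum_abs _ _).trans
    ((Finset.sum_le_sum fun n _ => BM.norm_apply_le W _).trans (le_of_eq ?_))
  rw [Finset.sum_const, Nat.card_Icc, nsmul_eq_mul, Nat.add_sub_cancel, mul_comm]

variable {κ : Kernel M M} {Ω : Type*} [MeasurableSpace Ω] {P : Measure Ω}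
  [IsProbabilityMeasure P] {X : ℕ → Ω → M}

theorem IsMarkovChain.integrable_exp_nonconvSum (hX : IsMarkovChain κ X P)
    (W : BM (Fin (m + 1) → M) ℝ) (N : ℕ) :
    Integrable (fun ω => Real.exp (nonconvSum q W N fun n => X n ω)) P :=
  Integrable.of_bound (C := Real.exp (‖W‖ * N))
    (((measurable_nonconvSum W N).comp hX.measurable_path).exp).aestronglyMeasurable
    (ae_of_all _ fun ω => by
      rw [Real.norm_eq_abs, Real.abs_exp]
      exact Real.exp_le_exp.2 ((le_abs_self _).trans (abs_nonconvSum_le W N _)))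

variable [IsMarkovKernel κ] {n₀ : ℕ} {C : ℝ≥0} {ν μ : Measure M} [IsProbabilityMeasure μ]

theorem lintegral_ofReal_exp_cons (W : BM (Fin (m + 1) → M) ℝ) (x : M) :
    ∫⁻ y, ENNReal.ofReal (Real.exp (W (Fin.cons x y))) ∂(Measure.pi fun _ : Fin m => μ) =
      ENNReal.ofReal (hat μ W x) := by
  rw [hat_apply, ofReal_integral_eq_lintegral_ofReal (integrable_exp_cons μ W x)
    (ae_of_all _ fun y => (Real.exp_pos _).le)]

/-- Comparison of the nonconventional exponential moment with the corresponding product of averaged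
weights along the chain. -/
theorem IsMarkovChain.compare (hX : IsMarkovChain κ X P) (hq : IsSamplingTimes q)
    (W : BM (Fin (m + 1) → M) ℝ) {k : ℕ} (hk : 0 < k) {c c' : ℝ≥0∞} (hc1 : c ≤ 1) (hc1' : 1 ≤ c')
    (hc : ∀ x, c • μ ≤ (κ ^ k) x) (hc' : ∀ x, (κ ^ k) x ≤ c' • μ) {ε : ℝ} (hε : 0 < ε)
    (hε1 : ε ≤ 1) : ∀ᶠ N : ℕ in atTop,
      ∫⁻ ω, ENNReal.ofReal (Real.exp (nonconvSum q W N fun n => X n ω)) ∂P ≤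
          ENNReal.ofReal (Real.exp ‖W‖) ^ (2 * ⌈ε * N⌉₊) * c' ^ (m * N) *
            ∫⁻ ω, ∏ n ∈ Finset.Icc 1 N, ENNReal.ofReal (hat μ W (X n ω)) ∂P ∧
        c ^ (m * N) * ∫⁻ ω, ∏ n ∈ Finset.Icc 1 N, ENNReal.ofReal (hat μ W (X n ω)) ∂P ≤
          ENNReal.ofReal (Real.exp ‖W‖) ^ (2 * ⌈ε * N⌉₊) *
            ∫⁻ ω, ENNReal.ofReal (Real.exp (nonconvSum q W N fun n => X n ω)) ∂P := by
  filter_upwards [hq.eventually_separated (k := k) hε hε1] with N hsep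
  obtain ⟨hafter, hlex⟩ := hsep
  set n₁ := ⌈ε * N⌉₊ with hn₁
  have hn₁N : n₁ ≤ N := Nat.ceil_le.2 (mul_le_of_le_one_left (Nat.cast_nonneg _) hε1)
  set E := ENNReal.ofReal (Real.exp ‖W‖) with hE
  set A := Finset.Ioc n₁ N with hA
  set t : Fin m → ℕ → ℕ := fun j n => natTime q j.succ n with ht
  set s := A.biUnion fun n => Finset.univ.image fun j => t j n with hs
  set w : (Fin (m + 1) → M) → ℝ≥0∞ := fun z => ENNReal.ofReal (Real.exp (W z)) with hw
  have hwm : Measurable w := (BM.measurable W).exp.ennreal_ofReal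
  have hmem : ∀ i, i ∈ s ↔ ∃ n ∈ A, ∃ j, t j n = i := fun i => by simp [hs]
  have hinj : ∀ j, ∀ n ∈ A, ∀ j', ∀ n' ∈ A, t j n = t j' n' → j = j' ∧ n = n' := by
    intro j n hn j' n' hn' heq
    by_contra hne
    have hcases : (j < j' ∨ j = j' ∧ n < n') ∨ (j' < j ∨ j' = j ∧ n' < n) := by
      rcases lt_trichotomy j j' with h | h | h
      · exact Or.inl (Or.inl h)
      · rcases lt_trichotomy n n' with h' | h' | h'
        · exact Or.inl (Or.inr ⟨h, h'⟩)
        · exact absurd ⟨h, h'⟩ hne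
        · exact Or.inr (Or.inr ⟨h.symm, h'⟩)
      · exact Or.inr (Or.inl h)
    rcases hcases with h | h
    · have := hlex j j' n hn n' hn' h; simp only [ht] at heq; omega
    · have := hlex j' j n' hn' n hn h; simp only [ht] at heq; omega
  have hne : ∀ j, ∀ n ∈ A, t j n ∉ A := by
    intro j n hn h
    have h1 := hafter j n hn
    have h2 := (Finset.mem_Ioc.1 h).2
    simp only [ht] at h2
    omega
  have hsepS : IsSeparated k N s := by
    constructor
    · intro i hi
      obtain ⟨n, hn, j, rfl⟩ := (hmem i).1 hi
      exact (hafter j n hn).le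
    · intro i hi i' hi' hlt
      obtain ⟨n, hn, j, rfl⟩ := (hmem i).1 hi
      obtain ⟨n', hn', j', rfl⟩ := (hmem i').1 hi'
      rcases lt_trichotomy j j' with h | h | h
      · exact hlex j j' n hn n' hn' (Or.inl h)
      · rcases lt_trichotomy n n' with h' | h' | h'
        · exact hlex j j' n hn n' hn' (Or.inr ⟨h, h'⟩)
        · subst h; subst h'; exact absurd hlt (lt_irrefl _)
        · have := hlex j' j n' hn' n hn (Or.inr ⟨h.symm, h'⟩); simp only [ht] at hlt; omega
      · have := hlex j' j n' hn' n hn (Or.inl h); simp only [ht] at hlt; omega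
  have hcard : s.card ≤ m * N := by
    have h1 : s.card ≤ A.card * m := Finset.card_biUnion_le_card_mul A _ m fun n _ =>
      Finset.card_image_le.trans (by simp)
    have h2 : A.card ≤ N := by simp [hA]
    calc s.card ≤ A.card * m := h1
      _ ≤ N * m := Nat.mul_le_mul_right m h2
      _ = m * N := mul_comm _ _
  -- the factors with `n > n₁`
  set f : (ℕ → M) → ℝ≥0∞ := fun x => ∏ n ∈ A, w (Fin.cons (x n) fun j => x (t j n)) with hf
  have hfm : Measurable f := Finset.measurable_fun_prod _ fun n _ => hwm.comp
    (measurable_pi_lambda _ fun j => by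
      refine Fin.cases ?_ (fun i => ?_) j
      · exact measurable_pi_apply n
      · exact measurable_pi_apply (t i n))
  have hdep : DependsOn f (Set.Iic N ∪ s) := by
    intro x y hxy
    refine Finset.prod_congr rfl fun n hn => ?_
    have h1 : x n = y n := hxy n (Or.inl (Finset.mem_Ioc.1 hn).2)
    have h2 : (fun j => x (t j n)) = fun j => y (t j n) := funext fun j =>
      hxy _ (Or.inr ((hmem _).2 ⟨n, hn, j, rfl⟩))
    rw [h1, h2]
  obtain ⟨hlow, hupp⟩ := hX.lintegral_separated hk hc hc' s hsepS hfm hdep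
  have hmarg : ∀ x : ℕ → M, (∫⋯∫⁻_s, f ∂fun _ => μ) x = ∏ n ∈ A, ENNReal.ofReal (hat μ W (x n)) := by
    intro x
    rw [hf, hs, lmarginal_prod_blocks hwm t A hinj hne x]
    refine Finset.prod_congr rfl fun n _ => lintegral_ofReal_exp_cons W (x n)
  simp only [hmarg] at hlow hupp
  -- both full products differ from the partial ones by at most `E ^ n₁`
  have hsum : ∀ x : ℕ → M, ENNReal.ofReal (Real.exp (nonconvSum q W N x)) =
      ∏ n ∈ Finset.Icc 1 N, w (Fin.cons (x n) fun j => x (t j n)) := by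
    intro x
    rw [nonconvSum, Real.exp_sum, ENNReal.ofReal_prod_of_nonneg fun n _ => (Real.exp_pos _).le]
    refine Finset.prod_congr rfl fun n hn => ?_
    have hz : (fun j => x ⌊q j (n : ℝ)⌋₊) =
        Fin.cons (α := fun _ => M) (x n) fun j => x (t j n) := by
      funext j
      refine Fin.cases ?_ (fun i => rfl) j
      exact congrArg x (hq.natTime_zero (Finset.mem_Icc.1 hn).1)
    rw [hz]
  have hE1 : ∀ v : ℝ, Real.exp (-‖W‖) ≤ v → 1 ≤ E * ENNReal.ofReal v := by
    intro v hv
    rw [hE, ← ENNReal.ofReal_mul (Real.exp_pos _).le, ← ENNReal.ofReal_one]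
    refine ENNReal.ofReal_le_ofReal ?_
    calc (1 : ℝ) = Real.exp ‖W‖ * Real.exp (-‖W‖) := by rw [← Real.exp_add]; simp
      _ ≤ _ := by gcongr
  have hZ : ∀ x : ℕ → M, ENNReal.ofReal (Real.exp (nonconvSum q W N x)) ≤ E ^ n₁ * f x ∧
      f x ≤ E ^ n₁ * ENNReal.ofReal (Real.exp (nonconvSum q W N x)) := fun x => by
    rw [hsum]
    exact prod_Icc_Ioc_le (fun n => ENNReal.ofReal_le_ofReal (exp_apply_bounds W _).2)
      (fun n => hE1 _ (exp_apply_bounds W _).1) hn₁N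
  have hH : ∀ x : ℕ → M, ∏ n ∈ Finset.Icc 1 N, ENNReal.ofReal (hat μ W (x n)) ≤
        E ^ n₁ * ∏ n ∈ A, ENNReal.ofReal (hat μ W (x n)) ∧
      ∏ n ∈ A, ENNReal.ofReal (hat μ W (x n)) ≤
        E ^ n₁ * ∏ n ∈ Finset.Icc 1 N, ENNReal.ofReal (hat μ W (x n)) := fun x =>
    prod_Icc_Ioc_le (fun n => ENNReal.ofReal_le_ofReal (hat_bounds μ W _).2)
      (fun n => hE1 _ (hat_bounds μ W _).1) hn₁N
  have hEtop : E ^ n₁ ≠ ⊤ := ENNReal.pow_ne_top ENNReal.ofReal_ne_top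
  have hE2 : E ^ (2 * n₁) = E ^ n₁ * E ^ n₁ := by rw [two_mul, pow_add]
  constructor
  · calc _ ≤ ∫⁻ ω, E ^ n₁ * f (fun n => X n ω) ∂P := lintegral_mono fun ω => (hZ _).1
      _ = E ^ n₁ * ∫⁻ ω, f (fun n => X n ω) ∂P := lintegral_const_mul' _ _ hEtop
      _ ≤ E ^ n₁ * (c' ^ (m * N) * ∫⁻ ω, ∏ n ∈ A, ENNReal.ofReal (hat μ W (X n ω)) ∂P) := by
          refine mul_le_mul_right (hupp.trans (mul_le_mul_left ?_ _)) _
          exact pow_le_pow_right' hc1' hcard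
      _ ≤ E ^ n₁ * (c' ^ (m * N) * ∫⁻ ω, E ^ n₁ *
            ∏ n ∈ Finset.Icc 1 N, ENNReal.ofReal (hat μ W (X n ω)) ∂P) := by
          refine mul_le_mul_right (mul_le_mul_right (lintegral_mono fun ω => ?_) _) _
          exact (hH fun n => X n ω).2
      _ = _ := by rw [lintegral_const_mul' _ _ hEtop, hE2]; ring
  · calc _ ≤ c ^ (m * N) * ∫⁻ ω, E ^ n₁ * ∏ n ∈ A, ENNReal.ofReal (hat μ W (X n ω)) ∂P := by
          refine mul_le_mul_right (lintegral_mono fun ω => ?_) _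
          exact (hH fun n => X n ω).1
      _ = E ^ n₁ * (c ^ (m * N) * ∫⁻ ω, ∏ n ∈ A, ENNReal.ofReal (hat μ W (X n ω)) ∂P) := by
          rw [lintegral_const_mul' _ _ hEtop]; ring
      _ ≤ E ^ n₁ * ∫⁻ ω, f (fun n => X n ω) ∂P := by
          refine mul_le_mul_right (le_trans (mul_le_mul_left ?_ _) hlow) _
          exact pow_le_pow_right_of_le_one' hc1 hcard
      _ ≤ E ^ n₁ * ∫⁻ ω, E ^ n₁ * ENNReal.ofReal (Real.exp (nonconvSum q W N fun n => X n ω)) ∂P :=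
          mul_le_mul_right (lintegral_mono fun ω => (hZ _).2) _
      _ = _ := by rw [lintegral_const_mul' _ _ hEtop, hE2]; ring

/-- The moment of the product of averaged weights is `r(W) ^ N` up to constant factors. -/
theorem IsMarkovChain.lintegral_prod_hat_bounds (hX : IsMarkovChain κ X P)
    (W : BM (Fin (m + 1) → M) ℝ) {a b : ℝ}
    (hL : IsDoeblinOp (realOp κ (toRB (hat μ W))) ν n₀ a b) {N : ℕ} (hN : n₀ ≤ N) :
    ENNReal.ofReal (a / b * hL.eigenvalue ^ N) ≤
        ∫⁻ ω, ∏ n ∈ Finset.Icc 1 N, ENNReal.ofReal (hat μ W (X n ω)) ∂P ∧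
      ∫⁻ ω, ∏ n ∈ Finset.Icc 1 N, ENNReal.ofReal (hat μ W (X n ω)) ∂P ≤
        ENNReal.ofReal (b / a * hL.eigenvalue ^ N) := by
  have h := hX.lintegral_prod (h := toRB (hat μ W))
    (fun x => (Real.exp_pos _).le.trans (hat_bounds μ W x).1) N (g := RB.const M 1)
    (fun _ => zero_le_one' ℝ)
  simp only [RB.const_apply, ENNReal.ofReal_one, mul_one, toRB_apply] at h
  rw [h]
  constructor
  · calc _ = ∫⁻ _, ENNReal.ofReal (a / b * hL.eigenvalue ^ N) ∂P := by simp
      _ ≤ _ := lintegral_mono fun ω => ENNReal.ofReal_le_ofReal (hL.pow_one_bounds hN _).1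
  · calc _ ≤ ∫⁻ _, ENNReal.ofReal (b / a * hL.eigenvalue ^ N) ∂P :=
        lintegral_mono fun ω => ENNReal.ofReal_le_ofReal (hL.pow_one_bounds hN _).2
      _ = _ := by simp

theorem exists_small_log {η : ℝ} (hη : 0 < η) : ∃ δ : ℝ, 0 < δ ∧ δ < 1 ∧
    m * Real.log (1 + δ) < η / 4 ∧ -(η / 4) < m * Real.log (1 - δ) := by
  have l1 : Tendsto (fun δ : ℝ => m * Real.log (1 + δ)) (𝓝 0) (𝓝 (m * Real.log (1 + 0))) :=
    Tendsto.const_mul _ (Tendsto.log (tendsto_const_nhds.add tendsto_id) (by norm_num))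
  have l2 : Tendsto (fun δ : ℝ => m * Real.log (1 - δ)) (𝓝 0) (𝓝 (m * Real.log (1 - 0))) :=
    Tendsto.const_mul _ (Tendsto.log (tendsto_const_nhds.sub tendsto_id) (by norm_num))
  rw [add_zero, Real.log_one, mul_zero] at l1
  rw [sub_zero, Real.log_one, mul_zero] at l2
  have e1 := l1.eventually (gt_mem_nhds (by linarith : (0 : ℝ) < η / 4))
  have e2 := l2.eventually (lt_mem_nhds (by linarith : -(η / 4) < (0 : ℝ)))
  have e3 : ∀ᶠ δ : ℝ in 𝓝[>] 0, 0 < δ := self_mem_nhdsWithin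
  have e4 : ∀ᶠ δ : ℝ in 𝓝 0, δ < 1 := gt_mem_nhds one_pos
  obtain ⟨δ, h1, h2, h3, h4⟩ := ((e1.filter_mono nhdsWithin_le_nhds).and
    ((e2.filter_mono nhdsWithin_le_nhds).and (e3.and (e4.filter_mono nhdsWithin_le_nhds)))).exists
  exact ⟨δ, h3, h4, h1, h2⟩

/-- The elementary estimate behind the limit: bounds on `Z` by `r ^ N`, up to the factors
`(1 ± δ) ^ (m N)`, `exp (2 B n₁)` with `n₁ ≤ ε N + 1`, and constants, determine `log Z / N` up to
`η`. -/
theorem dist_log_lt {a b r B δ ε η Z : ℝ} {n₁ N : ℕ} (ha : 0 < a) (hb : 0 < b) (hr : 0 < r)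
    (hB : 0 ≤ B) (hδ0 : 0 < δ) (hδ1 : δ < 1) (hδu : m * Real.log (1 + δ) < η / 4)
    (hδl : -(η / 4) < m * Real.log (1 - δ)) (hε : 2 * B * ε < η / 4) (hN : 0 < N)
    (hn₁ : (n₁ : ℝ) ≤ ε * N + 1)
    (hD : 2 * B + |Real.log (a / b)| + |Real.log (b / a)| < η / 4 * N) (hZ : 0 < Z)
    (up : Z ≤ Real.exp B ^ (2 * n₁) * (1 + δ) ^ (m * N) * (b / a * r ^ N))
    (lo : (1 - δ) ^ (m * N) * (a / b * r ^ N) ≤ Real.exp B ^ (2 * n₁) * Z) :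
    dist (1 / (N : ℝ) * Real.log Z) (Real.log r) < η := by
  have hN0 : (0 : ℝ) < N := by exact_mod_cast hN
  have h1δ : 0 < 1 - δ := by linarith
  have logup : Real.log Z ≤ 2 * n₁ * B + m * N * Real.log (1 + δ) +
      (Real.log (b / a) + N * Real.log r) := by
    have := Real.log_le_log hZ up
    rw [Real.log_mul (by positivity) (by positivity), Real.log_mul (by positivity) (by positivity),
      Real.log_mul (by positivity) (by positivity), Real.log_pow, Real.log_pow, Real.log_pow,
      Real.log_exp] at this
    push_cast at this
    exact this
  have loglo : m * N * Real.log (1 - δ) + (Real.log (a / b) + N * Real.log r) ≤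
      2 * n₁ * B + Real.log Z := by
    have := Real.log_le_log (by positivity) lo
    rw [Real.log_mul (by positivity) (by positivity), Real.log_mul (by positivity) (by positivity),
      Real.log_mul (by positivity) (by positivity), Real.log_pow, Real.log_pow, Real.log_pow,
      Real.log_exp] at this
    push_cast at this
    exact this
  have e1 : 2 * n₁ * B ≤ η / 4 * N + 2 * B := by
    have h1 := mul_le_mul_of_nonneg_left hn₁ (by positivity : 0 ≤ 2 * B)
    have h2 := mul_le_mul_of_nonneg_right hε.le hN0.le
    linarith
  have e2 : m * N * Real.log (1 + δ) ≤ η / 4 * N := by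
    have h2 := mul_le_mul_of_nonneg_right hδu.le hN0.le
    linarith
  have e3 : -(η / 4 * N) ≤ m * N * Real.log (1 - δ) := by
    have h2 := mul_le_mul_of_nonneg_right hδl.le hN0.le
    linarith
  have e4 := le_abs_self (Real.log (b / a))
  have e5 := neg_abs_le (Real.log (a / b))
  have e6 := abs_nonneg (Real.log (b / a))
  have e7 := abs_nonneg (Real.log (a / b))
  have heq : 1 / (N : ℝ) * Real.log Z - Real.log r = (Real.log Z - N * Real.log r) / N := by
    field_simp
  rw [Real.dist_eq, heq, abs_div, abs_of_pos hN0, div_lt_iff₀ hN0, abs_lt]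
  constructor <;> linarith

/-- The limit of the logarithmic moments, for an arbitrary initial law. -/
theorem IsMarkovChain.tendsto_log_moment [IsProbabilityMeasure ν] (hX : IsMarkovChain κ X P) (hq : IsSamplingTimes q)
    (hC : 0 < C) (hκ : DoeblinBound κ n₀ C ν) (hμ : κ.Invariant μ)
    (W : BM (Fin (m + 1) → M) ℝ) :
    Tendsto (fun N : ℕ => (1 / (N : ℝ)) *
      Real.log (∫ ω, Real.exp (nonconvSum q W N fun n => X n ω) ∂P)) atTop
      (𝓝 (Real.log (lead μ κ W))) := by
  obtain ⟨a, b, hL⟩ := hκ.isDoeblinOp_hat μ hC W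
  rw [lead_eq μ W hL]
  set r := hL.eigenvalue with hr_def
  have hr : 0 < r := hL.eigenvalue_pos
  have ha := hL.a_pos
  have hb := hL.b_pos
  set B := ‖W‖ with hB_def
  have hB : 0 ≤ B := norm_nonneg _
  rw [Metric.tendsto_atTop']
  intro η hη
  obtain ⟨δ, hδ0, hδ1, hδu, hδl⟩ := exists_small_log (m := m) hη
  obtain ⟨ε, hε0, hε1, hεB⟩ : ∃ ε : ℝ, 0 < ε ∧ ε ≤ 1 ∧ 2 * B * ε < η / 4 := by
    refine ⟨min 1 (η / (8 * (B + 1))), by positivity, min_le_left _ _, ?_⟩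
    have h1 : min 1 (η / (8 * (B + 1))) ≤ η / (8 * (B + 1)) := min_le_right _ _
    have h2 : 0 < η / (8 * (B + 1)) := by positivity
    calc 2 * B * min 1 (η / (8 * (B + 1))) ≤ 2 * B * (η / (8 * (B + 1))) := by gcongr
      _ < 2 * (B + 1) * (η / (8 * (B + 1))) := by
          gcongr
          linarith
      _ = η / 4 := by field_simp; norm_num
  obtain ⟨k, hk⟩ := hκ.mixing hC hμ hδ0
  have hk' := hk (max k 1) (le_max_left _ _)
  have hcmp := hX.compare hq W (μ := μ) (k := max k 1) (by positivity)
    (c := ENNReal.ofReal (1 - δ)) (c' := ENNReal.ofReal (1 + δ))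
    (by rw [← ENNReal.ofReal_one]; exact ENNReal.ofReal_le_ofReal (by linarith))
    (by rw [← ENNReal.ofReal_one]; exact ENNReal.ofReal_le_ofReal (by linarith))
    (fun x => (hk' x).1) (fun x => (hk' x).2) hε0 hε1
  set D := 2 * B + |Real.log (a / b)| + |Real.log (b / a)| with hD
  have hsmall : ∀ᶠ N : ℕ in atTop, D / N < η / 4 :=
    (tendsto_const_div_atTop_nhds_zero_nat D).eventually (gt_mem_nhds (by positivity))
  suffices H : ∀ᶠ N : ℕ in atTop, dist ((1 / (N : ℝ)) *
      Real.log (∫ ω, Real.exp (nonconvSum q W N fun n => X n ω) ∂P)) (Real.log r) < η by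
    obtain ⟨N₀, hN₀⟩ := eventually_atTop.1 H
    exact ⟨N₀, fun n hn => hN₀ n hn.le⟩
  filter_upwards [hcmp, hsmall, eventually_ge_atTop n₀, eventually_gt_atTop 0]
    with N hN hDN hNn₀ hN0
  obtain ⟨hup, hlo⟩ := hN
  obtain ⟨hHl, hHu⟩ := hX.lintegral_prod_hat_bounds (μ := μ) W hL hNn₀
  set Z := ∫ ω, Real.exp (nonconvSum q W N fun n => X n ω) ∂P with hZdef
  have hint := hX.integrable_exp_nonconvSum (q := q) W N
  have hZ : ∫⁻ ω, ENNReal.ofReal (Real.exp (nonconvSum q W N fun n => X n ω)) ∂P =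
      ENNReal.ofReal Z :=
    (ofReal_integral_eq_lintegral_ofReal hint (ae_of_all _ fun ω => (Real.exp_pos _).le)).symm
  have hZpos : 0 < Z := integral_exp_pos hint
  set n₁ := ⌈ε * N⌉₊ with hn₁
  have hn₁le : (n₁ : ℝ) ≤ ε * N + 1 := (Nat.ceil_lt_add_one (by positivity)).le
  have h1δ : 0 < 1 - δ := by linarith
  have up : Z ≤ Real.exp B ^ (2 * n₁) * (1 + δ) ^ (m * N) * (b / a * r ^ N) := by
    have := hup.trans (mul_le_mul_right hHu _)
    rw [hZ, ← ENNReal.ofReal_pow (Real.exp_pos _).le, ← ENNReal.ofReal_pow (by linarith),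
      ← ENNReal.ofReal_mul (by positivity), ← ENNReal.ofReal_mul (by positivity)] at this
    exact (ENNReal.ofReal_le_ofReal_iff (by positivity)).1 this
  have lo : (1 - δ) ^ (m * N) * (a / b * r ^ N) ≤ Real.exp B ^ (2 * n₁) * Z := by
    have := (mul_le_mul_right hHl _).trans hlo
    rw [hZ, ← ENNReal.ofReal_pow (Real.exp_pos _).le, ← ENNReal.ofReal_pow (by linarith),
      ← ENNReal.ofReal_mul (by positivity), ← ENNReal.ofReal_mul (by positivity)] at this
    exact (ENNReal.ofReal_le_ofReal_iff (by positivity)).1 this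
  rw [div_lt_iff₀ (by exact_mod_cast hN0)] at hDN
  exact dist_log_lt ha hb hr hB hδ0 hδ1 hδu hδl hεB hN0 hn₁le hDN hZpos up lo

end MomentGenerating

/-! ### Large deviations from a differentiable logarithmic moment generating function -/

section GartnerEllis

/-- The Legendre transform `u ↦ sup_t (t u - Λ t)`, with values in the extended reals. -/
noncomputable def legendre (Λ : ℝ → ℝ) (u : ℝ) : EReal := ⨆ t : ℝ, ((t * u - Λ t : ℝ) : EReal)

theorem le_legendre (Λ : ℝ → ℝ) (u t : ℝ) : ((t * u - Λ t : ℝ) : EReal) ≤ legendre Λ u :=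
  le_iSup (fun t : ℝ => ((t * u - Λ t : ℝ) : EReal)) t

/-- `Λ` is the limiting logarithmic moment generating function of the random variables `Y N`, which
are at most of linear growth. -/
structure HasLogMoment {Ω : Type*} [MeasurableSpace Ω] (P : Measure Ω) (Y : ℕ → Ω → ℝ) (B : ℝ)
    (Λ : ℝ → ℝ) : Prop where
  measurable : ∀ N, Measurable (Y N)
  abs_le : ∀ N ω, |Y N ω| ≤ B * N
  tendsto : ∀ t, Tendsto (fun N : ℕ => (1 / (N : ℝ)) * Real.log (∫ ω, Real.exp (t * Y N ω) ∂P))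
    atTop (𝓝 (Λ t))

theorem log_ofReal_exp_div (α : ℝ) {N : ℕ} (hN : 0 < N) :
    ENNReal.log (ENNReal.ofReal (Real.exp (α * N))) / (N : EReal) = (α : EReal) := by
  have hN' : (N : ℝ) ≠ 0 := by positivity
  rw [ENNReal.log_ofReal_of_pos (Real.exp_pos _), Real.log_exp, ← EReal.coe_coe_eq_natCast,
    ← EReal.coe_div, mul_div_cancel_right₀ _ hN']

variable {Ω : Type*} [MeasurableSpace Ω] {P : Measure Ω}
  {Y : ℕ → Ω → ℝ} {B : ℝ} {Λ : ℝ → ℝ}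

namespace HasLogMoment

theorem measurableSet_div_mem (h : HasLogMoment P Y B Λ) (N : ℕ) {s : Set ℝ}
    (hs : MeasurableSet s) : MeasurableSet {ω | Y N ω / N ∈ s} :=
  ((h.measurable N).div_const _) hs

variable [IsProbabilityMeasure P]

theorem integrable (h : HasLogMoment P Y B Λ) (t : ℝ) (N : ℕ) :
    Integrable (fun ω => Real.exp (t * Y N ω)) P :=
  Integrable.of_bound (C := Real.exp (|t| * (B * N)))
    (((h.measurable N).const_mul t).exp).aestronglyMeasurable
    (ae_of_all _ fun ω => by
      rw [Real.norm_eq_abs, Real.abs_exp]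
      refine Real.exp_le_exp.2 ((le_abs_self _).trans ?_)
      rw [abs_mul]
      exact mul_le_mul_of_nonneg_left (h.abs_le N ω) (abs_nonneg t))

theorem moment_pos (h : HasLogMoment P Y B Λ) (t : ℝ) (N : ℕ) :
    0 < ∫ ω, Real.exp (t * Y N ω) ∂P :=
  integral_exp_pos (h.integrable t N)

theorem eventually_moment_le (h : HasLogMoment P Y B Λ) {t c : ℝ} (hc : Λ t < c) :
    ∀ᶠ N : ℕ in atTop, ∫ ω, Real.exp (t * Y N ω) ∂P ≤ Real.exp (c * N) := by
  filter_upwards [(h.tendsto t).eventually (gt_mem_nhds hc), eventually_gt_atTop 0] with N hN h0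
  have h0' : (0 : ℝ) < N := by exact_mod_cast h0
  rw [← Real.log_le_iff_le_exp (h.moment_pos t N)]
  rw [one_div, inv_mul_lt_iff₀ h0'] at hN
  linarith

theorem eventually_le_moment (h : HasLogMoment P Y B Λ) {t c : ℝ} (hc : c < Λ t) :
    ∀ᶠ N : ℕ in atTop, Real.exp (c * N) ≤ ∫ ω, Real.exp (t * Y N ω) ∂P := by
  filter_upwards [(h.tendsto t).eventually (lt_mem_nhds hc), eventually_gt_atTop 0] with N hN h0
  have h0' : (0 : ℝ) < N := by exact_mod_cast h0
  rw [← Real.le_log_iff_exp_le (h.moment_pos t N)]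
  rw [one_div, lt_inv_mul_iff₀ h0'] at hN
  linarith

theorem apply_zero (h : HasLogMoment P Y B Λ) : Λ 0 = 0 := by
  refine tendsto_nhds_unique (h.tendsto 0) ?_
  simp

/-- The exponential Markov inequality, near a single point. -/
theorem exists_nhds_prob_le (h : HasLogMoment P Y B Λ) {u α : ℝ} (hα : (α : EReal) < legendre Λ u) :
    ∃ V ∈ 𝓝 u, ∀ᶠ N : ℕ in atTop, P.real {ω | Y N ω / N ∈ V} ≤ Real.exp (-α * N) := by
  obtain ⟨t, ht⟩ := lt_iSup_iff.1 hα
  have ht' : α < t * u - Λ t := by exact_mod_cast ht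
  obtain ⟨β, hβ1, hβ2⟩ := exists_between ht'
  have hVo : IsOpen {v : ℝ | β + Λ t < t * v} := isOpen_lt continuous_const (by fun_prop)
  refine ⟨{v | β + Λ t < t * v}, hVo.mem_nhds (by simp only [Set.mem_ofPred_eq]; linarith), ?_⟩
  filter_upwards [h.eventually_moment_le (t := t) (c := Λ t + (β - α)) (by linarith),
    eventually_gt_atTop 0] with N hN h0
  have h0' : (0 : ℝ) < N := by exact_mod_cast h0
  have hsub : {ω | Y N ω / N ∈ {v : ℝ | β + Λ t < t * v}} ⊆
      {ω | Real.exp ((β + Λ t) * N) ≤ Real.exp (t * Y N ω)} := by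
    intro ω hω
    simp only [Set.mem_ofPred_eq] at hω ⊢
    rw [← mul_div_assoc, lt_div_iff₀ h0'] at hω
    exact Real.exp_le_exp.2 hω.le
  have hmarkov := mul_meas_ge_le_integral_of_nonneg (μ := P)
    (ae_of_all _ fun ω => (Real.exp_pos (t * Y N ω)).le) (h.integrable t N)
    (Real.exp ((β + Λ t) * N))
  have h1 : Real.exp ((β + Λ t) * N) * P.real {ω | Y N ω / N ∈ {v : ℝ | β + Λ t < t * v}} ≤
      Real.exp ((Λ t + (β - α)) * N) :=
    (mul_le_mul_of_nonneg_left (measureReal_mono hsub) (Real.exp_pos _).le).trans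
      (hmarkov.trans hN)
  have h2 : Real.exp ((Λ t + (β - α)) * N) = Real.exp ((β + Λ t) * N) * Real.exp (-α * N) := by
    rw [← Real.exp_add]; ring_nf
  rw [h2] at h1
  exact le_of_mul_le_mul_left h1 (Real.exp_pos _)

theorem exists_prob_le_of_isCompact (h : HasLogMoment P Y B Λ) {K : Set ℝ} (hK : IsCompact K)
    {α : ℝ} (hα : ∀ u ∈ K, (α : EReal) < legendre Λ u) :
    ∃ c : ℝ, ∀ᶠ N : ℕ in atTop, P.real {ω | Y N ω / N ∈ K} ≤ c * Real.exp (-α * N) := by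
  refine hK.induction_on
    (p := fun s => ∃ c : ℝ, ∀ᶠ N : ℕ in atTop, P.real {ω | Y N ω / N ∈ s} ≤ c * Real.exp (-α * N))
    ⟨0, by simp⟩ ?_ ?_ ?_
  · rintro s s' hss ⟨c, hc⟩
    exact ⟨c, hc.mono fun N hN => (measureReal_mono (Set.preimage_mono hss)).trans hN⟩
  · rintro s s' ⟨c, hc⟩ ⟨c', hc'⟩
    refine ⟨c + c', ?_⟩
    filter_upwards [hc, hc'] with N hN hN'
    rw [add_mul]
    exact (measureReal_union_le {ω | Y N ω / N ∈ s} {ω | Y N ω / N ∈ s'}).trans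
      (add_le_add hN hN')
  · intro u hu
    obtain ⟨V, hV, hVp⟩ := h.exists_nhds_prob_le (hα u hu)
    exact ⟨V, nhdsWithin_le_nhds hV, 1, by simpa using hVp⟩

theorem eventually_prob_le (h : HasLogMoment P Y B Λ) {K : Set ℝ} (hK : IsClosed K)
    {α : ℝ} (hα : (α : EReal) < ⨅ u ∈ K, legendre Λ u) :
    ∀ᶠ N : ℕ in atTop, P.real {ω | Y N ω / N ∈ K} ≤ Real.exp (-α * N) := by
  obtain ⟨β, hβ1, hβ2⟩ := EReal.lt_iff_exists_real_btwn.1 hα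
  have hαβ : α < β := by exact_mod_cast hβ1
  obtain ⟨c, hc⟩ := h.exists_prob_le_of_isCompact (K := K ∩ Set.Icc (-B) B)
    (isCompact_Icc.inter_left hK) (α := β) fun u hu => hβ2.trans_le (iInf₂_le u hu.1)
  have hexp : Tendsto (fun N : ℕ => Real.exp ((β - α) * N)) atTop atTop :=
    Real.tendsto_exp_atTop.comp (tendsto_natCast_atTop_atTop.const_mul_atTop (by linarith))
  filter_upwards [hc, hexp.eventually_ge_atTop c, eventually_gt_atTop 0] with N hN hcN h0
  have h0' : (0 : ℝ) < N := by exact_mod_cast h0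
  have hsub : {ω | Y N ω / N ∈ K} ⊆ {ω | Y N ω / N ∈ K ∩ Set.Icc (-B) B} := by
    intro ω hω
    refine ⟨hω, _root_.abs_le.1 ?_⟩
    rw [abs_div, abs_of_pos h0', div_le_iff₀ h0']
    exact h.abs_le N ω
  calc P.real {ω | Y N ω / N ∈ K} ≤ c * Real.exp (-β * N) := (measureReal_mono hsub).trans hN
    _ ≤ Real.exp ((β - α) * N) * Real.exp (-β * N) := by gcongr
    _ = Real.exp (-α * N) := by rw [← Real.exp_add]; ring_nf

/-- Under the weight `exp (t Y)`, the half line beyond `v` is negligible as soon as the slope of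
`Λ` between `t` and `t + s` is smaller than `v` (for `s > 0`, and larger for `s < 0`). -/
theorem eventually_tail_le (h : HasLogMoment P Y B Λ) {t s v : ℝ} (hs : Λ (t + s) < Λ t + s * v) :
    ∀ᶠ N : ℕ in atTop, ∫ ω in {ω | s * (v * N) ≤ s * Y N ω}, Real.exp (t * Y N ω) ∂P ≤
      1 / 4 * ∫ ω, Real.exp (t * Y N ω) ∂P := by
  obtain ⟨η, hη0, hη⟩ : ∃ η : ℝ, 0 < η ∧ Λ (t + s) + η - s * v < Λ t - 2 * η := by
    refine ⟨(Λ t + s * v - Λ (t + s)) / 4, by linarith, by linarith⟩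
  have hexp : Tendsto (fun N : ℕ => Real.exp (η * N)) atTop atTop :=
    Real.tendsto_exp_atTop.comp (tendsto_natCast_atTop_atTop.const_mul_atTop hη0)
  filter_upwards [h.eventually_moment_le (t := t + s) (c := Λ (t + s) + η) (by linarith),
    h.eventually_le_moment (t := t) (c := Λ t - η) (by linarith), hexp.eventually_ge_atTop 4]
    with N h1 h2 h4
  have hpt : ∀ ω ∈ {ω | s * (v * N) ≤ s * Y N ω}, Real.exp (t * Y N ω) ≤
      Real.exp (-(s * (v * N))) * Real.exp ((t + s) * Y N ω) := by
    intro ω hω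
    rw [← Real.exp_add]
    simp only [Set.mem_ofPred_eq] at hω
    exact Real.exp_le_exp.2 (by linarith)
  have hms : MeasurableSet {ω | s * (v * N) ≤ s * Y N ω} :=
    measurableSet_le measurable_const ((h.measurable N).const_mul s)
  have hint := (h.integrable (t + s) N).const_mul (Real.exp (-(s * (v * N))))
  calc ∫ ω in {ω | s * (v * N) ≤ s * Y N ω}, Real.exp (t * Y N ω) ∂P
      ≤ ∫ ω in {ω | s * (v * N) ≤ s * Y N ω},
          Real.exp (-(s * (v * N))) * Real.exp ((t + s) * Y N ω) ∂P :=
        setIntegral_mono_on (h.integrable t N).integrableOn hint.integrableOn hms hpt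
    _ ≤ ∫ ω, Real.exp (-(s * (v * N))) * Real.exp ((t + s) * Y N ω) ∂P :=
        setIntegral_le_integral hint (ae_of_all _ fun ω => by positivity)
    _ = Real.exp (-(s * (v * N))) * ∫ ω, Real.exp ((t + s) * Y N ω) ∂P := integral_const_mul _ _
    _ ≤ Real.exp (-(s * (v * N))) * Real.exp ((Λ (t + s) + η) * N) := by gcongr
    _ = Real.exp ((Λ (t + s) + η - s * v) * N) := by rw [← Real.exp_add]; ring_nf
    _ ≤ Real.exp ((Λ t - 2 * η) * N) := by gcongr
    _ = Real.exp (-(η * N)) * Real.exp ((Λ t - η) * N) := by rw [← Real.exp_add]; ring_nf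
    _ ≤ 1 / 4 * ∫ ω, Real.exp (t * Y N ω) ∂P := by
        refine mul_le_mul ?_ h2 (Real.exp_pos _).le (by norm_num)
        rw [Real.exp_neg, ← one_div]
        exact one_div_le_one_div_of_le (by norm_num) h4

/-- The lower bound near an exposed point `u = Λ'(t)`. -/
theorem eventually_le_prob_of_hasDerivAt (h : HasLogMoment P Y B Λ) {t u α : ℝ}
    (hd : HasDerivAt Λ u t) (hα : t * u - Λ t < α) {U : Set ℝ} (hU : U ∈ 𝓝 u) :
    ∀ᶠ N : ℕ in atTop, Real.exp (-α * N) ≤ P.real {ω | Y N ω / N ∈ U} := by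
  obtain ⟨ρ, hρ0, hρ⟩ := Metric.mem_nhds_iff.1 hU
  obtain ⟨η, hη0, hη⟩ : ∃ η : ℝ, 0 < η ∧ t * u - Λ t + 4 * η < α :=
    ⟨(α - (t * u - Λ t)) / 8, by linarith, by linarith⟩
  obtain ⟨ε, hε0, hερ, hεη⟩ : ∃ ε : ℝ, 0 < ε ∧ ε ≤ ρ ∧ |t| * ε ≤ η := by
    refine ⟨min ρ (η / (|t| + 1)), by positivity, min_le_left _ _, ?_⟩
    calc |t| * min ρ (η / (|t| + 1)) ≤ (|t| + 1) * (η / (|t| + 1)) := by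
          gcongr
          · linarith
          · exact min_le_right _ _
      _ = η := by field_simp
  -- small increments on both sides of `t`
  have hlin := (hasDerivAt_iff_isLittleO_nhds_zero.1 hd).def (half_pos hε0)
  obtain ⟨σ, hσ0, hσ⟩ := Metric.eventually_nhds_iff.1 hlin
  have hσ2 : σ / 2 < σ := by linarith
  have hright : Λ (t + σ / 2) < Λ t + σ / 2 * (u + ε) := by
    have := hσ (y := σ / 2) (by rw [dist_zero_right, Real.norm_of_nonneg (by linarith)]; exact hσ2)
    rw [Real.norm_eq_abs, Real.norm_of_nonneg (by linarith : 0 ≤ σ / 2), smul_eq_mul] at this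
    have := (_root_.abs_le.1 this).2
    nlinarith [mul_pos hσ0 hε0]
  have hleft : Λ (t + -(σ / 2)) < Λ t + -(σ / 2) * (u - ε) := by
    have := hσ (y := -(σ / 2)) (by
      rw [dist_zero_right, norm_neg, Real.norm_of_nonneg (by linarith)]; exact hσ2)
    rw [Real.norm_eq_abs, norm_neg, Real.norm_of_nonneg (by linarith : 0 ≤ σ / 2),
      smul_eq_mul] at this
    have := (_root_.abs_le.1 this).2
    nlinarith [mul_pos hσ0 hε0]
  have hexp : Tendsto (fun N : ℕ => Real.exp (η * N)) atTop atTop :=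
    Real.tendsto_exp_atTop.comp (tendsto_natCast_atTop_atTop.const_mul_atTop hη0)
  filter_upwards [h.eventually_tail_le hright, h.eventually_tail_le hleft,
    h.eventually_le_moment (t := t) (c := Λ t - η) (by linarith), hexp.eventually_ge_atTop 2,
    eventually_gt_atTop 0] with N hNr hNl hNm hN2 h0
  have h0' : (0 : ℝ) < N := by exact_mod_cast h0
  set Ar := {ω | σ / 2 * ((u + ε) * N) ≤ σ / 2 * Y N ω} with hAr
  set Al := {ω | -(σ / 2) * ((u - ε) * N) ≤ -(σ / 2) * Y N ω} with hAl
  set A := {ω | Y N ω / N ∈ Metric.ball u ε} with hA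
  have hAm : MeasurableSet A := h.measurableSet_div_mem N Metric.isOpen_ball.measurableSet
  have hcover : Aᶜ ⊆ Ar ∪ Al := by
    intro ω hω
    simp only [hA, Set.mem_compl_iff, Set.mem_ofPred_eq, Metric.mem_ball, Real.dist_eq, not_lt] at hω
    rcases le_abs.1 hω with h1 | h1
    · left
      have h2 : u + ε ≤ Y N ω / N := by linarith
      rw [le_div_iff₀ h0'] at h2
      exact mul_le_mul_of_nonneg_left h2 (by linarith)
    · right
      have h2 : Y N ω / N ≤ u - ε := by linarith
      rw [div_le_iff₀ h0'] at h2
      exact mul_le_mul_of_nonpos_left h2 (by linarith)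
  have hint := h.integrable t N
  set m := ∫ ω, Real.exp (t * Y N ω) ∂P with hm
  have hcompl : ∫ ω in Aᶜ, Real.exp (t * Y N ω) ∂P ≤ 1 / 2 * m := by
    have hArm : MeasurableSet Ar := measurableSet_le measurable_const ((h.measurable N).const_mul _)
    have hAlm : MeasurableSet Al := measurableSet_le measurable_const ((h.measurable N).const_mul _)
    have hnn : ∀ ω, 0 ≤ Real.exp (t * Y N ω) := fun ω => (Real.exp_pos _).le
    have h1 : ∫ ω in Aᶜ, Real.exp (t * Y N ω) ∂P ≤ ∫ ω in Ar ∪ Al, Real.exp (t * Y N ω) ∂P :=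
      setIntegral_mono_set hint.integrableOn (ae_of_all _ hnn) hcover.eventuallyLE
    have h2 : ∫ ω in Ar ∪ Al, Real.exp (t * Y N ω) ∂P ≤
        ∫ ω in Ar, Real.exp (t * Y N ω) ∂P + ∫ ω in Al, Real.exp (t * Y N ω) ∂P := by
      rw [← integral_add_measure hint.integrableOn hint.integrableOn]
      exact integral_mono_measure (Measure.restrict_union_le _ _) (ae_of_all _ hnn)
        ((hint.mono_measure Measure.restrict_le_self).add_measure
          (hint.mono_measure Measure.restrict_le_self))
    linarith
  have hmain : 1 / 2 * m ≤ Real.exp ((t * u + η) * N) * P.real A := by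
    have h1 : ∫ ω in A, Real.exp (t * Y N ω) ∂P + ∫ ω in Aᶜ, Real.exp (t * Y N ω) ∂P = m :=
      integral_add_compl hAm hint
    have h2 : ∫ ω in A, Real.exp (t * Y N ω) ∂P ≤ ∫ _ in A, Real.exp ((t * u + η) * N) ∂P := by
      refine setIntegral_mono_on hint.integrableOn (integrable_const _).integrableOn hAm
        fun ω hω => Real.exp_le_exp.2 ?_
      have h3 : |Y N ω / N - u| < ε := hω
      have h4 : t * (Y N ω / N - u) ≤ η := by
        refine (le_abs_self _).trans ?_
        rw [abs_mul]
        exact (mul_le_mul_of_nonneg_left h3.le (abs_nonneg t)).trans hεη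
      have h5 : t * Y N ω = (t * u + t * (Y N ω / N - u)) * N := by field_simp; ring
      rw [h5]
      gcongr
    rw [setIntegral_const, smul_eq_mul, mul_comm] at h2
    linarith
  have hfinal : Real.exp (-α * N) ≤ P.real A := by
    refine le_of_mul_le_mul_left ?_ (Real.exp_pos ((t * u + η) * N))
    refine le_trans ?_ hmain
    calc Real.exp ((t * u + η) * N) * Real.exp (-α * N)
        = Real.exp ((t * u + η - α) * N) := by rw [← Real.exp_add]; ring_nf
      _ ≤ Real.exp ((Λ t - 2 * η) * N) :=
          Real.exp_le_exp.2 (mul_le_mul_of_nonneg_right (by linarith) h0'.le)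
      _ = Real.exp (-(η * N)) * Real.exp ((Λ t - η) * N) := by rw [← Real.exp_add]; ring_nf
      _ ≤ 1 / 2 * m := by
          refine mul_le_mul ?_ hNm (Real.exp_pos _).le (by norm_num)
          rw [Real.exp_neg, ← one_div]
          exact one_div_le_one_div_of_le (by norm_num) hN2
  exact hfinal.trans (measureReal_mono fun ω hω => hρ (Metric.ball_subset_ball hερ hω))

/-- The tangent of `Λ` at the origin lies below `Λ`. -/
theorem mul_deriv_zero_le (h : HasLogMoment P Y B Λ) {u₀ : ℝ} (hd : HasDerivAt Λ u₀ 0) (t : ℝ) :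
    t * u₀ ≤ Λ t := by
  by_contra! hlt
  obtain ⟨α, hα0, hα⟩ := exists_between (sub_pos.2 hlt)
  have hα' : (α : EReal) < legendre Λ u₀ :=
    lt_of_lt_of_le (by exact_mod_cast hα) (le_legendre Λ u₀ t)
  obtain ⟨V, hV, hupp⟩ := h.exists_nhds_prob_le hα'
  have hlow := h.eventually_le_prob_of_hasDerivAt hd (α := α / 2)
    (by rw [h.apply_zero]; linarith) hV
  obtain ⟨N, h1, h2, h0⟩ := (hupp.and (hlow.and (eventually_gt_atTop 0))).exists
  have h0' : (0 : ℝ) < N := by exact_mod_cast h0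
  have h3 := Real.exp_le_exp.1 (h2.trans h1)
  nlinarith

/-- Points of finite rate are limits of exposed points of at most the same rate. -/
theorem exists_exposed (h : HasLogMoment P Y B Λ) (hΛ : Differentiable ℝ Λ) {u c : ℝ}
    (hu : ∀ t, t * u - Λ t ≤ c) {U : Set ℝ} (hU : U ∈ 𝓝 u) :
    ∃ t w, w ∈ U ∧ HasDerivAt Λ w t ∧ t * w - Λ t ≤ c := by
  set u₀ := deriv Λ 0 with hu₀
  have hd : HasDerivAt Λ u₀ 0 := (hΛ 0).hasDerivAt
  have htan := h.mul_deriv_zero_le hd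
  have hc : 0 ≤ c := by simpa [h.apply_zero] using hu 0
  rcases eq_or_ne u u₀ with heq | hne
  · exact ⟨0, u, mem_of_mem_nhds hU, heq ▸ hd, hu 0⟩
  -- a point `w` strictly between `u` and `u₀`, close to `u`
  obtain ⟨s, hs0, hs1, hsU⟩ : ∃ s : ℝ, 0 < s ∧ s < 1 ∧ u + s * (u₀ - u) ∈ U := by
    have hcont : Tendsto (fun s : ℝ => u + s * (u₀ - u)) (𝓝 0) (𝓝 (u + 0 * (u₀ - u))) :=
      Continuous.tendsto (by fun_prop) 0
    rw [zero_mul, add_zero] at hcont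
    have e3 : ∀ᶠ s : ℝ in 𝓝[>] 0, 0 < s := self_mem_nhdsWithin
    have e4 : ∀ᶠ s : ℝ in 𝓝 0, s < 1 := gt_mem_nhds one_pos
    obtain ⟨s, h1, h2, h3⟩ := (((hcont.eventually_mem hU).filter_mono nhdsWithin_le_nhds).and
      (e3.and (e4.filter_mono nhdsWithin_le_nhds))).exists
    exact ⟨s, h2, h3, h1⟩
  set w := u + s * (u₀ - u) with hw
  -- `t ↦ Λ t - t w` is coercive, so it has a minimum
  set k := min s (1 - s) * |u - u₀| with hk
  have hk0 : 0 < k := mul_pos (lt_min hs0 (by linarith)) (abs_pos.2 (sub_ne_zero.2 hne))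
  have hcoer : ∀ t, k * |t| - c ≤ Λ t - t * w := by
    intro t
    have h1 : s * (t * (u - u₀)) - c ≤ Λ t - t * w := by
      have := hu t
      rw [hw]
      linarith
    have h2 : (1 - s) * -(t * (u - u₀)) ≤ Λ t - t * w := by
      have := htan t
      rw [hw]
      linarith
    have h3 : k * |t| = min s (1 - s) * |t * (u - u₀)| := by rw [hk, abs_mul]; ring
    rw [h3]
    rcases abs_cases (t * (u - u₀)) with ⟨h4, h5⟩ | ⟨h4, h5⟩ <;> rw [h4]
    · refine le_trans ?_ h1
      gcongr
      exact min_le_left _ _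
    · refine le_trans ?_ h2
      have := mul_le_mul_of_nonneg_right (min_le_right s (1 - s)) (by linarith : 0 ≤ -(t * (u - u₀)))
      linarith
  have hlim : Tendsto (fun t => Λ t - t * w) (cocompact ℝ) atTop := by
    refine tendsto_atTop_mono hcoer ?_
    exact tendsto_atTop_add_const_right _ (-c)
      ((tendsto_norm_cocompact_atTop (E := ℝ)).const_mul_atTop hk0)
  have hcont : Continuous fun t => Λ t - t * w := hΛ.continuous.sub (by fun_prop)
  obtain ⟨t, ht⟩ := hcont.exists_forall_le hlim
  have hderiv : HasDerivAt (fun t => Λ t - t * w) (deriv Λ t - w) t := by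
    have := (hΛ t).hasDerivAt.fun_sub ((hasDerivAt_id' t).mul_const w)
    rwa [one_mul] at this
  have hzero : deriv Λ t - w = 0 :=
    IsLocalMin.hasDerivAt_eq_zero (Eventually.of_forall ht) hderiv
  refine ⟨t, w, hsU, ?_, ?_⟩
  · rw [← sub_eq_zero.1 hzero]
    exact (hΛ t).hasDerivAt
  · have h1 : t * w - Λ t = (1 - s) * (t * u - Λ t) + s * (t * u₀ - Λ t) := by rw [hw]; ring
    rw [h1]
    have h2 := mul_le_mul_of_nonneg_left (hu t) (by linarith : 0 ≤ 1 - s)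
    have h3 : s * (t * u₀ - Λ t) ≤ 0 :=
      mul_nonpos_of_nonneg_of_nonpos hs0.le (sub_nonpos.2 (htan t))
    nlinarith

theorem eventually_le_prob (h : HasLogMoment P Y B Λ) (hΛ : Differentiable ℝ Λ) {u α : ℝ}
    (hα : legendre Λ u < α) {U : Set ℝ} (hU : IsOpen U) (huU : u ∈ U) :
    ∀ᶠ N : ℕ in atTop, Real.exp (-α * N) ≤ P.real {ω | Y N ω / N ∈ U} := by
  obtain ⟨c, hc1, hc2⟩ := EReal.lt_iff_exists_real_btwn.1 hα
  have hc : ∀ t, t * u - Λ t ≤ c := fun t => by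
    exact_mod_cast (le_legendre Λ u t).trans hc1.le
  obtain ⟨t, w, hw, hd, hle⟩ := h.exists_exposed hΛ hc (hU.mem_nhds huU)
  exact h.eventually_le_prob_of_hasDerivAt hd (hle.trans_lt (by exact_mod_cast hc2))
    (hU.mem_nhds hw)

/-- The upper large deviation bound. -/
theorem limsup_le (h : HasLogMoment P Y B Λ) {K : Set ℝ} (hK : IsClosed K) :
    limsup (fun N : ℕ => ENNReal.log (P {ω | Y N ω / N ∈ K}) / (N : EReal)) atTop ≤
      -(⨅ u ∈ K, legendre Λ u) := by
  rw [EReal.le_neg]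
  refine EReal.ge_of_forall_gt_iff_ge.1 fun α hα => ?_
  rw [EReal.le_neg]
  refine limsup_le_of_le (by isBoundedDefault) ?_
  filter_upwards [h.eventually_prob_le hK hα, eventually_gt_atTop 0] with N hN h0
  have h1 : P {ω | Y N ω / N ∈ K} ≤ ENNReal.ofReal (Real.exp (-α * N)) := by
    rw [← ofReal_measureReal]
    exact ENNReal.ofReal_le_ofReal hN
  rw [← EReal.coe_neg, ← log_ofReal_exp_div (-α) h0]
  exact EReal.div_le_div_right_of_nonneg (by positivity) (ENNReal.log_le_log h1)

/-- The lower large deviation bound. -/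
theorem le_liminf (h : HasLogMoment P Y B Λ) (hΛ : Differentiable ℝ Λ) {U : Set ℝ}
    (hU : IsOpen U) : -(⨅ u ∈ U, legendre Λ u) ≤
      liminf (fun N : ℕ => ENNReal.log (P {ω | Y N ω / N ∈ U}) / (N : EReal)) atTop := by
  rw [EReal.neg_le]
  refine le_iInf₂ fun u hu => EReal.le_of_forall_lt_iff_le.1 fun α hα => ?_
  rw [EReal.neg_le]
  refine le_liminf_of_le (by isBoundedDefault) ?_
  filter_upwards [h.eventually_le_prob hΛ hα hU hu, eventually_gt_atTop 0] with N hN h0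
  have h1 : ENNReal.ofReal (Real.exp (-α * N)) ≤ P {ω | Y N ω / N ∈ U} := by
    rw [← ofReal_measureReal]
    exact ENNReal.ofReal_le_ofReal hN
  rw [← EReal.coe_neg, ← log_ofReal_exp_div (-α) h0]
  exact EReal.div_le_div_right_of_nonneg (by positivity) (ENNReal.log_le_log h1)

end HasLogMoment

end GartnerEllis

/-! ### The family of multiples of a single function -/

section Multiples

variable {M : Type*} [MeasurableSpace M] {κ : Kernel M M} [IsMarkovKernel κ] {m : ℕ}
  {q : Fin (m + 1) → ℝ → ℝ} {n₀ : ℕ} {C : ℝ≥0} {ν μ : Measure M} [IsProbabilityMeasure ν]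
  [IsProbabilityMeasure μ] {Ω : Type*} [MeasurableSpace Ω] {P : Measure Ω}
  [IsProbabilityMeasure P] {X : ℕ → Ω → M}

theorem nonconvSum_smul (F : BM (Fin (m + 1) → M) ℝ) (t : ℝ) (N : ℕ) (path : ℕ → M) :
    nonconvSum q (t • F : BM (Fin (m + 1) → M) ℝ) N path = t * nonconvSum q F N path := by
  simp only [nonconvSum, BM.smul_apply, Finset.mul_sum]

theorem DoeblinBound.differentiable_log_lead_smul (hC : 0 < C)
    (hκ : DoeblinBound κ n₀ C ν) (F : BM (Fin (m + 1) → M) ℝ) :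
    Differentiable ℝ fun t : ℝ => Real.log (lead μ κ (t • F)) := by
  intro t₀
  refine DoeblinBound.differentiableAt_log_lead μ hC hκ (W := fun t => t • F) ?_ ?_
  · intro z
    simp only [BM.smul_apply]
    fun_prop
  · refine ⟨‖F‖, Eventually.of_forall fun t z => ?_⟩
    rw [BM.smul_apply, BM.smul_apply, ← sub_mul, abs_mul, mul_comm]
    exact mul_le_mul_of_nonneg_right (BM.norm_apply_le F z) (abs_nonneg _)

theorem IsMarkovChain.hasLogMoment (hX : IsMarkovChain κ X P) (hq : IsSamplingTimes q)
    (hC : 0 < C) (hκ : DoeblinBound κ n₀ C ν) (hμ : κ.Invariant μ)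
    (F : BM (Fin (m + 1) → M) ℝ) :
    HasLogMoment P (fun N ω => nonconvSum q F N fun n => X n ω) ‖F‖
      fun t => Real.log (lead μ κ (t • F)) where
  measurable N := (measurable_nonconvSum F N).comp hX.measurable_path
  abs_le N ω := abs_nonconvSum_le F N _
  tendsto t := by
    simpa only [nonconvSum_smul] using hX.tendsto_log_moment hq hC hκ hμ (t • F)

theorem DoeblinBound.rate_eq_legendre (hC : 0 < C) (hκ : DoeblinBound κ n₀ C ν)
    (F : BM (Fin (m + 1) → M) ℝ) (u : ℝ) :
    rate κ μ F u = legendre (fun t => Real.log (lead μ κ (t • F))) u := by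
  simp only [rate, legendre, DoeblinBound.log_specRad μ hC hκ, EReal.coe_sub]

end Multiples

end NonconvLD

open NonconvLD in
theorem theorem2p1 {M : Type*} [MeasurableSpace M] [StandardBorelSpace M]
    (κ : Kernel M M) [IsMarkovKernel κ] (hκ : StrongDoeblin κ)
    {m : ℕ} (q : Fin (m + 1) → ℝ → ℝ) (hq : IsSamplingTimes q) :
    (∃! μ : Measure M, IsProbabilityMeasure μ ∧ κ.Invariant μ) ∧
    ∀ (μ : Measure M) [IsProbabilityMeasure μ], κ.Invariant μ →
      (∀ W : ℝ → BM (Fin (m + 1) → M) ℝ,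
        (∀ x, Differentiable ℝ (fun l => W l x)) →
        (∀ l₀ : ℝ, ∃ C : ℝ, ∀ᶠ l in 𝓝 l₀, ∀ x, |W l x - W l₀ x| ≤ C * |l - l₀|) →
        ∃ Q : ℝ → ℝ,
          (∀ (l : ℝ) (x : M), Tendsto
            (fun N : ℕ => (1 / (N : ℝ)) *
              Real.log (∫ path, Real.exp (nonconvSum q (W l) N path) ∂(pathLaw κ x)))
            atTop (𝓝 (Q l))) ∧
          Differentiable ℝ Q ∧
          ∀ l : ℝ, ((Q l : ℝ) : EReal) = ENNReal.log (specRad κ μ (W l))) ∧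
      (∀ (F : BM (Fin (m + 1) → M) ℝ)
        (Ω : Type*) [MeasurableSpace Ω] (P : Measure Ω) [IsProbabilityMeasure P]
        (X : ℕ → Ω → M), IsMarkovChain κ X P →
        (∀ K : Set ℝ, IsClosed K →
          limsup (fun N : ℕ => ENNReal.log
            (P {ω | nonconvSum q F N (fun n => X n ω) / N ∈ K}) / (N : EReal)) atTop
            ≤ -(⨅ u ∈ K, rate κ μ F u)) ∧
        (∀ U : Set ℝ, IsOpen U →
          -(⨅ u ∈ U, rate κ μ F u) ≤
          liminf (fun N : ℕ => ENNReal.log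
            (P {ω | nonconvSum q F N (fun n => X n ω) / N ∈ U}) / (N : EReal)) atTop)) := by
  obtain ⟨n₀, -, C, hC, ν, hν, hκ'⟩ := hκ
  have hD : DoeblinBound κ n₀ C ν := hκ'
  refine ⟨?_, fun μ _ hμ => ⟨fun W hdiff hLip => ?_, fun F Ω _ P _ X hX => ?_⟩⟩
  · obtain ⟨μ, hμp, hμ⟩ := hD.exists_invariant hC
    refine ⟨μ, ⟨hμp, hμ⟩, fun μ' hμ' => ?_⟩
    have := hμ'.1
    exact DoeblinBound.invariant_unique hC hD hμ'.2 hμ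
  · refine ⟨fun l => Real.log (lead μ κ (W l)), fun l x => ?_, fun l => ?_, fun l => ?_⟩
    · exact (isMarkovChain_pathLaw x).tendsto_log_moment hq hC hD hμ (W l)
    · exact DoeblinBound.differentiableAt_log_lead μ hC hD (fun z => hdiff z l) (hLip l)
    · exact (hD.log_specRad μ hC (W l)).symm
  · have hlog := hX.hasLogMoment hq hC hD hμ F
    simp only [DoeblinBound.rate_eq_legendre hC hD]
    exact ⟨fun K hK => hlog.limsup_le hK,
      fun U hU => hlog.le_liminf (DoeblinBound.differentiable_log_lead_smul hC hD F) hU⟩
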